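/- Let $N\ge 1$, $R>0$, $p>1$, $\mu^*=\frac{2(p+1)}{(p-1)^2}$, $-\mu^*<\mu<\frac14$, $\mu\neq 0$, $\beta_-=\frac12-\sqrt{\frac14-\mu}$, and for $\rho>0$ let $B_\rho=\{x\in\mathbb R^N:|x|<\rho\}$. Consider positive classical ($C^2$) solutions of $$\Delta u+\frac{\mu}{\delta(x)^2}\,u=u^p,\qquad(\ast)$$ where $\delta(x)=R-|x|$ is the distance of $x\in B_R$ to $\partial B_R$. A radial solution in $B_\rho$ ($0<\rho\le R$) is a positive solution $u$ of $(\ast)$ in $B_\rho$ that depends only on $r=|x|$; we write $u(r)$ for $u(x)$, so that $u(0)$ is its value at the centre. There is a number $u^*>0$ with the following properties. (i) For every $a\in(0,u^*]$ there is exactly one radial solution $u$ of $(\ast)$ in $B_R$ with $u(0)=a$. For every $a>u^*$ the radial solution with $u(0)=a$ blows up before $R$: there are $\rho\in(0,R)$ and a radial solution $u$ in $B_\rho$ with $u(0)=a$ and $u(r)\to+\infty$ as $r\to\rho^-$, and every radial solution $v$ in a ball $B_\sigma$, $0<\sigma\le R$, with $v(0)=a$ satisfies $\sigma\le\rho$ and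 $v=u$ in $B_\sigma$. In particular, a radial solution in $B_R$ with central value $a>0$ exists if and only if $a\le u^*$. (ii) If $u$ is a radial solution in $B_R$ with $u(0)<u^*$, then $\lim_{r\to R^-}\frac{u(r)}{(R-r)^{\beta_-}}=c$ for some $c\in(0,\infty)$. Vice versa, for every $c>0$ there is exactly one radial solution in $B_R$ satisfying this condition, and it has $u(0)<u^*$. (iii) If $u$ is the radial solution in $B_R$ with $u(0)=u^*$, then $$\lim_{r\to R^-}\frac{u(r)}{(R-r)^{-\frac{2}{p-1}}}=(\mu+\mu^*)^{\frac1{p-1}}.$$ Moreover $u$ is the maximal solution, that is, $v\le u$ in $B_R$ for every positive solution $v$ of $(\ast)$ in $B_R$, radial or not; and it is the only positive solution $v$ of $(\ast)$ in $B_R$, radial or not, with $v(x)/(R-|x|)^{-\frac{2}{p-1}}\to(\mu+\mu^*)^{\frac1{p-1}}$ as $|x|\to R$. -/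

import Mathlib

open Filter Topology Set Metric

noncomputable section

namespace HardyProblem

/-- The distance `δ(x)` of a point `x` to the boundary of `Ω`. -/
def boundaryDist {N : ℕ} (Ω : Set (EuclideanSpace ℝ (Fin N)))
    (x : EuclideanSpace ℝ (Fin N)) : ℝ :=
  Metric.infDist x (frontier Ω)

/-- The operator `L_μ u = Δ u + μ / δ² u`, with `δ` the distance to the boundary of `Ω`. -/
def hardyOp {N : ℕ} (μ : ℝ) (Ω : Set (EuclideanSpace ℝ (Fin N)))
    (u : EuclideanSpace ℝ (Fin N) → ℝ) (x : EuclideanSpace ℝ (Fin N)) : ℝ :=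
  Laplacian.laplacian u x + μ / boundaryDist Ω x ^ 2 * u x

/-- `u` is a positive classical solution of `L_μ u = u ^ p` in the open set `G ⊆ Ω`; the Hardy
potential is that of `Ω`.  Values of `u` outside `G` play no role. -/
structure IsPositiveSolutionOn {N : ℕ} (μ p : ℝ) (Ω G : Set (EuclideanSpace ℝ (Fin N)))
    (u : EuclideanSpace ℝ (Fin N) → ℝ) : Prop where
  contDiffOn : ContDiffOn ℝ 2 u G
  pos : ∀ x ∈ G, 0 < u x
  equation : ∀ x ∈ G, hardyOp μ Ω u x = u x ^ p

/-- `u` is radial on the ball of radius `ρ` about the origin: `u x` depends only on `‖x‖`. -/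
def IsRadialOn {N : ℕ} (ρ : ℝ) (u : EuclideanSpace ℝ (Fin N) → ℝ) : Prop :=
  ∀ x ∈ ball (0 : EuclideanSpace ℝ (Fin N)) ρ, ∀ y ∈ ball (0 : EuclideanSpace ℝ (Fin N)) ρ,
    ‖x‖ = ‖y‖ → u x = u y

/-- `u` is a positive radial solution, in the ball `B_ρ`, of the equation `L_μ u = u ^ p` whose
Hardy potential is that of the ball `B_R` (`ρ ≤ R`). -/
def IsRadialSolution {N : ℕ} (R μ p ρ : ℝ) (u : EuclideanSpace ℝ (Fin N) → ℝ) : Prop :=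
  IsPositiveSolutionOn μ p (ball 0 R) (ball 0 ρ) u ∧ IsRadialOn ρ u

/-- The filter `‖x‖ → ρ` with `‖x‖ < ρ`. -/
def toSphere (N : ℕ) (ρ : ℝ) : Filter (EuclideanSpace ℝ (Fin N)) :=
  comap (fun x => ‖x‖) (𝓝[<] ρ)

/-- `μ* = 2 (p + 1) / (p - 1)²`. -/
def muStar (p : ℝ) : ℝ := 2 * (p + 1) / (p - 1) ^ 2

/-- `β₋ = 1/2 - √(1/4 - μ)`. -/
def betaMinus (μ : ℝ) : ℝ := 1 / 2 - Real.sqrt (1 / 4 - μ)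

/-- `u(x) / (R - |x|)^β₋ → c` as `|x| → R`. -/
def HasLinearBoundaryLimit {N : ℕ} (R μ : ℝ) (u : EuclideanSpace ℝ (Fin N) → ℝ) (c : ℝ) : Prop :=
  Tendsto (fun x => u x / (R - ‖x‖) ^ betaMinus μ) (toSphere N R) (𝓝 c)

/-- `u(x) / (R - |x|)^(-2/(p-1)) → (μ + μ*)^(1/(p-1))` as `|x| → R`. -/
def HasSingularBoundaryLimit {N : ℕ} (R μ p : ℝ) (u : EuclideanSpace ℝ (Fin N) → ℝ) : Prop :=
  Tendsto (fun x => u x / (R - ‖x‖) ^ (-(2 / (p - 1)))) (toSphere N R)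
    (𝓝 ((μ + muStar p) ^ (1 / (p - 1))))

end HardyProblem

end

/-! Write a radial solution as u = ψ w with the weight ψ = (R² - r²)^b, b = max(β₋, 0). This choice
makes V = -L_μ ψ / ψ nonnegative on [0, R), so (r^(N-1) ψ² w')' = r^(N-1) ψ² (V w + ψ^(p-1) w^p)
turns into an integral equation with a monotone right-hand side. Its least fixed point among [0,
∞]-valued functions (`profile`) exists for every central value, and blow-up is merely the value ∞.
Every supersolution lies above the least fixed point, so the dependence of the profile U_a on a is
read off from suitable supersolutions: monotonicity, U_a ≤ (a / a') U_a' for a ≤ a' (`U_ratio`),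
convexity (`U_convex`), a local Lipschitz bound (`U_lipschitz`) and continuation. Uniqueness comes
from a maximum principle for the ratio of two solutions (`ratio_le_one`): an arbitrary radial
solution is squeezed between profiles with slightly larger and slightly smaller central values
(`radial_unique`).

For the boundary behavior put t = -log(R - r) and Y = U (R - r)^α with α = 2/(p-1). Then Y'' + (2α +
1 + e) Y' + (G + α e) Y = Y^p with G = μ + μ* and e(t) → 0, and A = G^(1/(p-1)) is the equilibrium
of the limit equation. Barriers on bounded windows give a Keller–Osserman bound (`Y_le_of_window`):
global solutions are locally bounded uniformly in a, and limsup Y ≤ A. From below, explicit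
subsolutions pass from the level A to the linear rate (R - r)^β₋; they give a lower bound with
constants independent of the central value (`exists_lower_bound`).

The threshold u* is the supremum of the central values of global profiles. The uniform bound and the
Lipschitz bound show that U_{u*} is global (`life_uStar`). Profiles with a > u* blow up inside and
so overtake the level A; letting a decrease to u* in the lower bound yields Y → A for u*. A monotone
quantity shows that U / (R - r)^β₋ has a positive limit or tends to ∞ for every global profile
(`linear_or_atTop`), and in the second case again Y → A. For a < u* this is incompatible with U_a ≤
(a / u*) U_{u*}, so the limit c(a) exists. It is convex in a, hence continuous; it is strictly
increasing, takes arbitrarily small values, and is unbounded near u*, so it attains each c > 0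
exactly once. Finally, any solution in the ball, radial or not, lies below U_a on the smaller ball
where U_a blows up, for each a > u*; letting a decrease to u* gives maximality, and the ratio
principle gives uniqueness of the solution with singular boundary behavior. -/

noncomputable section

namespace HardyProblem

/-! ### Second-order conditions at extrema and the distance function of a ball. -/

section

/-- If c were positive, x would also be a local minimum, so f would be constant near x and c would
vanish. -/
theorem IsLocalMax.second_deriv_nonpos {f f' : ℝ → ℝ} {c x : ℝ} (h : IsLocalMax f x)
    (hf : ∀ᶠ y in 𝓝 x, HasDerivAt f (f' y) y) (hf' : HasDerivAt f' c x) : c ≤ 0 := by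
  by_contra! hc
  have e : deriv f =ᶠ[𝓝 x] f' := hf.mono fun y hy => hy.deriv
  have h2 : deriv (deriv f) x = c := by rw [e.deriv_eq, hf'.deriv]
  have hmin : IsLocalMin f x :=
    isLocalMin_of_deriv_deriv_pos (by rw [h2]; exact hc) h.deriv_eq_zero
      hf.self_of_nhds.continuousAt
  have hconst : f =ᶠ[𝓝 x] fun _ => f x := by
    filter_upwards [h, hmin] with y h1 h2 using le_antisymm h1 h2
  have : deriv f =ᶠ[𝓝 x] fun _ => 0 := by
    have := hconst.deriv
    simpa using this
  have h3 := this.deriv_eq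
  rw [h2] at h3
  simp at h3
  exact hc.ne' h3

theorem IsLocalMin.second_deriv_nonneg {f f' : ℝ → ℝ} {c x : ℝ} (h : IsLocalMin f x)
    (hf : ∀ᶠ y in 𝓝 x, HasDerivAt f (f' y) y) (hf' : HasDerivAt f' c x) : 0 ≤ c := by
  have := IsLocalMax.second_deriv_nonpos (f := fun y => - f y) (f' := fun y => - f' y) (c := -c)
    h.neg (hf.mono fun y hy => hy.neg) hf'.neg
  linarith

variable {N : ℕ}

theorem laplacian_nonpos_of_isLocalMax {f : EuclideanSpace ℝ (Fin N) → ℝ}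
    {x : EuclideanSpace ℝ (Fin N)} (hf : ContDiffAt ℝ 2 f x) (h : IsLocalMax f x) :
    Laplacian.laplacian f x ≤ 0 := by
  rw [InnerProductSpace.laplacian_eq_iteratedFDeriv_stdOrthonormalBasis]
  refine Finset.sum_nonpos fun i _ => ?_
  set e := stdOrthonormalBasis ℝ (EuclideanSpace ℝ (Fin N)) i with he
  rw [iteratedFDeriv_two_apply]
  simp only [Matrix.cons_val_zero, Matrix.cons_val_one]
  have hl : ∀ t : ℝ, HasDerivAt (fun t : ℝ => x + t • e) e t := fun t => by
    simpa using ((hasDerivAt_id t).smul_const e).const_add x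
  have hc : ContinuousAt (fun t : ℝ => x + t • e) 0 := (hl 0).continuousAt
  have hc' : Tendsto (fun t : ℝ => x + t • e) (𝓝 0) (𝓝 x) := by simpa [ContinuousAt] using hc
  have h1 : ∀ᶠ y in 𝓝 x, DifferentiableAt ℝ f y :=
    (hf.eventually (by simp)).mono fun y hy => hy.differentiableAt (by norm_num)
  have h2 : DifferentiableAt ℝ (fderiv ℝ f) x :=
    (hf.fderiv_right (m := 1) (by norm_num)).differentiableAt (by norm_num)
  refine IsLocalMax.second_deriv_nonpos (f := fun t : ℝ => f (x + t • e))
    (f' := fun t : ℝ => fderiv ℝ f (x + t • e) e) (x := 0) ?_ ?_ ?_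
  · have := hc'.eventually h
    simpa [IsLocalMax, IsMaxFilter] using this
  · filter_upwards [hc'.eventually h1] with t ht
    exact ht.hasFDerivAt.comp_hasDerivAt t (hl t)
  · have h2' : HasFDerivAt (fderiv ℝ f) (fderiv ℝ (fderiv ℝ f) x) (x + (0 : ℝ) • e) := by
      simpa using h2.hasFDerivAt
    have := h2'.comp_hasDerivAt (0 : ℝ) (hl 0)
    exact this.clm_apply (hasDerivAt_const (0 : ℝ) e) |>.congr_deriv (by simp)

theorem boundaryDist_ball (hN : 1 ≤ N) {R : ℝ} (hR : 0 < R) {x : EuclideanSpace ℝ (Fin N)}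
    (hx : x ∈ ball (0 : EuclideanSpace ℝ (Fin N)) R) :
    boundaryDist (ball 0 R) x = R - ‖x‖ := by
  have : Nonempty (Fin N) := ⟨⟨0, hN⟩⟩
  have hxR : ‖x‖ < R := by simpa using hx
  rw [boundaryDist, frontier_ball _ hR.ne']
  have hex : ∃ z : EuclideanSpace ℝ (Fin N), ‖z‖ = R ∧ dist x z = R - ‖x‖ := by
    by_cases h0 : x = 0
    -- At the centre every point of the sphere is nearest; the sphere is nonempty because N ≥ 1.
    -- Elsewhere the nearest point is the radial projection.
    · obtain ⟨z, hz⟩ := exists_norm_eq (EuclideanSpace ℝ (Fin N)) hR.le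
      exact ⟨z, hz, by simp [h0, hz]⟩
    · have hn : 0 < ‖x‖ := norm_pos_iff.2 h0
      refine ⟨(R / ‖x‖) • x, ?_, ?_⟩
      · rw [norm_smul, Real.norm_of_nonneg (by positivity)]; field_simp
      · have : x - (R / ‖x‖) • x = (1 - R / ‖x‖) • x := by module
        rw [dist_eq_norm, this, norm_smul, Real.norm_eq_abs, abs_of_nonpos]
        · field_simp; ring
        · rw [sub_nonpos, one_le_div hn]; exact hxR.le
  obtain ⟨z, hz, hd⟩ := hex
  refine le_antisymm ?_ ?_
  · rw [← hd]; exact infDist_le_dist_of_mem (by simpa using hz)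
  · refine (le_infDist ⟨z, by simpa using hz⟩).2 fun y hy => ?_
    have hy' : ‖y‖ = R := by simpa using hy
    have := norm_sub_norm_le y x
    rw [dist_eq_norm, norm_sub_rev, ← hy']
    exact this

end

/-! ### Calculus of radial functions. -/

section

/-- The inner product of a real inner product space as a continuous bilinear map. -/
def innerCLM (E : Type*) [NormedAddCommGroup E] [InnerProductSpace ℝ E] : E →L[ℝ] E →L[ℝ] ℝ :=
  innerSL ℝ

section Radial

variable {E : Type*} [NormedAddCommGroup E] [InnerProductSpace ℝ E]

theorem innerCLM_apply (x y : E) : innerCLM E x y = inner ℝ x y := rfl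

theorem norm_innerCLM (x : E) : ‖innerCLM E x‖ = ‖x‖ := innerSL_apply_norm ℝ x

theorem hasFDerivAt_norm {x : E} (hx : x ≠ 0) :
    HasFDerivAt (fun y : E => ‖y‖) (‖x‖⁻¹ • innerCLM E x) x := by
  have hn : ‖x‖ ≠ 0 := norm_ne_zero_iff.2 hx
  have h := ((hasStrictFDerivAt_norm_sq x).hasFDerivAt).sqrt (by positivity)
  have e : (fun y : E => √(‖y‖ ^ 2)) = fun y => ‖y‖ := by
    ext y; exact Real.sqrt_sq (norm_nonneg y)
  rw [e] at h
  refine h.congr_fderiv ?_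
  ext y
  rw [Real.sqrt_sq (norm_nonneg x)]
  simp [innerCLM_apply]
  field_simp

theorem hasFDerivAt_comp_norm {U : ℝ → ℝ} {c : ℝ} {x : E} (hx : x ≠ 0)
    (h : HasDerivAt U c ‖x‖) :
    HasFDerivAt (fun y : E => U ‖y‖) ((c / ‖x‖) • innerCLM E x) x := by
  have := h.comp_hasFDerivAt x (hasFDerivAt_norm hx)
  refine this.congr_fderiv ?_
  rw [smul_smul, div_eq_mul_inv]

theorem hasFDerivAt_radial_gradient {H : E → ℝ} {c : ℝ} {x : E}
    (h : HasFDerivAt H (c • innerCLM E x) x) :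
    HasFDerivAt (fun y : E => H y • innerCLM E y)
      (H x • innerCLM E + (c • innerCLM E x).smulRight (innerCLM E x)) x :=
  h.smul ((innerCLM E).hasFDerivAt)

/-- The gradient is the field (U'(s)/s) y with s = ‖y‖. Its derivative is a multiple of the identity
plus a rank-one term, and the trace gives the formula. -/
theorem laplacian_comp_norm {N : ℕ} {U U' : ℝ → ℝ} {c : ℝ} {x : EuclideanSpace ℝ (Fin N)}
    (hx : x ≠ 0) (hU : ∀ᶠ s in 𝓝 ‖x‖, HasDerivAt U (U' s) s) (hU' : HasDerivAt U' c ‖x‖) :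
    Laplacian.laplacian (fun y : EuclideanSpace ℝ (Fin N) => U ‖y‖) x
      = c + (N - 1) / ‖x‖ * U' ‖x‖ := by
  have hn : ‖x‖ ≠ 0 := norm_ne_zero_iff.2 hx
  have h1 : fderiv ℝ (fun y : EuclideanSpace ℝ (Fin N) => U ‖y‖) =ᶠ[𝓝 x]
      fun y => (U' ‖y‖ / ‖y‖) • innerCLM (EuclideanSpace ℝ (Fin N)) y := by
    filter_upwards [continuous_norm.continuousAt.eventually hU, isOpen_ne.mem_nhds hx]
      with y hy hy0
    exact (hasFDerivAt_comp_norm hy0 hy).fderiv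
  have h2 := hasFDerivAt_comp_norm hx (hU'.div (hasDerivAt_id ‖x‖) hn)
  have h3 := (hasFDerivAt_radial_gradient (H := fun y : EuclideanSpace ℝ (Fin N) => U' ‖y‖ / ‖y‖) h2).fderiv
  rw [InnerProductSpace.laplacian_eq_iteratedFDeriv_stdOrthonormalBasis]
  simp only [iteratedFDeriv_two_apply, Matrix.cons_val_zero, Matrix.cons_val_one]
  rw [h1.fderiv_eq, h3]
  set e := stdOrthonormalBasis ℝ (EuclideanSpace ℝ (Fin N))
  have e1 : ∀ i, inner ℝ (e i) (e i) = (1 : ℝ) := fun i => by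
    rw [real_inner_self_eq_norm_sq]; simp [e.orthonormal.1 i]
  have e2 : ∑ i, inner ℝ x (e i) * inner ℝ x (e i) = ‖x‖ ^ 2 := by
    rw [← e.sum_sq_norm_inner_left x]
    refine Finset.sum_congr rfl fun i _ => ?_
    rw [Real.norm_eq_abs, sq_abs, sq]
  have : ∀ i, (((U' ‖x‖ / ‖x‖) • innerCLM (EuclideanSpace ℝ (Fin N)) +
      (((c * id ‖x‖ - U' ‖x‖ * 1) / id ‖x‖ ^ 2 / ‖x‖) • innerCLM (EuclideanSpace ℝ (Fin N)) x).smulRight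
        (innerCLM (EuclideanSpace ℝ (Fin N)) x)) (e i)) (e i) = U' ‖x‖ / ‖x‖ +
      ((c * ‖x‖ - U' ‖x‖) / ‖x‖ ^ 2 / ‖x‖) * (inner ℝ x (e i) * inner ℝ x (e i)) := fun i => by
    simp [innerCLM_apply]
    ring
  rw [Finset.sum_congr rfl fun i _ => this i, Finset.sum_add_distrib, ← Finset.mul_sum, e2]
  simp
  field_simp
  ring

set_option maxSynthPendingDepth 3 in
-- With W' = r H the gradient is H(‖x‖) x and the Hessian is H(‖x‖) I + (H'(‖x‖)/‖x‖) x ⊗ x. The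
-- rank-one term has norm ‖x‖ |H'(‖x‖)|, so the last two hypotheses are what makes the Hessian
-- continuous at the origin.
theorem contDiffOn_comp_norm {W H H' : ℝ → ℝ} {ρ h₀ : ℝ}
    (hW : ∀ r ∈ Ioo 0 ρ, HasDerivAt W (r * H r) r)
    (hW0 : HasDerivWithinAt W 0 (Ici 0) 0)
    (hH : ∀ r ∈ Ioo 0 ρ, HasDerivAt H (H' r) r) (hH' : ContinuousOn H' (Ioo 0 ρ))
    (hH0 : Tendsto H (𝓝[>] 0) (𝓝 h₀)) (hrH : Tendsto (fun r => r * H' r) (𝓝[>] 0) (𝓝 0)) :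
    ContDiffOn ℝ 2 (fun x : E => W ‖x‖) (ball 0 ρ) := by
  have hnorm0 : Tendsto (fun x : E => ‖x‖) (𝓝[≠] 0) (𝓝[>] 0) := by
    refine tendsto_nhdsWithin_iff.2 ⟨?_, ?_⟩
    · have : Tendsto (fun x : E => ‖x‖) (𝓝 0) (𝓝 0) := by
        simpa using (continuous_norm (E := E)).tendsto 0
      exact this.mono_left nhdsWithin_le_nhds
    · filter_upwards [self_mem_nhdsWithin] with x hx using norm_pos_iff.2 hx
  classical
  set h : E → ℝ := fun x => if x = 0 then h₀ else H ‖x‖ with hh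
  set c : E → ℝ := fun x => H' ‖x‖ / ‖x‖ with hc
  have mem : ∀ x ∈ ball (0 : E) ρ, x ≠ 0 → ‖x‖ ∈ Ioo 0 ρ := fun x hx h0 =>
    ⟨norm_pos_iff.2 h0, by simpa using hx⟩
  have hev : ∀ x : E, x ≠ 0 → h =ᶠ[𝓝 x] fun y => H ‖y‖ := fun x hx => by
    filter_upwards [isOpen_ne.mem_nhds hx] with y hy
    simp only [hh]; rw [if_neg hy]
  have hh0 : ContinuousAt h 0 := by
    rw [continuousAt_iff_punctured_nhds]
    have : h 0 = h₀ := by simp [hh]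
    rw [this]
    refine (hH0.comp hnorm0).congr' ?_
    filter_upwards [self_mem_nhdsWithin] with x hx
    simp only [hh, Function.comp]; rw [if_neg (by simpa using hx)]
  have d1 : ∀ x ∈ ball (0 : E) ρ, HasFDerivAt (fun x : E => W ‖x‖) (h x • innerCLM E x) x := by
    intro x hx
    by_cases h0 : x = 0
    · subst h0
      rw [hasFDerivAt_iff_isLittleO_nhds_zero]
      have := (hasDerivWithinAt_iff_isLittleO.1 hW0)
      have ht : Tendsto (fun x : E => ‖x‖) (𝓝 0) (𝓝[≥] 0) := by
        refine tendsto_nhdsWithin_iff.2 ⟨by simpa using (continuous_norm (E := E)).tendsto 0, ?_⟩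
        exact Eventually.of_forall fun x => norm_nonneg x
      have h2 := this.comp_tendsto ht
      simp only [Function.comp_def] at h2
      rw [← Asymptotics.isLittleO_norm_right]
      simpa using h2
    · have := hasFDerivAt_comp_norm h0 (hW _ (mem x hx h0))
      have e : h x = ‖x‖ * H ‖x‖ / ‖x‖ := by
        simp only [hh]; rw [if_neg h0]
        have : ‖x‖ ≠ 0 := norm_ne_zero_iff.2 h0
        field_simp
      rw [e]; exact this
  set G : E → (E →L[ℝ] (E →L[ℝ] ℝ)) := fun x =>
    h x • innerCLM E + (c x • innerCLM E x).smulRight (innerCLM E x) with hG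
  have d2 : ∀ x ∈ ball (0 : E) ρ, HasFDerivAt (fun x : E => h x • innerCLM E x) (G x) x := by
    intro x hx
    by_cases h0 : x = 0
    · subst h0
      -- At the origin h is only known to be continuous, but this suffices: (h(x) - h(0)) x = o(x).
      have e : G 0 = h 0 • innerCLM E := by
        simp only [hG]; ext; simp
      rw [e, hasFDerivAt_iff_isLittleO_nhds_zero]
      have h1 : (fun x : E => h x - h 0) =o[𝓝 0] fun _ => (1 : ℝ) := by
        rw [Asymptotics.isLittleO_one_iff]
        have : Tendsto h (𝓝 0) (𝓝 (h 0)) := hh0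
        simpa using this.sub_const (h 0)
      have h2 : (fun x : E => innerCLM E x) =O[𝓝 0] fun x => x :=
        (innerCLM E).isBigO_id _
      have h3 := h1.smul_isBigO h2
      refine (h3.congr_left fun x => ?_).trans_isBigO ?_
      · simp [sub_smul]
      · simpa using Asymptotics.isBigO_refl _ _
    · have hx' := mem x hx h0
      have hne : ‖x‖ ≠ 0 := norm_ne_zero_iff.2 h0
      refine hasFDerivAt_radial_gradient (H := h) ?_
      exact (hasFDerivAt_comp_norm h0 (hH _ hx')).congr_of_eventuallyEq (hev x h0)
  have cG : ContinuousOn G (ball 0 ρ) := by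
    intro x hx
    refine ContinuousAt.continuousWithinAt ?_
    by_cases h0 : x = 0
    · subst h0
      have e : G 0 = h 0 • innerCLM E + 0 := by
        simp only [hG]; ext; simp
      unfold ContinuousAt
      rw [e]
      refine (Filter.Tendsto.smul_const hh0 _).add ?_
      have hn : ∀ x : E, ‖(c x • innerCLM E x).smulRight (innerCLM E x)‖ = ‖‖x‖ * H' ‖x‖‖ := by
        intro x
        rw [ContinuousLinearMap.norm_smulRight_apply, norm_smul, norm_innerCLM, norm_mul,
          norm_norm]
        simp only [hc, norm_div, norm_norm]
        by_cases h0 : ‖x‖ = 0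
        · simp [h0]
        · field_simp
      have hz : Tendsto (fun x : E => (c x • innerCLM E x).smulRight (innerCLM E x))
          (𝓝[≠] 0) (𝓝 0) := by
        rw [tendsto_zero_iff_norm_tendsto_zero]
        simp_rw [hn]
        exact (tendsto_zero_iff_norm_tendsto_zero.1 hrH).comp hnorm0
      have hz0 : (c 0 • innerCLM E 0).smulRight (innerCLM E 0) = 0 := by ext; simp
      have : ContinuousAt (fun x : E => (c x • innerCLM E x).smulRight (innerCLM E x)) 0 := by
        rw [continuousAt_iff_punctured_nhds, hz0]
        exact hz
      unfold ContinuousAt at this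
      dsimp only at this
      rwa [hz0] at this
    · have hx' := mem x hx h0
      have hne : ‖x‖ ≠ 0 := norm_ne_zero_iff.2 h0
      have c1 : ContinuousAt h x :=
        ((hH _ hx').continuousAt.comp (f := fun y : E => ‖y‖)
          continuous_norm.continuousAt).congr (hev x h0).symm
      have c2 : ContinuousAt c x :=
        ((hH'.continuousAt (Ioo_mem_nhds hx'.1 hx'.2)).comp (f := fun y : E => ‖y‖)
          continuous_norm.continuousAt).div continuous_norm.continuousAt hne
      have c3 : ContinuousAt (fun y => innerCLM E y) x := (innerCLM E).continuous.continuousAt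
      have c4 : ContinuousAt (fun y => (ContinuousLinearMap.smulRightL ℝ E (E →L[ℝ] ℝ)
          (c y • innerCLM E y)) (innerCLM E y)) x :=
        ((ContinuousLinearMap.smulRightL ℝ E (E →L[ℝ] ℝ)).continuous.continuousAt.comp
          (c2.smul c3)).clm_apply c3
      exact (c1.smul (continuousAt_const (y := innerCLM E))).add c4
  rw [show (2 : WithTop ℕ∞) = 1 + 1 by norm_num, contDiffOn_succ_iff_fderiv_of_isOpen isOpen_ball]
  refine ⟨fun x hx => (d1 x hx).differentiableAt.differentiableWithinAt, by simp, ?_⟩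
  have : ContDiffOn ℝ 1 (fun x : E => h x • innerCLM E x) (ball 0 ρ) := by
    rw [show (1 : WithTop ℕ∞) = 0 + 1 by norm_num,
      contDiffOn_succ_iff_fderiv_of_isOpen isOpen_ball]
    refine ⟨fun x hx => (d2 x hx).differentiableAt.differentiableWithinAt, by simp, ?_⟩
    exact contDiffOn_zero.2 (cG.congr fun x hx => (d2 x hx).fderiv)
  exact this.congr fun x hx => (d1 x hx).fderiv

end Radial

end

/-! ### Maximum principle for ratios of solutions. -/

section

section Comparison

variable {N : ℕ} {μ p : ℝ} {Ω G G' : Set (EuclideanSpace ℝ (Fin N))}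
  {u v : EuclideanSpace ℝ (Fin N) → ℝ}

theorem IsPositiveSolutionOn.mono (h : IsPositiveSolutionOn μ p Ω G u) (hG : G' ⊆ G) :
    IsPositiveSolutionOn μ p Ω G' u :=
  ⟨h.contDiffOn.mono hG, fun x hx => h.pos x (hG hx), fun x hx => h.equation x (hG hx)⟩

theorem IsPositiveSolutionOn.laplacian_eq (h : IsPositiveSolutionOn μ p Ω G u)
    {x : EuclideanSpace ℝ (Fin N)} (hx : x ∈ G) :
    Laplacian.laplacian u x = u x ^ p - μ / boundaryDist Ω x ^ 2 * u x := by
  have := h.equation x hx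
  unfold hardyOp at this
  linarith

/-- At a point where v = q u the two linear Hardy terms cancel, so the singular potential, of either
sign, plays no role in the comparison; only the superlinear remainder is left. -/
theorem IsPositiveSolutionOn.laplacian_sub (hv : IsPositiveSolutionOn μ p Ω G v)
    (hu : IsPositiveSolutionOn μ p Ω G u) (hG : IsOpen G)
    {x : EuclideanSpace ℝ (Fin N)} (hx : x ∈ G) {q : ℝ} (hq : 0 < q) (hvu : v x = q * u x) :
    ContDiffAt ℝ 2 (v - q • u) x ∧
      Laplacian.laplacian (v - q • u) x = (q ^ p - q) * u x ^ p := by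
  have cv := hv.contDiffOn.contDiffAt (hG.mem_nhds hx)
  have cu := hu.contDiffOn.contDiffAt (hG.mem_nhds hx)
  have cqu : ContDiffAt ℝ 2 (q • u) x := cu.const_smul q
  refine ⟨cv.sub cqu, ?_⟩
  rw [cv.laplacian_sub cqu, InnerProductSpace.laplacian_smul q cu, hv.laplacian_eq hx,
    hu.laplacian_eq hx, hvu, Real.mul_rpow hq.le (hu.pos x hx).le]
  simp only [smul_eq_mul]
  ring

/-- Where the ratio `v / u` of two solutions has a local maximum, it is at most `1`. -/
theorem IsPositiveSolutionOn.ratio_le_one (hp : 1 < p) (hv : IsPositiveSolutionOn μ p Ω G v)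
    (hu : IsPositiveSolutionOn μ p Ω G u) (hG : IsOpen G)
    {x : EuclideanSpace ℝ (Fin N)} (hx : x ∈ G) {q : ℝ} (hq : 0 < q) (hvu : v x = q * u x)
    (hmax : ∀ᶠ y in 𝓝 x, v y ≤ q * u y) : q ≤ 1 := by
  by_contra! h1
  obtain ⟨hc, hl⟩ := hv.laplacian_sub hu hG hx hq hvu
  have hm : IsLocalMax (v - q • u) x := by
    filter_upwards [hmax] with y hy
    simp only [Pi.sub_apply, Pi.smul_apply, smul_eq_mul]
    rw [hvu]; linarith
  have h0 := laplacian_nonpos_of_isLocalMax hc hm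
  rw [hl] at h0
  have h2 : 0 < u x ^ p := Real.rpow_pos_of_pos (hu.pos x hx) p
  have h3 : q < q ^ p := by
    simpa using Real.rpow_lt_rpow_of_exponent_lt h1 hp
  have := mul_pos (sub_pos.2 h3) h2
  linarith

/-- A local minimum of v / u is a local maximum of u / v. -/
theorem IsPositiveSolutionOn.one_le_ratio (hp : 1 < p) (hv : IsPositiveSolutionOn μ p Ω G v)
    (hu : IsPositiveSolutionOn μ p Ω G u) (hG : IsOpen G)
    {x : EuclideanSpace ℝ (Fin N)} (hx : x ∈ G) {q : ℝ} (hq : 0 < q) (hvu : v x = q * u x)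
    (hmin : ∀ᶠ y in 𝓝 x, q * u y ≤ v y) : 1 ≤ q := by
  have := hu.ratio_le_one hp hv hG hx (inv_pos.2 hq) (by rw [hvu]; field_simp) (by
    filter_upwards [hmin] with y hy
    rw [inv_mul_eq_div, le_div_iff₀ hq]; linarith)
  exact (inv_le_one₀ hq).1 this

theorem eventually_toSphere {ρ : ℝ} {P : EuclideanSpace ℝ (Fin N) → Prop} (hρ : 0 < ρ)
    (h : ∀ᶠ x in toSphere N ρ, P x) : ∃ r, 0 < r ∧ r < ρ ∧ ∀ x, r < ‖x‖ → ‖x‖ < ρ → P x := by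
  rw [toSphere, eventually_comap] at h
  obtain ⟨r, hr, h'⟩ := mem_nhdsLT_iff_exists_Ioo_subset.1 h
  refine ⟨max r (ρ / 2), by positivity, max_lt hr (by linarith), fun x h1 h2 => ?_⟩
  exact h' ⟨(le_max_left _ _).trans_lt h1, h2⟩ x rfl

/-- Comparison of two positive solutions in a ball whose boundary values are ordered. -/
theorem IsPositiveSolutionOn.le_of_boundary (hp : 1 < p) {ρ : ℝ}
    (hv : IsPositiveSolutionOn μ p Ω (ball 0 ρ) v) (hu : IsPositiveSolutionOn μ p Ω (ball 0 ρ) u)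
    (hb : ∀ ε > 0, ∀ᶠ x in toSphere N ρ, v x ≤ (1 + ε) * u x) :
    ∀ x ∈ ball (0 : EuclideanSpace ℝ (Fin N)) ρ, v x ≤ u x := by
  intro x₁ hx₁
  by_contra! hlt
  have hρ : 0 < ρ := pos_of_mem_ball hx₁
  have hu1 := hu.pos x₁ hx₁
  have hq1 : 1 < v x₁ / u x₁ := (one_lt_div hu1).2 hlt
  -- Half of the excess over 1: near the sphere the ratio stays below its value at x₁, so its
  -- maximum is attained in a smaller closed ball.
  set ε := (v x₁ / u x₁ - 1) / 2 with hε
  obtain ⟨r, hr0, hrρ, hr⟩ := eventually_toSphere hρ (hb ε (by simp only [hε]; linarith))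
  have hout : ∀ x ∈ ball (0 : EuclideanSpace ℝ (Fin N)) ρ, r < ‖x‖ → v x / u x < v x₁ / u x₁ := by
    intro x hx hxr
    have := hr x hxr (by simpa using hx)
    have h2 : v x / u x ≤ 1 + ε := (div_le_iff₀ (hu.pos x hx)).2 this
    simp only [hε] at h2
    linarith
  have hsub : closedBall (0 : EuclideanSpace ℝ (Fin N)) r ⊆ ball 0 ρ := closedBall_subset_ball hrρ
  have hcont : ContinuousOn (fun x => v x / u x) (closedBall 0 r) :=
    (hv.contDiffOn.continuousOn.mono hsub).div (hu.contDiffOn.continuousOn.mono hsub)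
      fun x hx => (hu.pos x (hsub hx)).ne'
  have hx₁r : x₁ ∈ closedBall (0 : EuclideanSpace ℝ (Fin N)) r := by
    by_contra hn
    exact lt_irrefl _ (hout x₁ hx₁ (by simpa using hn))
  obtain ⟨x₀, hx₀, hmax⟩ := (isCompact_closedBall (0 : EuclideanSpace ℝ (Fin N)) r).exists_isMaxOn
    ⟨x₁, hx₁r⟩ hcont
  have hglob : ∀ x ∈ ball (0 : EuclideanSpace ℝ (Fin N)) ρ, v x / u x ≤ v x₀ / u x₀ := by
    intro x hx
    by_cases hxr : x ∈ closedBall (0 : EuclideanSpace ℝ (Fin N)) r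
    · exact hmax hxr
    · exact (hout x hx (by simpa using hxr)).le.trans (hmax hx₁r)
  have hq0 : 1 < v x₀ / u x₀ := hq1.trans_le (hmax hx₁r)
  refine absurd hq0 (not_lt.2 ?_)
  refine hv.ratio_le_one hp hu isOpen_ball (hsub hx₀) (by linarith) ?_ ?_
  · rw [div_mul_cancel₀ _ (hu.pos _ (hsub hx₀)).ne']
  · filter_upwards [isOpen_ball.mem_nhds (hsub hx₀)] with y hy
    exact (div_le_iff₀ (hu.pos y hy)).1 (hglob y hy)

/-- Radial solutions with ordered central values are ordered. -/
theorem IsRadialSolution.le_of_center_lt (hp : 1 < p) {R s : ℝ}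
    (hv : IsRadialSolution R μ p s v) (hu : IsRadialSolution R μ p s u) (h0 : v 0 < u 0) :
    ∀ x ∈ ball (0 : EuclideanSpace ℝ (Fin N)) s, v x ≤ u x := by
  intro x₁ hx₁
  by_contra! hlt
  have hx₁s : ‖x₁‖ < s := by simpa using hx₁
  have hsub : closedBall (0 : EuclideanSpace ℝ (Fin N)) ‖x₁‖ ⊆ ball 0 s :=
    closedBall_subset_ball hx₁s
  have h0s : (0 : EuclideanSpace ℝ (Fin N)) ∈ closedBall (0 : EuclideanSpace ℝ (Fin N)) ‖x₁‖ := by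
    simp
  have hcont : ContinuousOn (fun x => v x / u x) (closedBall 0 ‖x₁‖) :=
    (hv.1.contDiffOn.continuousOn.mono hsub).div (hu.1.contDiffOn.continuousOn.mono hsub)
      fun x hx => (hu.1.pos x (hsub hx)).ne'
  obtain ⟨x₀, hx₀, hmin⟩ :=
    (isCompact_closedBall (0 : EuclideanSpace ℝ (Fin N)) ‖x₁‖).exists_isMinOn ⟨0, h0s⟩ hcont
  have hq0 : v x₀ / u x₀ < 1 :=
    lt_of_le_of_lt (hmin h0s) ((div_lt_one (hu.1.pos 0 (hsub h0s))).2 h0)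
  have hu0 := hu.1.pos x₀ (hsub hx₀)
  have hv0 := hv.1.pos x₀ (hsub hx₀)
  -- The minimum of v / u is not on the bounding sphere: by radiality the ratio there equals its
  -- value at x₁, which exceeds 1.
  have hx₀' : x₀ ∈ ball (0 : EuclideanSpace ℝ (Fin N)) ‖x₁‖ := by
    have hle : ‖x₀‖ ≤ ‖x₁‖ := by simpa using hx₀
    refine mem_ball_zero_iff.2 (lt_of_le_of_ne hle fun he => ?_)
    have e1 := hv.2 x₀ (hsub hx₀) x₁ hx₁ he
    have e2 := hu.2 x₀ (hsub hx₀) x₁ hx₁ he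
    rw [div_lt_one hu0, e1, e2] at hq0
    linarith
  refine absurd hq0 (not_lt.2 ?_)
  refine hv.1.one_le_ratio hp hu.1 isOpen_ball (hsub hx₀) (div_pos hv0 hu0) ?_ ?_
  · rw [div_mul_cancel₀ _ hu0.ne']
  · filter_upwards [isOpen_ball.mem_nhds hx₀'] with y hy
    have hy' := ball_subset_closedBall hy
    exact (le_div_iff₀ (hu.1.pos y (hsub hy'))).1 (hmin hy')

theorem IsRadialSolution.mono {R ρ σ : ℝ} (h : IsRadialSolution R μ p ρ u) (hσ : σ ≤ ρ) :
    IsRadialSolution R μ p σ u :=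
  ⟨h.1.mono (ball_subset_ball hσ), fun x hx y hy =>
    h.2 x (ball_subset_ball hσ hx) y (ball_subset_ball hσ hy)⟩

end Comparison

end

/-! ### The integral equation for w = u / ψ and its minimal solution. -/

section

open MeasureTheory ENNReal

/-- The weight `t ^ (N - 1) ψ(t) ^ 2`. -/
def mass (N : ℕ) (ψ : ℝ → ℝ) (t : ℝ) : ℝ := t ^ (N - 1) * ψ t ^ 2

/-- The nonlinearity `V w + ψ ^ (p - 1) w ^ p`. -/
def nlin (p : ℝ) (ψ V : ℝ → ℝ) (t : ℝ) (w : ℝ≥0∞) : ℝ≥0∞ :=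
  ENNReal.ofReal (V t) * w + ENNReal.ofReal (ψ t ^ (p - 1)) * w ^ p

/-- The flux `∫₀ˢ m(t) (V w + ψ ^ (p - 1) w ^ p) dt`. -/
def flux (N : ℕ) (p : ℝ) (ψ V : ℝ → ℝ) (w : ℝ → ℝ≥0∞) (s : ℝ) : ℝ≥0∞ :=
  ∫⁻ t in Ioc 0 s, ENNReal.ofReal (mass N ψ t) * nlin p ψ V t (w t)

/-- The right-hand side of the integral equation of a radial solution divided by `ψ`. -/
def volterra (N : ℕ) (p : ℝ) (ψ V : ℝ → ℝ) (a : ℝ≥0∞) (w : ℝ → ℝ≥0∞) (r : ℝ) : ℝ≥0∞ :=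
  a + ∫⁻ s in Ioc 0 r, ENNReal.ofReal (mass N ψ s)⁻¹ * flux N p ψ V w s

/-- The hypotheses on the weights `ψ` and `V` on `[0, R)`. -/
structure IsWeight (N : ℕ) (p R : ℝ) (ψ V : ℝ → ℝ) : Prop where
  one_le_dim : 1 ≤ N
  one_lt : 1 < p
  radius_pos : 0 < R
  pos : ∀ r ∈ Ico 0 R, 0 < ψ r
  cont : ContinuousOn ψ (Ico 0 R)
  meas : Measurable ψ
  nonneg : ∀ r ∈ Ico 0 R, 0 ≤ V r
  potential_cont : ContinuousOn V (Ico 0 R)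
  potential_meas : Measurable V

section Volterra

variable {N : ℕ} {p R : ℝ} {ψ V : ℝ → ℝ} {a b : ℝ≥0∞} {v w : ℝ → ℝ≥0∞}

theorem nlin_mono (hp : 0 ≤ p) (t : ℝ) {x y : ℝ≥0∞} (h : x ≤ y) :
    nlin p ψ V t x ≤ nlin p ψ V t y := by
  unfold nlin
  gcongr

theorem flux_le_flux (hp : 0 ≤ p) {s : ℝ} (h : ∀ t ∈ Ioc 0 s, v t ≤ w t) :
    flux N p ψ V v s ≤ flux N p ψ V w s := by
  refine setLIntegral_mono' measurableSet_Ioc fun t ht => ?_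
  gcongr
  exact nlin_mono hp t (h t ht)

theorem volterra_le_volterra (hp : 0 ≤ p) {r : ℝ} (hab : a ≤ b) (h : ∀ t ∈ Ioc 0 r, v t ≤ w t) :
    volterra N p ψ V a v r ≤ volterra N p ψ V b w r := by
  refine add_le_add hab (setLIntegral_mono' measurableSet_Ioc fun s hs => ?_)
  gcongr
  exact flux_le_flux hp fun t ht => h t ⟨ht.1, ht.2.trans hs.2⟩

theorem flux_mono (w : ℝ → ℝ≥0∞) : Monotone (flux N p ψ V w) := fun _ _ h =>
  lintegral_mono_set (Ioc_subset_Ioc_right h)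

theorem volterra_mono (a : ℝ≥0∞) (w : ℝ → ℝ≥0∞) : Monotone (volterra N p ψ V a w) := fun _ _ h =>
  add_le_add le_rfl (lintegral_mono_set (Ioc_subset_Ioc_right h))

/-- The right-hand side of the integral equation as a monotone operator. -/
def volterraHom (N : ℕ) (p : ℝ) (hp : 0 ≤ p) (ψ V : ℝ → ℝ) (a : ℝ≥0∞) :
    (ℝ → ℝ≥0∞) →o (ℝ → ℝ≥0∞) where
  toFun := volterra N p ψ V a
  monotone' := by
    intro v w h r
    exact volterra_le_volterra hp le_rfl fun t _ => h t

/-- The minimal solution of the integral equation with central value `a`. -/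
def profile (N : ℕ) (p : ℝ) (hp : 0 ≤ p) (ψ V : ℝ → ℝ) (a : ℝ≥0∞) : ℝ → ℝ≥0∞ :=
  OrderHom.lfp (volterraHom N p hp ψ V a)

theorem profile_eq (hp : 0 ≤ p) (a : ℝ≥0∞) (r : ℝ) :
    volterra N p ψ V a (profile N p hp ψ V a) r = profile N p hp ψ V a r :=
  congrFun (OrderHom.map_lfp (volterraHom N p hp ψ V a)) r

theorem profile_mono (hp : 0 ≤ p) (a : ℝ≥0∞) : Monotone (profile N p hp ψ V a) := by
  intro r s h
  rw [← profile_eq, ← profile_eq hp a s]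
  exact volterra_mono _ _ h

theorem profile_of_nonpos (hp : 0 ≤ p) (a : ℝ≥0∞) {r : ℝ} (hr : r ≤ 0) :
    profile N p hp ψ V a r = a := by
  rw [← profile_eq]
  simp [volterra, Ioc_eq_empty_of_le hr]

theorem le_profile (hp : 0 ≤ p) (a : ℝ≥0∞) (r : ℝ) : a ≤ profile N p hp ψ V a r := by
  rw [← profile_eq]
  exact le_self_add

/-- Supersolutions of the integral equation on `[0, r₀]` lie above the minimal solution. -/
theorem profile_le_of_volterra_le (hp : 0 ≤ p) {r₀ : ℝ}
    (h : ∀ r ∈ Icc 0 r₀, volterra N p ψ V a v r ≤ v r) :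
    ∀ r ∈ Icc 0 r₀, profile N p hp ψ V a r ≤ v r := by
  classical
  -- The value ∞ outside [0, r₀] makes v a supersolution everywhere; on [0, r₀] nothing changes,
  -- since the equation at r involves only values on (0, r].
  set v' : ℝ → ℝ≥0∞ := fun r => if r ∈ Icc 0 r₀ then v r else ⊤ with hv'
  have hle : profile N p hp ψ V a ≤ v' := by
    refine OrderHom.lfp_le _ fun r => ?_
    simp only [hv']
    split_ifs with hr
    · refine le_trans (volterra_le_volterra hp le_rfl fun t ht => ?_) (h r hr)
      rw [if_pos ⟨ht.1.le, ht.2.trans hr.2⟩]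
    · exact le_top
  intro r hr
  have := hle r
  simp only [hv'] at this
  rwa [if_pos hr] at this

theorem profile_le_profile (hp : 0 ≤ p) (hab : a ≤ b) (r : ℝ) :
    profile N p hp ψ V a r ≤ profile N p hp ψ V b r := by
  rcases le_or_gt r 0 with hr | hr
  · rwa [profile_of_nonpos hp _ hr, profile_of_nonpos hp _ hr]
  · refine profile_le_of_volterra_le hp (r₀ := r) (fun s _ => ?_) r ⟨hr.le, le_rfl⟩
    exact (volterra_le_volterra hp hab fun _ _ => le_rfl).trans (profile_eq hp b s).le

/-- Since l ≤ 1 and p ≥ 1 give l^p ≤ l, the multiple l w is a supersolution for the central value l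
a. -/
theorem profile_mul_le (hp : 1 ≤ p) {l : ℝ≥0∞} (hl : l ≤ 1) {r : ℝ} (hr : 0 ≤ r) :
    profile N p (zero_le_one.trans hp) ψ V (l * a) r
      ≤ l * profile N p (zero_le_one.trans hp) ψ V a r := by
  have hp0 := zero_le_one.trans hp
  have hl' : l ≠ ⊤ := ne_top_of_le_ne_top one_ne_top hl
  set w := profile N p hp0 ψ V a
  refine profile_le_of_volterra_le hp0 (r₀ := r) (v := fun r => l * w r) (fun s _ => ?_) r
    ⟨hr, le_rfl⟩
  have h1 : ∀ t, nlin p ψ V t (l * w t) ≤ l * nlin p ψ V t (w t) := fun t => by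
    unfold nlin
    rw [ENNReal.mul_rpow_of_nonneg _ _ hp0, mul_add]
    have : l ^ p ≤ l := by
      simpa using ENNReal.rpow_le_rpow_of_exponent_ge hl hp
    refine add_le_add (by rw [mul_left_comm]) ?_
    rw [mul_left_comm]
    gcongr
  have h2 : ∀ s, flux N p ψ V (fun r => l * w r) s ≤ l * flux N p ψ V w s := fun s => by
    unfold flux
    rw [← lintegral_const_mul' _ _ hl']
    refine lintegral_mono fun t => ?_
    rw [mul_left_comm]
    gcongr
    exact h1 t
  change volterra N p ψ V (l * a) (fun r => l * w r) s ≤ l * profile N p hp0 ψ V a s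
  rw [← profile_eq hp0 a s]
  unfold volterra
  rw [mul_add, ← lintegral_const_mul' _ _ hl']
  refine add_le_add le_rfl (lintegral_mono fun t => ?_)
  rw [mul_left_comm]
  gcongr
  exact h2 t

theorem IsWeight.mass_measurable (h : IsWeight N p R ψ V) : Measurable (mass N ψ) :=
  (measurable_id.pow_const _).mul (h.meas.pow_const _)

theorem IsWeight.nlin_measurable (h : IsWeight N p R ψ V) (hw : Measurable w) :
    Measurable fun t => nlin p ψ V t (w t) :=
  (h.potential_meas.ennreal_ofReal.mul hw).add
    ((h.meas.pow_const _).ennreal_ofReal.mul (hw.pow_const _))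

theorem IsWeight.flux_integrand_measurable (h : IsWeight N p R ψ V) (hw : Measurable w) :
    Measurable fun t => ENNReal.ofReal (mass N ψ t) * nlin p ψ V t (w t) :=
  h.mass_measurable.ennreal_ofReal.mul (h.nlin_measurable hw)

theorem IsWeight.volterra_integrand_measurable (h : IsWeight N p R ψ V) (w : ℝ → ℝ≥0∞) :
    Measurable fun s => ENNReal.ofReal (mass N ψ s)⁻¹ * flux N p ψ V w s :=
  h.mass_measurable.inv.ennreal_ofReal.mul (flux_mono w).measurable

/-- The nonlinearity is convex in w, so a convex combination of two solutions is a supersolution for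
the combined central value. -/
theorem profile_convex (h : IsWeight N p R ψ V) {l m : ℝ≥0∞} (hlm : l + m = 1) {r : ℝ}
    (hr : 0 ≤ r) (hp : 0 ≤ p) :
    profile N p hp ψ V (l * a + m * b) r
      ≤ l * profile N p hp ψ V a r + m * profile N p hp ψ V b r := by
  have hl' : l ≠ ⊤ := ne_top_of_le_ne_top one_ne_top (hlm ▸ le_self_add)
  have hm' : m ≠ ⊤ := ne_top_of_le_ne_top one_ne_top (hlm ▸ le_add_self)
  set x := profile N p hp ψ V a
  set y := profile N p hp ψ V b
  have hx : Measurable x := (profile_mono hp a).measurable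
  have hy : Measurable y := (profile_mono hp b).measurable
  refine profile_le_of_volterra_le hp (r₀ := r) (v := fun r => l * x r + m * y r)
    (fun s _ => ?_) r ⟨hr, le_rfl⟩
  have h1 : ∀ t, nlin p ψ V t (l * x t + m * y t)
      ≤ l * nlin p ψ V t (x t) + m * nlin p ψ V t (y t) := fun t => by
    unfold nlin
    have := ENNReal.rpow_arith_mean_le_arith_mean2_rpow l m (x t) (y t) hlm h.one_lt.le
    calc _ ≤ ENNReal.ofReal (V t) * (l * x t + m * y t)
          + ENNReal.ofReal (ψ t ^ (p - 1)) * (l * x t ^ p + m * y t ^ p) := by gcongr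
      _ = _ := by ring
  have h2 : ∀ s, flux N p ψ V (fun r => l * x r + m * y r) s
      ≤ l * flux N p ψ V x s + m * flux N p ψ V y s := fun s => by
    unfold flux
    rw [← lintegral_const_mul' _ _ hl', ← lintegral_const_mul' _ _ hm', ← lintegral_add_left
      ((h.flux_integrand_measurable hx).const_mul l)]
    refine lintegral_mono fun t => ?_
    calc _ ≤ ENNReal.ofReal (mass N ψ t) *
          (l * nlin p ψ V t (x t) + m * nlin p ψ V t (y t)) := by
            simp only
            gcongr
            exact h1 t
      _ = _ := by ring
  change volterra N p ψ V (l * a + m * b) (fun r => l * x r + m * y r) s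
    ≤ l * profile N p hp ψ V a s + m * profile N p hp ψ V b s
  rw [← profile_eq hp a s, ← profile_eq hp b s]
  unfold volterra
  have e : ∀ A B : ℝ≥0∞, l * (a + A) + m * (b + B) = (l * a + m * b) + (l * A + m * B) := by
    intros; ring
  rw [e, ← lintegral_const_mul' _ _ hl', ← lintegral_const_mul' _ _ hm', ← lintegral_add_left
    ((h.volterra_integrand_measurable x).const_mul l)]
  refine add_le_add le_rfl (lintegral_mono fun t => ?_)
  calc _ ≤ ENNReal.ofReal (mass N ψ t)⁻¹ * (l * flux N p ψ V x t + m * flux N p ψ V y t) := by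
        gcongr
        exact h2 t
    _ = _ := by ring

theorem IsWeight.mass_pos (h : IsWeight N p R ψ V) {r : ℝ} (hr : r ∈ Ioo 0 R) :
    0 < mass N ψ r :=
  mul_pos (pow_pos hr.1 _) (pow_pos (h.pos r ⟨hr.1.le, hr.2⟩) _)

/-- Bounds for the weights on compact subintervals of `[0, R)`. -/
theorem IsWeight.exists_bounds (h : IsWeight N p R ψ V) {r₁ : ℝ} (h0 : 0 ≤ r₁) (hr₁ : r₁ < R) :
    ∃ κ B : ℝ, 0 < κ ∧ 0 < B ∧ (∀ t ∈ Icc 0 r₁, V t ≤ B ∧ ψ t ^ (p - 1) ≤ B) ∧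
      ∀ s ∈ Ioc 0 r₁, ∀ (F : ℝ → ℝ≥0∞) (C : ℝ≥0∞), (∀ t ∈ Ioc 0 s, F t ≤ C) →
        ENNReal.ofReal (mass N ψ s)⁻¹ * ∫⁻ t in Ioc 0 s, ENNReal.ofReal (mass N ψ t) * F t
          ≤ ENNReal.ofReal κ * C := by
  have hsub : Icc 0 r₁ ⊆ Ico 0 R := fun t ht => ⟨ht.1, ht.2.trans_lt hr₁⟩
  have hne : (Icc 0 r₁).Nonempty := ⟨0, le_rfl, h0⟩
  obtain ⟨t₁, ht₁, hmax⟩ := isCompact_Icc.exists_isMaxOn hne (h.cont.mono hsub)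
  obtain ⟨t₂, ht₂, hmin⟩ := isCompact_Icc.exists_isMinOn hne (h.cont.mono hsub)
  obtain ⟨t₃, ht₃, hV⟩ := isCompact_Icc.exists_isMaxOn hne (h.potential_cont.mono hsub)
  have p1 := h.pos t₁ (hsub ht₁)
  have p2 := h.pos t₂ (hsub ht₂)
  set Q := (ψ t₁ / ψ t₂) ^ 2 with hQ
  -- For t ≤ s the ratio of the masses at t and s is at most Q, because t^(N-1) ≤ s^(N-1); this
  -- absorbs the degeneracy at 0. The summand 1 keeps κ positive when r₁ = 0.
  refine ⟨Q * (r₁ + 1), |V t₃| + ψ t₁ ^ (p - 1), by positivity,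
    add_pos_of_nonneg_of_pos (abs_nonneg _) (Real.rpow_pos_of_pos p1 _), ?_, ?_⟩
  · intro t ht
    refine ⟨?_, ?_⟩
    · have : V t ≤ V t₃ := hV ht
      have := le_abs_self (V t₃)
      have := (Real.rpow_pos_of_pos p1 (p - 1)).le
      linarith
    · have : ψ t ^ (p - 1) ≤ ψ t₁ ^ (p - 1) :=
        Real.rpow_le_rpow (h.pos t (hsub ht)).le (hmax ht) (by linarith [h.one_lt])
      have := abs_nonneg (V t₃)
      linarith
  · intro s hs F C hF
    rw [← lintegral_const_mul' _ _ ofReal_ne_top]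
    have hms : 0 < mass N ψ s := h.mass_pos ⟨hs.1, hs.2.trans_lt hr₁⟩
    have key : ∀ t ∈ Ioc 0 s, ENNReal.ofReal (mass N ψ s)⁻¹ * (ENNReal.ofReal (mass N ψ t) * F t)
        ≤ ENNReal.ofReal Q * C := by
      intro t ht
      have ht' : t ∈ Icc 0 r₁ := ⟨ht.1.le, ht.2.trans hs.2⟩
      have hs' : s ∈ Icc 0 r₁ := ⟨hs.1.le, hs.2⟩
      rw [← mul_assoc, ← ENNReal.ofReal_mul (by positivity)]
      gcongr
      · rw [inv_mul_eq_div, div_le_iff₀ hms]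
        have a1 : t ^ (N - 1) ≤ s ^ (N - 1) := pow_le_pow_left₀ ht.1.le ht.2 _
        have a2 : ψ t ≤ (ψ t₁ / ψ t₂) * ψ s := by
          have b1 : ψ t ≤ ψ t₁ := hmax ht'
          have b2 : ψ t₂ ≤ ψ s := hmin hs'
          calc ψ t ≤ ψ t₁ := b1
            _ = (ψ t₁ / ψ t₂) * ψ t₂ := by field_simp
            _ ≤ _ := by gcongr
        have a3 : ψ t ^ 2 ≤ ((ψ t₁ / ψ t₂) * ψ s) ^ 2 :=
          pow_le_pow_left₀ (h.pos t (hsub ht')).le a2 2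
        have hs0 := hs.1
        calc t ^ (N - 1) * ψ t ^ 2 ≤ s ^ (N - 1) * ((ψ t₁ / ψ t₂) * ψ s) ^ 2 := by gcongr
          _ = _ := by rw [hQ, mass]; ring
      · exact hF t ht
    calc _ ≤ ∫⁻ _ in Ioc 0 s, ENNReal.ofReal Q * C := setLIntegral_mono' measurableSet_Ioc key
      _ = ENNReal.ofReal Q * C * ENNReal.ofReal s := by simp
      _ ≤ ENNReal.ofReal Q * C * ENNReal.ofReal (r₁ + 1) := by
          gcongr; linarith [hs.2]
      _ = _ := by rw [ENNReal.ofReal_mul (by positivity)]; ring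

theorem nlin_le_of_bounds {B : ℝ} (hp : 0 ≤ p) {t : ℝ} (hB : V t ≤ B ∧ ψ t ^ (p - 1) ≤ B)
    {x c : ℝ≥0∞} (hx : x ≤ c) : nlin p ψ V t x ≤ ENNReal.ofReal B * (c + c ^ p) := by
  unfold nlin
  rw [mul_add]
  gcongr
  · exact hB.1
  · exact hB.2

/-- The minimal solution extends beyond any radius at which it is finite. -/
theorem IsWeight.profile_continuation (h : IsWeight N p R ψ V) (hp : 0 ≤ p) {r₀ : ℝ} (h0 : 0 ≤ r₀)
    (hr₀ : r₀ < R) (hfin : profile N p hp ψ V a r₀ ≠ ⊤) :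
    ∃ r₁, r₀ < r₁ ∧ r₁ < R ∧ profile N p hp ψ V a r₁ ≠ ⊤ := by
  classical
  set w := profile N p hp ψ V a with hw
  set c := w r₀ + 1 with hc
  have hct : c ≠ ⊤ := add_ne_top.2 ⟨hfin, one_ne_top⟩
  obtain ⟨κ, B, hκ, hB, hb, hk⟩ := h.exists_bounds (r₁ := (r₀ + R) / 2) (by linarith) (by linarith)
  set D : ℝ≥0∞ := ENNReal.ofReal κ * (ENNReal.ofReal B * (c + c ^ p)) with hD
  have hDt : D ≠ ⊤ := by
    refine mul_ne_top ofReal_ne_top (mul_ne_top ofReal_ne_top (add_ne_top.2 ⟨hct, ?_⟩))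
    exact rpow_ne_top_of_nonneg hp hct
  -- D bounds the growth rate of the right-hand side for functions below c, so over a length η the
  -- increase is at most 1, the margin built into c.
  set η := min ((R - r₀) / 2) (1 / (D.toReal + 1)) with hη
  have hη0 : 0 < η := lt_min (by linarith) (by positivity)
  have hη1 : η ≤ (R - r₀) / 2 := min_le_left _ _
  have hη2 : D * ENNReal.ofReal η ≤ 1 := by
    rw [← ENNReal.ofReal_toReal hDt, ← ENNReal.ofReal_mul toReal_nonneg, ← ENNReal.ofReal_one]
    refine ENNReal.ofReal_le_ofReal ?_
    have h1 : η ≤ 1 / (D.toReal + 1) := min_le_right _ _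
    have h2 : 0 ≤ D.toReal := toReal_nonneg
    calc D.toReal * η ≤ D.toReal * (1 / (D.toReal + 1)) := by gcongr
      _ ≤ 1 := by rw [mul_one_div, div_le_one (by positivity)]; linarith
  -- The supersolution that stays finite past r₀: the profile itself, then the constant c.
  set v : ℝ → ℝ≥0∞ := fun t => if t ≤ r₀ then w t else c with hv
  have hvc : ∀ t, v t ≤ c := fun t => by
    simp only [hv]
    split_ifs with ht
    · exact (profile_mono hp a ht).trans le_self_add
    · exact le_rfl
  have hle : ∀ r ∈ Icc 0 (r₀ + η), volterra N p ψ V a v r ≤ v r := by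
    intro r hr
    have hsmall : ∀ r ≤ r₀, volterra N p ψ V a v r ≤ w r := fun r hr => by
      rw [hw, ← profile_eq hp a r]
      refine volterra_le_volterra hp le_rfl fun t ht => ?_
      simp only [hv]
      rw [if_pos (ht.2.trans hr)]
    by_cases hr' : r ≤ r₀
    · have : v r = w r := by simp only [hv]; rw [if_pos hr']
      rw [this]
      exact hsmall r hr'
    · have : v r = c := by simp only [hv]; rw [if_neg hr']
      rw [this]
      push Not at hr'
      have hsplit : volterra N p ψ V a v r = volterra N p ψ V a v r₀ +
          ∫⁻ s in Ioc r₀ r, ENNReal.ofReal (mass N ψ s)⁻¹ * flux N p ψ V v s := by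
        unfold volterra
        rw [← Ioc_union_Ioc_eq_Ioc h0 hr'.le, lintegral_union measurableSet_Ioc
          (Ioc_disjoint_Ioc_of_le le_rfl), add_assoc]
      rw [hsplit, hc]
      refine add_le_add (hsmall r₀ le_rfl) (le_trans ?_ hη2)
      calc _ ≤ ∫⁻ _ in Ioc r₀ r, D := by
            refine setLIntegral_mono' measurableSet_Ioc fun s hs => ?_
            have hs' : s ∈ Ioc 0 ((r₀ + R) / 2) :=
              ⟨h0.trans_lt hs.1, by linarith [hs.2, hr.2]⟩
            refine hk s hs' _ _ fun t ht => ?_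
            exact nlin_le_of_bounds hp (hb t ⟨ht.1.le, ht.2.trans hs'.2⟩) (hvc t)
        _ = D * ENNReal.ofReal (r - r₀) := by simp
        _ ≤ D * ENNReal.ofReal η := by gcongr; linarith [hr.2]
  refine ⟨r₀ + η, by linarith, by linarith, ?_⟩
  have := profile_le_of_volterra_le hp hle (r₀ + η) ⟨by linarith, le_rfl⟩
  exact ne_top_of_le_ne_top hct (this.trans (hvc _))

/-- Convexity of the power, in the form of the tangent line at x + y; it is Bernoulli's inequality
for x / (x + y) = 1 - y / (x + y). -/
theorem add_rpow_le {x y : ℝ} (hp : 1 ≤ p) (hx : 0 ≤ x) (hy : 0 ≤ y) :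
    (x + y) ^ p ≤ x ^ p + p * (x + y) ^ (p - 1) * y := by
  rcases (add_nonneg hx hy).eq_or_lt with h | h
  · have hx0 : x = 0 := by linarith
    have hy0 : y = 0 := by linarith
    simp [hx0, hy0]
  · have h1 := one_add_mul_self_le_rpow_one_add (s := -y / (x + y))
      (by rw [le_div_iff₀ h]; linarith) hp
    have e : 1 + -y / (x + y) = x / (x + y) := by field_simp; ring
    rw [e, Real.div_rpow hx h.le, le_div_iff₀ (Real.rpow_pos_of_pos h p)] at h1
    have e2 : (x + y) ^ p = (x + y) ^ (p - 1) * (x + y) := by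
      conv_rhs => rw [← Real.rpow_add_one h.ne']
      ring_nf
    have e3 : (1 + p * (-y / (x + y))) * (x + y) ^ p
        = (x + y) ^ p - p * (x + y) ^ (p - 1) * y := by
      rw [e2]; field_simp; ring
    linarith

/-- A one-sided Lipschitz estimate; the bound y ≤ 1 keeps the slope of the power below p (C +
1)^(p-1). -/
theorem nlin_add_le {B C : ℝ} (hp : 1 ≤ p) {t : ℝ} (hV : V t ≤ B ∧ ψ t ^ (p - 1) ≤ B) (hB : 0 ≤ B)
    {x : ℝ≥0∞} {y : ℝ} (hx : x ≤ ENNReal.ofReal C) (hC : 0 ≤ C) (hy : 0 ≤ y) (hy1 : y ≤ 1) :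
    nlin p ψ V t (x + ENNReal.ofReal y)
      ≤ nlin p ψ V t x + ENNReal.ofReal (B * (1 + p * (C + 1) ^ (p - 1)) * y) := by
  have hxt : x ≠ ⊤ := ne_top_of_le_ne_top ofReal_ne_top hx
  obtain ⟨z, hz, rfl⟩ : ∃ z : ℝ, 0 ≤ z ∧ x = ENNReal.ofReal z :=
    ⟨x.toReal, toReal_nonneg, (ENNReal.ofReal_toReal hxt).symm⟩
  have hzC : z ≤ C := (ENNReal.ofReal_le_ofReal_iff hC).1 hx
  have hp0 : 0 ≤ p := zero_le_one.trans hp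
  have key : (ENNReal.ofReal z + ENNReal.ofReal y) ^ p
      ≤ ENNReal.ofReal z ^ p + ENNReal.ofReal (p * (C + 1) ^ (p - 1) * y) := by
    rw [← ENNReal.ofReal_add hz hy, ENNReal.ofReal_rpow_of_nonneg (by positivity) hp0,
      ENNReal.ofReal_rpow_of_nonneg hz hp0, ← ENNReal.ofReal_add (by positivity) (by positivity)]
    refine ENNReal.ofReal_le_ofReal ((add_rpow_le hp hz hy).trans ?_)
    gcongr
  unfold nlin
  calc _ ≤ ENNReal.ofReal (V t) * (ENNReal.ofReal z + ENNReal.ofReal y)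
        + ENNReal.ofReal (ψ t ^ (p - 1)) *
          (ENNReal.ofReal z ^ p + ENNReal.ofReal (p * (C + 1) ^ (p - 1) * y)) := by gcongr
    _ = ENNReal.ofReal (V t) * ENNReal.ofReal z
        + ENNReal.ofReal (ψ t ^ (p - 1)) * ENNReal.ofReal z ^ p
        + (ENNReal.ofReal (V t) * ENNReal.ofReal y
          + ENNReal.ofReal (ψ t ^ (p - 1)) * ENNReal.ofReal (p * (C + 1) ^ (p - 1) * y)) := by ring
    _ ≤ ENNReal.ofReal (V t) * ENNReal.ofReal z
        + ENNReal.ofReal (ψ t ^ (p - 1)) * ENNReal.ofReal z ^ p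
        + (ENNReal.ofReal B * ENNReal.ofReal y
          + ENNReal.ofReal B * ENNReal.ofReal (p * (C + 1) ^ (p - 1) * y)) := by
        gcongr
        · exact hV.1
        · exact hV.2
    _ = _ := by
        rw [← ENNReal.ofReal_mul hB, ← ENNReal.ofReal_mul hB,
          ← ENNReal.ofReal_add (by positivity) (by positivity)]
        congr 2
        ring

theorem lintegral_exp_le {L r : ℝ} (hL : 0 < L) (hr : 0 ≤ r) :
    ∫⁻ s in Ioc 0 r, ENNReal.ofReal (L * Real.exp (L * s)) ≤ ENNReal.ofReal (Real.exp (L * r)) := by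
  have hint : ∫ s in (0 : ℝ)..r, L * Real.exp (L * s) = Real.exp (L * r) - Real.exp (L * 0) := by
    refine intervalIntegral.integral_eq_sub_of_hasDerivAt (f := fun s => Real.exp (L * s))
      (fun s _ => ?_) ?_
    · have := ((hasDerivAt_id s).const_mul L).exp
      simpa [mul_comm] using this
    · exact (by fun_prop : Continuous fun s => L * Real.exp (L * s)).intervalIntegrable _ _
  rw [← ofReal_integral_eq_lintegral_ofReal]
  · rw [← intervalIntegral.integral_of_le hr, hint]
    exact ENNReal.ofReal_le_ofReal (by have := Real.exp_pos (L * 0); linarith)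
  · exact ((by fun_prop : Continuous fun s => L * Real.exp (L * s)).integrableOn_Icc).mono_set
      Ioc_subset_Icc_self
  · exact Eventually.of_forall fun s => by positivity

/-- Locally Lipschitz dependence of the minimal solution on its central value. -/
theorem IsWeight.profile_lipschitz (h : IsWeight N p R ψ V) (hp : 0 ≤ p) {r₀ C : ℝ} (h0 : 0 ≤ r₀)
    (hr₀ : r₀ < R) (hC : 0 ≤ C) :
    ∃ L : ℝ, 0 < L ∧ ∀ (a : ℝ≥0∞) (θ : ℝ), profile N p hp ψ V a r₀ ≤ ENNReal.ofReal C → 0 ≤ θ →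
      θ * Real.exp (L * r₀) ≤ 1 → ∀ r ∈ Icc 0 r₀,
        profile N p hp ψ V (a + ENNReal.ofReal (θ / 2)) r
          ≤ profile N p hp ψ V a r + ENNReal.ofReal (θ * Real.exp (L * r)) := by
  obtain ⟨κ, B, hκ, hB, hb, hk⟩ := h.exists_bounds h0 hr₀
  have hp1 := h.one_lt.le
  set D := B * (1 + p * (C + 1) ^ (p - 1)) with hD
  have hD0 : 0 < D := by positivity
  -- With this L the integral term adds at most (θ/2) e^(L r). The shift θ/2 of the central value is
  -- also at most (θ/2) e^(L r), so w + θ e^(L r) is a supersolution.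
  set L := 2 * (κ * D) with hL
  have hL0 : 0 < L := by positivity
  refine ⟨L, hL0, fun a θ ha hθ hθ1 => ?_⟩
  set w := profile N p hp ψ V a with hw
  have hwm : Measurable w := (profile_mono hp a).measurable
  refine profile_le_of_volterra_le hp (v := fun r => w r + ENNReal.ofReal (θ * Real.exp (L * r)))
    fun r hr => ?_
  set v : ℝ → ℝ≥0∞ := fun r => w r + ENNReal.ofReal (θ * Real.exp (L * r)) with hv
  have f1 : ∀ s ∈ Ioc 0 r, ENNReal.ofReal (mass N ψ s)⁻¹ * flux N p ψ V v s
      ≤ ENNReal.ofReal (mass N ψ s)⁻¹ * flux N p ψ V w s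
        + ENNReal.ofReal (θ / 2) * ENNReal.ofReal (L * Real.exp (L * s)) := by
    intro s hs
    have hs' : s ∈ Ioc 0 r₀ := ⟨hs.1, hs.2.trans hr.2⟩
    have g1 : flux N p ψ V v s ≤ flux N p ψ V w s + ∫⁻ t in Ioc 0 s,
        ENNReal.ofReal (mass N ψ t) * ENNReal.ofReal (D * (θ * Real.exp (L * t))) := by
      unfold flux
      rw [← lintegral_add_left (h.flux_integrand_measurable hwm)]
      refine setLIntegral_mono' measurableSet_Ioc fun t ht => ?_
      rw [← mul_add]
      gcongr
      have ht' : t ∈ Icc 0 r₀ := ⟨ht.1.le, ht.2.trans hs'.2⟩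
      refine nlin_add_le hp1 (hb t ht') hB.le ((profile_mono hp a ht'.2).trans ha) hC
        (by positivity) (le_trans ?_ hθ1)
      have := ht'.2
      gcongr
    have g2 := hk s hs' (fun t => ENNReal.ofReal (D * (θ * Real.exp (L * t))))
      (ENNReal.ofReal (D * (θ * Real.exp (L * s)))) (fun t ht => by
        have := ht.2
        refine ENNReal.ofReal_le_ofReal ?_
        gcongr)
    calc _ ≤ ENNReal.ofReal (mass N ψ s)⁻¹ * (flux N p ψ V w s + ∫⁻ t in Ioc 0 s,
        ENNReal.ofReal (mass N ψ t) * ENNReal.ofReal (D * (θ * Real.exp (L * t)))) := by gcongr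
      _ ≤ ENNReal.ofReal (mass N ψ s)⁻¹ * flux N p ψ V w s
        + ENNReal.ofReal κ * ENNReal.ofReal (D * (θ * Real.exp (L * s))) := by
          rw [mul_add]
          gcongr
      _ = _ := by
          rw [← ENNReal.ofReal_mul hκ.le, ← ENNReal.ofReal_mul (by positivity)]
          congr 2
          rw [hL]; ring
  have f2 : ∫⁻ s in Ioc 0 r, ENNReal.ofReal (mass N ψ s)⁻¹ * flux N p ψ V v s
      ≤ (∫⁻ s in Ioc 0 r, ENNReal.ofReal (mass N ψ s)⁻¹ * flux N p ψ V w s)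
        + ENNReal.ofReal (θ / 2) * ENNReal.ofReal (Real.exp (L * r)) := by
    refine (setLIntegral_mono' measurableSet_Ioc f1).trans ?_
    rw [lintegral_add_left (h.volterra_integrand_measurable w),
      lintegral_const_mul' _ _ ofReal_ne_top]
    gcongr
    exact lintegral_exp_le hL0 hr.1
  have f3 : ENNReal.ofReal (θ / 2) + ENNReal.ofReal (θ / 2) * ENNReal.ofReal (Real.exp (L * r))
      ≤ ENNReal.ofReal (θ * Real.exp (L * r)) := by
    rw [← ENNReal.ofReal_mul (by positivity), ← ENNReal.ofReal_add (by positivity) (by positivity)]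
    refine ENNReal.ofReal_le_ofReal ?_
    have : 1 ≤ Real.exp (L * r) := Real.one_le_exp (mul_nonneg hL0.le hr.1)
    nlinarith
  change volterra N p ψ V _ v r ≤ w r + _
  rw [hw, ← profile_eq hp a r]
  unfold volterra
  calc _ ≤ a + ENNReal.ofReal (θ / 2)
        + ((∫⁻ s in Ioc 0 r, ENNReal.ofReal (mass N ψ s)⁻¹ * flux N p ψ V w s)
        + ENNReal.ofReal (θ / 2) * ENNReal.ofReal (Real.exp (L * r))) := by gcongr
    _ = a + (∫⁻ s in Ioc 0 r, ENNReal.ofReal (mass N ψ s)⁻¹ * flux N p ψ V w s)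
        + (ENNReal.ofReal (θ / 2)
          + ENNReal.ofReal (θ / 2) * ENNReal.ofReal (Real.exp (L * r))) := by ring
    _ ≤ _ := by gcongr

end Volterra

end

/-! ### Regularity of the minimal solution while it is finite. -/

section

open MeasureTheory ENNReal

/-- The real-valued minimal solution of the integral equation. -/
def realProfile (N : ℕ) (p : ℝ) (hp : 0 ≤ p) (ψ V : ℝ → ℝ) (a : ℝ≥0∞) (r : ℝ) : ℝ :=
  (profile N p hp ψ V a r).toReal

/-- The real-valued nonlinearity along the minimal solution. -/
def realNlin (N : ℕ) (p : ℝ) (hp : 0 ≤ p) (ψ V : ℝ → ℝ) (a : ℝ≥0∞) (r : ℝ) : ℝ :=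
  V r * realProfile N p hp ψ V a r + ψ r ^ (p - 1) * realProfile N p hp ψ V a r ^ p

/-- The real-valued flux along the minimal solution. -/
def realFlux (N : ℕ) (p : ℝ) (hp : 0 ≤ p) (ψ V : ℝ → ℝ) (a : ℝ≥0∞) (s : ℝ) : ℝ :=
  ∫ t in (0 : ℝ)..s, mass N ψ t * realNlin N p hp ψ V a t

/-- The derivative of the minimal solution divided by the radius. -/
def radialSlope (N : ℕ) (p : ℝ) (hp : 0 ≤ p) (ψ V : ℝ → ℝ) (a : ℝ≥0∞) (s : ℝ) : ℝ :=
  realFlux N p hp ψ V a s / (s * mass N ψ s)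

section Regularity

variable {N : ℕ} {p R ρ : ℝ} {ψ V : ℝ → ℝ} {a : ℝ≥0∞}

theorem realProfile_nonneg (hp : 0 ≤ p) (r : ℝ) : 0 ≤ realProfile N p hp ψ V a r := toReal_nonneg

theorem IsWeight.realNlin_nonneg (h : IsWeight N p R ψ V) (hp : 0 ≤ p) {r : ℝ}
    (hr : r ∈ Ico 0 R) : 0 ≤ realNlin N p hp ψ V a r :=
  add_nonneg (mul_nonneg (h.nonneg r hr) (realProfile_nonneg hp r))
    (mul_nonneg (Real.rpow_nonneg (h.pos r hr).le _) (Real.rpow_nonneg (realProfile_nonneg hp r) _))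

theorem IsWeight.nlin_eq_ofReal (h : IsWeight N p R ψ V) (hp : 0 ≤ p) {r : ℝ} (hr : r ∈ Ico 0 R)
    (hfin : profile N p hp ψ V a r ≠ ⊤) :
    nlin p ψ V r (profile N p hp ψ V a r) = ENNReal.ofReal (realNlin N p hp ψ V a r) := by
  have hw := realProfile_nonneg (N := N) (ψ := ψ) (V := V) (a := a) hp r
  have h1 := Real.rpow_nonneg (h.pos r hr).le (p - 1)
  unfold realNlin nlin
  rw [ENNReal.ofReal_add (mul_nonneg (h.nonneg r hr) hw) (by positivity),
    ENNReal.ofReal_mul (h.nonneg r hr), ENNReal.ofReal_mul h1,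
    ← ENNReal.ofReal_rpow_of_nonneg hw hp, realProfile, ENNReal.ofReal_toReal hfin]

theorem IsWeight.mass_nonneg (h : IsWeight N p R ψ V) {r : ℝ} (hr : r ∈ Ico 0 R) :
    0 ≤ mass N ψ r :=
  mul_nonneg (pow_nonneg hr.1 _) (pow_nonneg (h.pos r hr).le _)

/-- On [0, r₁] the integrand of the equation is bounded because the profile is at most its value at
r₁; hence the profile is Lipschitz there. -/
theorem IsWeight.realProfile_continuousOn (h : IsWeight N p R ψ V) (hp : 0 ≤ p) (hρ : ρ ≤ R)
    (hfin : ∀ r ∈ Ico 0 ρ, profile N p hp ψ V a r ≠ ⊤) :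
    ContinuousOn (realProfile N p hp ψ V a) (Ico 0 ρ) := by
  set w := profile N p hp ψ V a with hw
  have key : ∀ r₁ ∈ Ico 0 ρ, ∃ K : ℝ, 0 ≤ K ∧ ∀ r ∈ Icc 0 r₁, ∀ s ∈ Icc 0 r₁, r ≤ s →
      realProfile N p hp ψ V a s ≤ realProfile N p hp ψ V a r + K * (s - r) := by
    intro r₁ hr₁
    obtain ⟨κ, B, hκ, hB, hb, hk⟩ := h.exists_bounds hr₁.1 (hr₁.2.trans_le hρ)
    set c := w r₁
    have hct : c ≠ ⊤ := hfin r₁ hr₁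
    set D : ℝ≥0∞ := ENNReal.ofReal κ * (ENNReal.ofReal B * (c + c ^ p)) with hD
    have hDt : D ≠ ⊤ := mul_ne_top ofReal_ne_top (mul_ne_top ofReal_ne_top
      (add_ne_top.2 ⟨hct, rpow_ne_top_of_nonneg hp hct⟩))
    refine ⟨D.toReal, toReal_nonneg, fun r hr s hs hrs => ?_⟩
    have hle : w s ≤ w r + D * ENNReal.ofReal (s - r) := by
      rw [hw, ← profile_eq hp a s]
      unfold volterra
      rw [← Ioc_union_Ioc_eq_Ioc hr.1 hrs, lintegral_union measurableSet_Ioc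
          (Ioc_disjoint_Ioc_of_le le_rfl), ← add_assoc]
      refine add_le_add (profile_eq hp a r).le ?_
      calc _ ≤ ∫⁻ _ in Ioc r s, D := by
            refine setLIntegral_mono' measurableSet_Ioc fun t ht => ?_
            refine hk t ⟨hr.1.trans_lt ht.1, ht.2.trans hs.2⟩ _ _ fun t' ht' => ?_
            have : t' ≤ r₁ := ht'.2.trans (ht.2.trans hs.2)
            exact nlin_le_of_bounds hp (hb t' ⟨ht'.1.le, this⟩) (profile_mono hp a this)
        _ = D * ENNReal.ofReal (s - r) := by simp
    have hrt : w r ≠ ⊤ := hfin r ⟨hr.1, hr.2.trans_lt hr₁.2⟩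
    have := ENNReal.toReal_mono (add_ne_top.2 ⟨hrt, mul_ne_top hDt ofReal_ne_top⟩) hle
    rwa [ENNReal.toReal_add hrt (mul_ne_top hDt ofReal_ne_top), ENNReal.toReal_mul,
      ENNReal.toReal_ofReal (by linarith)] at this
  have hmono : ∀ r s, r ≤ s → s ∈ Ico 0 ρ →
      realProfile N p hp ψ V a r ≤ realProfile N p hp ψ V a s := fun r s hrs hs =>
    ENNReal.toReal_mono (hfin s hs) (profile_mono hp a hrs)
  intro x hx
  obtain ⟨r₁, hxr, hr₁ρ⟩ := exists_between hx.2
  have hr₁ : r₁ ∈ Ico 0 ρ := ⟨hx.1.trans hxr.le, hr₁ρ⟩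
  obtain ⟨K, hK, hlip⟩ := key r₁ hr₁
  have hL : LipschitzOnWith (Real.toNNReal K) (realProfile N p hp ψ V a) (Icc 0 r₁) := by
    refine LipschitzOnWith.of_dist_le_mul fun r hr s hs => ?_
    rw [Real.coe_toNNReal K hK, Real.dist_eq, Real.dist_eq]
    rcases le_total r s with hrs | hrs
    · have h1 := hlip r hr s hs hrs
      have h2 := hmono r s hrs ⟨hs.1, hs.2.trans_lt hr₁ρ⟩
      rw [abs_of_nonpos (by linarith), abs_of_nonpos (by linarith)]
      linarith
    · have h1 := hlip s hs r hr hrs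
      have h2 := hmono s r hrs ⟨hr.1, hr.2.trans_lt hr₁ρ⟩
      rw [abs_of_nonneg (by linarith), abs_of_nonneg (by linarith)]
      linarith
  have := hL.continuousOn x ⟨hx.1, hxr.le⟩
  refine this.mono_of_mem_nhdsWithin ?_
  filter_upwards [self_mem_nhdsWithin, mem_nhdsWithin_of_mem_nhds (Iio_mem_nhds hxr)] with y hy hy'
  exact ⟨hy.1, le_of_lt hy'⟩

theorem IsWeight.realNlin_continuousOn (h : IsWeight N p R ψ V) (hp : 0 ≤ p) (hρ : ρ ≤ R)
    (hfin : ∀ r ∈ Ico 0 ρ, profile N p hp ψ V a r ≠ ⊤) :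
    ContinuousOn (realNlin N p hp ψ V a) (Ico 0 ρ) := by
  have hsub : Ico 0 ρ ⊆ Ico 0 R := Ico_subset_Ico_right hρ
  have hc := h.realProfile_continuousOn hp hρ hfin
  exact ((h.potential_cont.mono hsub).mul hc).add
    (((h.cont.mono hsub).rpow_const fun r hr => Or.inl (h.pos r (hsub hr)).ne').mul
      (hc.rpow_const fun _ _ => Or.inr hp))

theorem IsWeight.mass_continuousOn (h : IsWeight N p R ψ V) :
    ContinuousOn (mass N ψ) (Ico 0 R) :=
  (continuousOn_id.pow _).mul (h.cont.pow _)

theorem IsWeight.fluxDensity_continuousOn (h : IsWeight N p R ψ V) (hp : 0 ≤ p) (hρ : ρ ≤ R)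
    (hfin : ∀ r ∈ Ico 0 ρ, profile N p hp ψ V a r ≠ ⊤) :
    ContinuousOn (fun t => mass N ψ t * realNlin N p hp ψ V a t) (Ico 0 ρ) :=
  (h.mass_continuousOn.mono (Ico_subset_Ico_right hρ)).mul (h.realNlin_continuousOn hp hρ hfin)

theorem IsWeight.flux_eq_ofReal (h : IsWeight N p R ψ V) (hp : 0 ≤ p) (hρ : ρ ≤ R)
    (hfin : ∀ r ∈ Ico 0 ρ, profile N p hp ψ V a r ≠ ⊤) {s : ℝ} (hs : s ∈ Ico 0 ρ) :
    flux N p ψ V (profile N p hp ψ V a) s = ENNReal.ofReal (realFlux N p hp ψ V a s) := by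
  have hmem : ∀ t ∈ Ioc 0 s, t ∈ Ico 0 ρ := fun t ht => ⟨ht.1.le, ht.2.trans_lt hs.2⟩
  have hmem' : ∀ t ∈ Ioc 0 s, t ∈ Ico 0 R := fun t ht => Ico_subset_Ico_right hρ (hmem t ht)
  unfold realFlux flux
  rw [intervalIntegral.integral_of_le hs.1, ofReal_integral_eq_lintegral_ofReal]
  · refine setLIntegral_congr_fun measurableSet_Ioc fun t ht => ?_
    rw [h.nlin_eq_ofReal hp (hmem' t ht) (hfin t (hmem t ht)),
      ENNReal.ofReal_mul (h.mass_nonneg (hmem' t ht))]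
  · exact (((h.fluxDensity_continuousOn hp hρ hfin).mono fun t ht =>
      ⟨ht.1, ht.2.trans_lt hs.2⟩ : ContinuousOn _ (Icc 0 s)).integrableOn_Icc).mono_set
        Ioc_subset_Icc_self
  · filter_upwards [ae_restrict_mem measurableSet_Ioc] with t ht
    exact mul_nonneg (h.mass_nonneg (hmem' t ht)) (h.realNlin_nonneg hp (hmem' t ht))

theorem IsWeight.realFlux_nonneg (h : IsWeight N p R ψ V) (hp : 0 ≤ p) {s : ℝ}
    (hs : s ∈ Ico 0 R) : 0 ≤ realFlux N p hp ψ V a s := by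
  refine intervalIntegral.integral_nonneg hs.1 fun t ht => ?_
  have : t ∈ Ico 0 R := ⟨ht.1, ht.2.trans_lt hs.2⟩
  exact mul_nonneg (h.mass_nonneg this) (h.realNlin_nonneg hp this)

theorem IsWeight.hasDerivAt_realFlux (h : IsWeight N p R ψ V) (hp : 0 ≤ p) (hρ : ρ ≤ R)
    (hfin : ∀ r ∈ Ico 0 ρ, profile N p hp ψ V a r ≠ ⊤) {s : ℝ} (hs : s ∈ Ioo 0 ρ) :
    HasDerivAt (realFlux N p hp ψ V a) (mass N ψ s * realNlin N p hp ψ V a s) s := by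
  have hc := h.fluxDensity_continuousOn hp hρ hfin
  refine intervalIntegral.integral_hasDerivAt_right ?_ ?_ ?_
  · refine ContinuousOn.intervalIntegrable (hc.mono ?_)
    rw [uIcc_of_le hs.1.le]
    exact fun t ht => ⟨ht.1, ht.2.trans_lt hs.2⟩
  · exact (hc.mono Ioo_subset_Ico_self).stronglyMeasurableAtFilter isOpen_Ioo s hs
  · exact (hc.mono Ioo_subset_Ico_self).continuousAt (Ioo_mem_nhds hs.1 hs.2)

theorem IsWeight.hasDerivAt_realProfile (h : IsWeight N p R ψ V) (hp : 0 ≤ p) (hρ : ρ ≤ R)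
    (hfin : ∀ r ∈ Ico 0 ρ, profile N p hp ψ V a r ≠ ⊤) {r : ℝ} (hr : r ∈ Ioo 0 ρ) :
    HasDerivAt (realProfile N p hp ψ V a) (r * radialSlope N p hp ψ V a r) r := by
  set k : ℝ → ℝ := fun s => (mass N ψ s)⁻¹ * realFlux N p hp ψ V a s with hk
  have hkc : ContinuousOn k (Ioo 0 ρ) := by
    intro s hs
    have hs' : s ∈ Ioo 0 R := ⟨hs.1, hs.2.trans_le hρ⟩
    have c1 : ContinuousAt (mass N ψ) s :=
      (h.mass_continuousOn.mono Ioo_subset_Ico_self).continuousAt (Ioo_mem_nhds hs'.1 hs'.2)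
    exact ((c1.inv₀ (h.mass_pos hs').ne').mul
      (h.hasDerivAt_realFlux hp hρ hfin hs).continuousAt).continuousWithinAt
  -- The integral is started at some c > 0, away from the origin, where the mass may vanish and its
  -- inverse is not controlled.
  obtain ⟨c, hc0, hcr⟩ := exists_between hr.1
  have hcI : c ∈ Ico 0 ρ := ⟨hc0.le, hcr.trans hr.2⟩
  have hform : ∀ x ∈ Ioo c ρ, realProfile N p hp ψ V a x
      = realProfile N p hp ψ V a c + ∫ s in c..x, k s := by
    intro x hx
    have hxI : x ∈ Ico 0 ρ := ⟨hc0.le.trans hx.1.le, hx.2⟩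
    have hsub : Icc c x ⊆ Ioo 0 ρ := fun s hs => ⟨hc0.trans_le hs.1, hs.2.trans_lt hx.2⟩
    have hE : profile N p hp ψ V a x
        = profile N p hp ψ V a c + ∫⁻ s in Ioc c x, ENNReal.ofReal (k s) := by
      rw [← profile_eq hp a x, ← profile_eq hp a c]
      unfold volterra
      rw [← Ioc_union_Ioc_eq_Ioc hc0.le hx.1.le, lintegral_union measurableSet_Ioc
          (Ioc_disjoint_Ioc_of_le le_rfl), ← add_assoc]
      congr 1
      refine setLIntegral_congr_fun measurableSet_Ioc fun s hs => ?_
      have hs' := hsub (Ioc_subset_Icc_self hs)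
      simp only [hk]
      rw [h.flux_eq_ofReal hp hρ hfin ⟨hs'.1.le, hs'.2⟩, ENNReal.ofReal_mul
        (inv_nonneg.2 (h.mass_nonneg ⟨hs'.1.le, hs'.2.trans_le hρ⟩))]
    have hi : IntegrableOn k (Ioc c x) volume :=
      ((hkc.mono hsub).integrableOn_Icc).mono_set Ioc_subset_Icc_self
    have hnn : 0 ≤ᵐ[volume.restrict (Ioc c x)] k := by
      filter_upwards [ae_restrict_mem measurableSet_Ioc] with s hs
      have hs' := hsub (Ioc_subset_Icc_self hs)
      have hs'' : s ∈ Ico 0 R := ⟨hs'.1.le, hs'.2.trans_le hρ⟩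
      exact mul_nonneg (inv_nonneg.2 (h.mass_nonneg hs'')) (h.realFlux_nonneg hp hs'')
    rw [← ofReal_integral_eq_lintegral_ofReal hi hnn] at hE
    unfold realProfile
    rw [hE, ENNReal.toReal_add (hfin c hcI) ofReal_ne_top, ENNReal.toReal_ofReal
      (integral_nonneg_of_ae hnn), intervalIntegral.integral_of_le hx.1.le]
  have hd : HasDerivAt (fun x => realProfile N p hp ψ V a c + ∫ s in c..x, k s) (k r) r := by
    refine HasDerivAt.const_add _ (intervalIntegral.integral_hasDerivAt_right ?_ ?_ ?_)
    · refine ContinuousOn.intervalIntegrable (hkc.mono ?_)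
      rw [uIcc_of_le hcr.le]
      exact fun s hs => ⟨hc0.trans_le hs.1, hs.2.trans_lt hr.2⟩
    · exact hkc.stronglyMeasurableAtFilter isOpen_Ioo r hr
    · exact hkc.continuousAt (Ioo_mem_nhds hr.1 hr.2)
  refine (hd.congr_of_eventuallyEq ?_).congr_deriv ?_
  · filter_upwards [Ioo_mem_nhds hcr hr.2] with x hx using hform x hx
  · have h1 := (h.mass_pos ⟨hr.1, hr.2.trans_le hρ⟩).ne'
    have h2 := hr.1.ne'
    simp only [hk, radialSlope]
    field_simp

/-- The flux is compared with s^N by l'Hôpital's rule; the factor 1/N is the derivative of s^N seen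
in the limit. This value is what makes the Hessian continuous at the centre. -/
theorem IsWeight.tendsto_radialSlope (h : IsWeight N p R ψ V) (hp : 0 ≤ p) (hρ : ρ ≤ R)
    (hρ0 : 0 < ρ) (hfin : ∀ r ∈ Ico 0 ρ, profile N p hp ψ V a r ≠ ⊤) :
    Tendsto (radialSlope N p hp ψ V a) (𝓝[>] 0) (𝓝 (realNlin N p hp ψ V a 0 / N)) := by
  have h0 : (0 : ℝ) ∈ Ico 0 ρ := ⟨le_rfl, hρ0⟩
  have h0R : (0 : ℝ) ∈ Ico 0 R := ⟨le_rfl, h.radius_pos⟩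
  have hN : (N : ℝ) ≠ 0 := by have := h.one_le_dim; positivity
  have lim : ∀ {f : ℝ → ℝ}, ContinuousOn f (Ico 0 ρ) → Tendsto f (𝓝[>] 0) (𝓝 (f 0)) := by
    intro f hf
    exact (hf 0 h0).mono_left (nhdsWithin_le_of_mem
      (mem_of_superset (Ioo_mem_nhdsGT hρ0) Ioo_subset_Ico_self))
  have hψ := lim (h.cont.mono (Ico_subset_Ico_right hρ))
  have hF := lim (h.realNlin_continuousOn hp hρ hfin)
  have hIcont : Tendsto (realFlux N p hp ψ V a) (𝓝[>] 0) (𝓝 0) := by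
    have hρ2 : ρ / 2 ∈ Ico 0 ρ := ⟨by linarith, by linarith⟩
    have hint : IntegrableOn (fun t => mass N ψ t * realNlin N p hp ψ V a t) (uIcc 0 (ρ / 2))
        volume := by
      rw [uIcc_of_le hρ2.1]
      exact ((h.fluxDensity_continuousOn hp hρ hfin).mono fun t ht =>
        ⟨ht.1, ht.2.trans_lt hρ2.2⟩ : ContinuousOn _ (Icc 0 (ρ / 2))).integrableOn_Icc
    have hc := intervalIntegral.continuousOn_primitive_interval hint
    rw [uIcc_of_le hρ2.1] at hc
    have h1 := hc 0 ⟨le_rfl, hρ2.1⟩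
    have h2 : Tendsto (realFlux N p hp ψ V a) (𝓝[Icc 0 (ρ / 2)] 0)
        (𝓝 (realFlux N p hp ψ V a 0)) := h1
    have h3 : realFlux N p hp ψ V a 0 = 0 := by simp [realFlux]
    rw [h3] at h2
    refine h2.mono_left (nhdsWithin_le_of_mem ?_)
    exact mem_of_superset (Ioo_mem_nhdsGT (by linarith : (0 : ℝ) < ρ / 2)) Ioo_subset_Icc_self
  have hq : Tendsto (fun s => realFlux N p hp ψ V a s / s ^ N) (𝓝[>] 0)
      (𝓝 (ψ 0 ^ 2 * realNlin N p hp ψ V a 0 / N)) := by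
    refine HasDerivAt.lhopital_zero_right_on_Ioo hρ0
      (fun s hs => h.hasDerivAt_realFlux hp hρ hfin hs) (fun s _ => hasDerivAt_pow N s) ?_ hIcont ?_
      ?_
    · intro s hs
      have := hs.1
      positivity
    · have : Tendsto (fun s : ℝ => s ^ N) (𝓝 0) (𝓝 (0 ^ N)) := (continuous_pow N).tendsto 0
      rw [zero_pow (by have := h.one_le_dim; omega)] at this
      exact this.mono_left nhdsWithin_le_nhds
    · refine (((hψ.pow 2).mul hF).div_const (N : ℝ)).congr' ?_
      filter_upwards [self_mem_nhdsWithin] with s hs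
      have hs' : s ≠ 0 := (mem_Ioi.1 hs).ne'
      unfold mass
      have : s ^ (N - 1) ≠ 0 := pow_ne_zero _ hs'
      field_simp
  have hfinal := hq.div (hψ.pow 2) (pow_ne_zero 2 (h.pos 0 h0R).ne')
  have e : ψ 0 ^ 2 * realNlin N p hp ψ V a 0 / N / ψ 0 ^ 2 = realNlin N p hp ψ V a 0 / N := by
    have := (h.pos 0 h0R).ne'
    field_simp
  rw [e] at hfinal
  refine hfinal.congr' ?_
  filter_upwards [Ioo_mem_nhdsGT hρ0] with s hs
  simp only [radialSlope, mass, Pi.div_apply]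
  have hs' : s ≠ 0 := hs.1.ne'
  have hψs := (h.pos s ⟨hs.1.le, hs.2.trans_le hρ⟩).ne'
  obtain ⟨n, rfl⟩ : ∃ n, N = n + 1 := ⟨N - 1, by have := h.one_le_dim; omega⟩
  simp only [Nat.add_sub_cancel, pow_succ]
  field_simp

theorem IsWeight.hasDerivAt_radialSlope (h : IsWeight N p R ψ V) (hp : 0 ≤ p) (hρ : ρ ≤ R)
    (hfin : ∀ r ∈ Ico 0 ρ, profile N p hp ψ V a r ≠ ⊤) {r ψ' : ℝ} (hr : r ∈ Ioo 0 ρ)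
    (hψ : HasDerivAt ψ ψ' r) :
    HasDerivAt (radialSlope N p hp ψ V a) ((realNlin N p hp ψ V a r
      - (N + 2 * r * ψ' / ψ r) * radialSlope N p hp ψ V a r) / r) r := by
  have hr0 : r ≠ 0 := hr.1.ne'
  have hψr := (h.pos r ⟨hr.1.le, hr.2.trans_le hρ⟩).ne'
  have hm := (h.mass_pos ⟨hr.1, hr.2.trans_le hρ⟩).ne'
  obtain ⟨n, rfl⟩ : ∃ n, N = n + 1 := ⟨N - 1, by have := h.one_le_dim; omega⟩
  have d1 : HasDerivAt (fun s => s * mass (n + 1) ψ s)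
      ((n + 1) * r ^ n * ψ r ^ 2 + r ^ (n + 1) * (2 * ψ r * ψ')) r := by
    have := (hasDerivAt_pow (n + 1) r).mul (hψ.pow 2)
    refine (this.congr_of_eventuallyEq (Eventually.of_forall fun s => ?_)).congr_deriv ?_
    · simp only [mass, Nat.add_sub_cancel, Pi.mul_apply, Pi.pow_apply]; ring
    · push_cast; simp
  have := (h.hasDerivAt_realFlux hp hρ hfin hr).div d1 (mul_ne_zero hr0 hm)
  refine this.congr_deriv ?_
  have hx : realFlux (n + 1) p hp ψ V a r
      = radialSlope (n + 1) p hp ψ V a r * (r * mass (n + 1) ψ r) := by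
    unfold radialSlope; field_simp
  rw [hx]
  simp only [mass, Nat.add_sub_cancel]
  push_cast
  field_simp
  ring

end Regularity

end

/-! ### The weight adapted to the Hardy potential; dependence of the profiles on the central value.
-/

section

open MeasureTheory ENNReal

/-- Monotone convergence in the integral equation. Consequently a profile that is infinite at ρ is
already unbounded to the left of ρ. -/
theorem profile_le_of_forall_lt {N : ℕ} {p : ℝ} {ψ V : ℝ → ℝ} {a C : ℝ≥0∞} (hp : 0 ≤ p) {ρ : ℝ}
    (h : ∀ r < ρ, profile N p hp ψ V a r ≤ C) : profile N p hp ψ V a ρ ≤ C := by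
  rw [← profile_eq]
  unfold volterra
  have e : (∫⁻ s in Ioc 0 ρ, ENNReal.ofReal (mass N ψ s)⁻¹ * flux N p ψ V (profile N p hp ψ V a) s)
      = ∫⁻ s in ⋃ n : ℕ, Ioc 0 (ρ - 1 / (n + 1)),
        ENNReal.ofReal (mass N ψ s)⁻¹ * flux N p ψ V (profile N p hp ψ V a) s := by
    have : ⋃ n : ℕ, Ioc 0 (ρ - 1 / ((n : ℝ) + 1)) = Ioo 0 ρ := by
      ext s
      simp only [mem_iUnion, mem_Ioc, mem_Ioo]
      constructor
      · rintro ⟨n, h1, h2⟩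
        have : 0 < 1 / ((n : ℝ) + 1) := by positivity
        exact ⟨h1, by linarith⟩
      · rintro ⟨h1, h2⟩
        obtain ⟨n, hn⟩ := exists_nat_one_div_lt (sub_pos.2 h2)
        exact ⟨n, h1, by linarith⟩
    rw [this]
    exact (setLIntegral_congr Ioo_ae_eq_Ioc).symm
  have hmono : Monotone fun n : ℕ => Ioc 0 (ρ - 1 / ((n : ℝ) + 1)) := by
    intro m n hmn
    refine Ioc_subset_Ioc_right (sub_le_sub_left ?_ _)
    gcongr
  rw [e, setLIntegral_iUnion_of_directed _ hmono.directed_le, ENNReal.add_iSup]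
  refine iSup_le fun n => ?_
  have := h (ρ - 1 / ((n : ℝ) + 1)) (sub_lt_self _ (by positivity))
  rwa [← profile_eq] at this

theorem betaMinus_mul {μ : ℝ} (hμ : μ < 1 / 4) : betaMinus μ * (1 - betaMinus μ) = μ := by
  unfold betaMinus
  have := Real.sq_sqrt (show 0 ≤ 1 / 4 - μ by linarith)
  nlinarith

theorem betaMinus_lt_half {μ : ℝ} (hμ : μ < 1 / 4) : betaMinus μ < 1 / 2 := by
  unfold betaMinus
  have := Real.sqrt_pos.2 (show 0 < 1 / 4 - μ by linarith)
  linarith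

/-- The parameters of the problem. -/
structure Params where
  /-- The dimension. -/
  N : ℕ
  /-- The radius of the ball. -/
  R : ℝ
  /-- The exponent of the nonlinearity. -/
  p : ℝ
  /-- The coefficient of the Hardy potential. -/
  μ : ℝ
  one_le_dim : 1 ≤ N
  radius_pos : 0 < R
  one_lt : 1 < p
  lower : -muStar p < μ
  upper : μ < 1 / 4
  ne_zero : μ ≠ 0

namespace Params

variable (D : Params)

/-- The exponent `β₋`. -/
def β : ℝ := betaMinus D.μ

/-- The exponent of the weight. -/
def b : ℝ := max D.β 0

/-- The weight `(R ^ 2 - r ^ 2) ^ b`. -/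
def weight (r : ℝ) : ℝ := (D.R ^ 2 - r ^ 2) ^ D.b

/-- The potential `- L_μ ψ / ψ` of the weight. -/
def pot (r : ℝ) : ℝ :=
  (2 * D.b * D.N * (D.R ^ 2 - r ^ 2) + 4 * D.b * (1 - D.b) * r ^ 2 - D.μ * (D.R + r) ^ 2)
    / (D.R ^ 2 - r ^ 2) ^ 2

theorem p_nonneg : 0 ≤ D.p := zero_le_one.trans D.one_lt.le

theorem β_mul : D.β * (1 - D.β) = D.μ := betaMinus_mul D.upper

theorem β_lt_half : D.β < 1 / 2 := betaMinus_lt_half D.upper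

theorem β_cases : (D.β < 0 ∧ D.μ < 0) ∨ (0 < D.β ∧ 0 < D.μ) := by
  have h1 := D.β_mul
  have h2 := D.β_lt_half
  rcases lt_trichotomy D.β 0 with h | h | h
  · left; exact ⟨h, by nlinarith⟩
  · exfalso; rw [h] at h1; exact D.ne_zero (by linarith)
  · right; exact ⟨h, by nlinarith⟩

theorem sq_sub_pos {r : ℝ} (hr : r ∈ Ico 0 D.R) : 0 < D.R ^ 2 - r ^ 2 := by
  have h1 := hr.1
  have h2 := hr.2
  nlinarith

theorem weight_pos {r : ℝ} (hr : r ∈ Ico 0 D.R) : 0 < D.weight r :=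
  Real.rpow_pos_of_pos (D.sq_sub_pos hr) _

/-- For β₋ < 0 the weight is constant and μ < 0, so the potential is -μ/(R - r)². For β₋ > 0 the
identity β₋ (1 - β₋) = μ cancels the double pole at R, and what remains is a sum of nonnegative
terms. -/
theorem pot_nonneg {r : ℝ} (hr : r ∈ Ico 0 D.R) : 0 ≤ D.pot r := by
  refine div_nonneg ?_ (sq_nonneg _)
  have hr0 := hr.1
  have hrR := hr.2
  rcases D.β_cases with ⟨h1, h2⟩ | ⟨h1, h2⟩
  · have hb : D.b = 0 := max_eq_right h1.le
    rw [hb]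
    nlinarith [sq_nonneg (D.R + r)]
  · have hb : D.b = D.β := max_eq_left h1.le
    rw [hb, ← D.β_mul]
    have hN : (1 : ℝ) ≤ D.N := by exact_mod_cast D.one_le_dim
    have e : 2 * D.β * D.N * (D.R ^ 2 - r ^ 2) + 4 * D.β * (1 - D.β) * r ^ 2
        - D.β * (1 - D.β) * (D.R + r) ^ 2 = 2 * D.β * (D.N - 1) * ((D.R - r) * (D.R + r))
        + D.β * (D.R - r) * (D.R - r + D.β * (D.R + 3 * r)) := by ring
    rw [e]
    have : 0 ≤ D.R - r := by linarith
    have : 0 ≤ D.R + r := by linarith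
    have : (0 : ℝ) ≤ D.N - 1 := by linarith
    have : 0 ≤ D.R + 3 * r := by linarith
    positivity

theorem isWeight : IsWeight D.N D.p D.R D.weight D.pot where
  one_le_dim := D.one_le_dim
  one_lt := D.one_lt
  radius_pos := D.radius_pos
  pos := fun _ hr => D.weight_pos hr
  cont := ContinuousOn.rpow_const (by fun_prop) fun _ hr => Or.inl (D.sq_sub_pos hr).ne'
  meas := Measurable.pow_const (by fun_prop) _
  nonneg := fun _ hr => D.pot_nonneg hr
  potential_cont := ContinuousOn.div (by fun_prop) (by fun_prop) fun _ hr =>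
    pow_ne_zero 2 (D.sq_sub_pos hr).ne'
  potential_meas := by unfold pot; fun_prop

/-- The first derivative of the weight. -/
def weight' (r : ℝ) : ℝ := -2 * D.b * r * (D.R ^ 2 - r ^ 2) ^ (D.b - 1)

/-- The second derivative of the weight. -/
def weight'' (r : ℝ) : ℝ := -2 * D.b * (D.R ^ 2 - r ^ 2) ^ (D.b - 1)
  + 4 * D.b * (D.b - 1) * r ^ 2 * (D.R ^ 2 - r ^ 2) ^ (D.b - 2)

theorem hasDerivAt_weight {r : ℝ} (hr : r ∈ Ico 0 D.R) : HasDerivAt D.weight (D.weight' r) r := by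
  have h1 : HasDerivAt (fun r => D.R ^ 2 - r ^ 2) (-(2 * r)) r := by
    simpa using (hasDerivAt_pow 2 r).const_sub (D.R ^ 2)
  refine (h1.rpow_const (p := D.b) (Or.inl (D.sq_sub_pos hr).ne')).congr_deriv ?_
  unfold weight'; ring

theorem hasDerivAt_weight' {r : ℝ} (hr : r ∈ Ico 0 D.R) :
    HasDerivAt D.weight' (D.weight'' r) r := by
  have h1 : HasDerivAt (fun r => D.R ^ 2 - r ^ 2) (-(2 * r)) r := by
    simpa using (hasDerivAt_pow 2 r).const_sub (D.R ^ 2)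
  have h2 := h1.rpow_const (p := D.b - 1) (Or.inl (D.sq_sub_pos hr).ne')
  have h3 := ((hasDerivAt_id r).const_mul (-2 * D.b)).mul h2
  refine h3.congr_deriv ?_
  unfold weight''
  simp only [id]
  rw [show D.b - 1 - 1 = D.b - 2 by ring]
  ring

theorem weight_equation {r : ℝ} (hr : r ∈ Ioo 0 D.R) :
    D.weight'' r + (D.N - 1) / r * D.weight' r + D.μ / (D.R - r) ^ 2 * D.weight r
      = - (D.pot r * D.weight r) := by
  have hs := D.sq_sub_pos ⟨hr.1.le, hr.2⟩
  have hr0 := hr.1.ne'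
  have hd : D.R - r ≠ 0 := (sub_pos.2 hr.2).ne'
  unfold weight'' weight' weight pot
  have e1 : (D.R ^ 2 - r ^ 2) ^ (D.b - 1) = (D.R ^ 2 - r ^ 2) ^ D.b / (D.R ^ 2 - r ^ 2) := by
    rw [Real.rpow_sub_one hs.ne']
  have e2 : (D.R ^ 2 - r ^ 2) ^ (D.b - 2) = (D.R ^ 2 - r ^ 2) ^ D.b / (D.R ^ 2 - r ^ 2) ^ 2 := by
    rw [Real.rpow_sub hs]; norm_cast
  rw [e1, e2]
  have e3 : D.R ^ 2 - r ^ 2 = (D.R - r) * (D.R + r) := by ring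
  have hd2 : D.R + r ≠ 0 := by have := hr.1; have := D.radius_pos; positivity
  set P := (D.R ^ 2 - r ^ 2) ^ D.b
  rw [e3]
  field_simp
  ring

/-- The minimal solution with central value `a`, divided by the weight. -/
def w (a : ℝ) (r : ℝ) : ℝ≥0∞ :=
  profile D.N D.p D.p_nonneg D.weight D.pot (ENNReal.ofReal (a / D.weight 0)) r

/-- The radial profile with central value `a`. -/
def U (a : ℝ) (r : ℝ) : ℝ := D.weight r * (D.w a r).toReal

/-- The radius of existence of the radial solution with central value `a`. -/
def life (a : ℝ) : ℝ := sSup {r | r ∈ Ico 0 D.R ∧ D.w a r ≠ ⊤}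

theorem zero_mem_Ico : (0 : ℝ) ∈ Ico 0 D.R := ⟨le_rfl, D.radius_pos⟩

theorem w_mono (a : ℝ) : Monotone (D.w a) := profile_mono D.p_nonneg _

theorem w_of_nonpos (a : ℝ) {r : ℝ} (hr : r ≤ 0) :
    D.w a r = ENNReal.ofReal (a / D.weight 0) := profile_of_nonpos D.p_nonneg _ hr

theorem life_bddAbove (a : ℝ) : BddAbove {r | r ∈ Ico 0 D.R ∧ D.w a r ≠ ⊤} :=
  ⟨D.R, fun _ hr => hr.1.2.le⟩

theorem life_nonempty (a : ℝ) : {r | r ∈ Ico 0 D.R ∧ D.w a r ≠ ⊤}.Nonempty :=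
  ⟨0, D.zero_mem_Ico, by rw [D.w_of_nonpos a le_rfl]; exact ofReal_ne_top⟩

theorem life_le (a : ℝ) : D.life a ≤ D.R :=
  csSup_le (D.life_nonempty a)
    fun _ hr => hr.1.2.le

/-- Continuation shows that the radii of finiteness form a set without maximum, so the supremum
itself is excluded. -/
theorem lt_life_iff {a r : ℝ} (hr : r ∈ Ico 0 D.R) : r < D.life a ↔ D.w a r ≠ ⊤ := by
  constructor
  · intro h
    obtain ⟨s, hs, hrs⟩ := exists_lt_of_lt_csSup (D.life_nonempty a) h
    exact ne_top_of_le_ne_top hs.2 (D.w_mono a hrs.le)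
  · intro h
    obtain ⟨r₁, h1, h2, h3⟩ := D.isWeight.profile_continuation D.p_nonneg hr.1 hr.2 h
    exact h1.trans_le (le_csSup (D.life_bddAbove a) ⟨⟨hr.1.trans h1.le, h2⟩, h3⟩)

theorem life_pos (a : ℝ) : 0 < D.life a :=
  (D.lt_life_iff D.zero_mem_Ico).2 (by rw [D.w_of_nonpos a le_rfl]; exact ofReal_ne_top)

theorem w_ne_top {a r : ℝ} (hr : r ∈ Ico 0 (D.life a)) : D.w a r ≠ ⊤ :=
  (D.lt_life_iff ⟨hr.1, hr.2.trans_le (D.life_le a)⟩).1 hr.2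

theorem mem_of_life {a r : ℝ} (hr : r ∈ Ico 0 (D.life a)) : r ∈ Ico 0 D.R :=
  ⟨hr.1, hr.2.trans_le (D.life_le a)⟩

theorem U_zero {a : ℝ} (ha : 0 ≤ a) : D.U a 0 = a := by
  have h := D.weight_pos D.zero_mem_Ico
  unfold U
  rw [D.w_of_nonpos a le_rfl, ENNReal.toReal_ofReal (by positivity)]
  field_simp

theorem toReal_w_pos {a r : ℝ} (ha : 0 < a) (hr : r ∈ Ico 0 (D.life a)) :
    0 < (D.w a r).toReal := by
  refine ENNReal.toReal_pos ?_ (D.w_ne_top hr)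
  have h1 : ENNReal.ofReal (a / D.weight 0) ≤ D.w a r := le_profile D.p_nonneg _ r
  have h2 : 0 < ENNReal.ofReal (a / D.weight 0) :=
    ENNReal.ofReal_pos.2 (div_pos ha (D.weight_pos D.zero_mem_Ico))
  exact (h2.trans_le h1).ne'

theorem U_pos {a r : ℝ} (ha : 0 < a) (hr : r ∈ Ico 0 (D.life a)) : 0 < D.U a r :=
  mul_pos (D.weight_pos (D.mem_of_life hr)) (D.toReal_w_pos ha hr)

theorem toReal_w_mono {a r s : ℝ} (hrs : r ≤ s) (hs : s ∈ Ico 0 (D.life a)) :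
    (D.w a r).toReal ≤ (D.w a s).toReal :=
  ENNReal.toReal_mono (D.w_ne_top hs) (D.w_mono a hrs)

theorem U_div_weight_mono {a r s : ℝ} (hr : 0 ≤ r) (hrs : r ≤ s) (hs : s ∈ Ico 0 (D.life a)) :
    D.U a r / D.weight r ≤ D.U a s / D.weight s := by
  have h1 := D.weight_pos (D.mem_of_life ⟨hr, hrs.trans_lt hs.2⟩)
  have h2 := D.weight_pos (D.mem_of_life hs)
  unfold U
  rw [mul_div_cancel_left₀ _ h1.ne', mul_div_cancel_left₀ _ h2.ne']
  exact D.toReal_w_mono hrs hs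

theorem U_continuousOn (a : ℝ) : ContinuousOn (D.U a) (Ico 0 (D.life a)) :=
  (D.isWeight.cont.mono (Ico_subset_Ico_right (D.life_le a))).mul
    (D.isWeight.realProfile_continuousOn D.p_nonneg (D.life_le a) fun _ hr => D.w_ne_top hr)

/-- At the end of life the profile is infinite, hence unbounded before by left continuity, and w is
monotone; the weight stays positive there. -/
theorem tendsto_U_atTop {a : ℝ} (h : D.life a < D.R) :
    Tendsto (D.U a) (𝓝[<] D.life a) atTop := by
  have hl := D.life_pos a
  have hw : Tendsto (fun r => (D.w a r).toReal) (𝓝[<] D.life a) atTop := by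
    rw [Filter.tendsto_atTop]
    intro C
    obtain ⟨r, hr, hC⟩ : ∃ r < D.life a, ENNReal.ofReal C < D.w a r := by
      by_contra! hcon
      have h1 : D.w a (D.life a) ≤ ENNReal.ofReal C := profile_le_of_forall_lt D.p_nonneg hcon
      have h2 : D.w a (D.life a) ≠ ⊤ := ne_top_of_le_ne_top ofReal_ne_top h1
      exact lt_irrefl _ ((D.lt_life_iff ⟨hl.le, h⟩).2 h2)
    filter_upwards [Ioo_mem_nhdsLT (max_lt hr hl)] with s hs
    have hs0 : 0 ≤ s := (le_max_right r 0).trans hs.1.le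
    have h3 := D.w_ne_top ⟨hs0, hs.2⟩
    refine (ENNReal.ofReal_le_iff_le_toReal h3).1 (hC.le.trans (D.w_mono a ?_))
    exact (le_max_left r 0).trans hs.1.le
  have hψ : Tendsto D.weight (𝓝[<] D.life a) (𝓝 (D.weight (D.life a))) :=
    (D.hasDerivAt_weight ⟨hl.le, h⟩).continuousAt.tendsto.mono_left nhdsWithin_le_nhds
  exact hψ.pos_mul_atTop (D.weight_pos ⟨hl.le, h⟩) hw

theorem ofReal_mul_div {a l : ℝ} (hl : 0 ≤ l) : ENNReal.ofReal (l * a / D.weight 0)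
    = ENNReal.ofReal l * ENNReal.ofReal (a / D.weight 0) := by
  rw [mul_div_assoc, ENNReal.ofReal_mul hl]

theorem w_le_w {a a' : ℝ} (h : a ≤ a') (r : ℝ) : D.w a r ≤ D.w a' r := by
  have := D.weight_pos D.zero_mem_Ico
  refine profile_le_profile D.p_nonneg (ENNReal.ofReal_le_ofReal ?_) r
  gcongr

theorem life_anti {a a' : ℝ} (h : a ≤ a') : D.life a' ≤ D.life a := by
  by_contra! hlt
  have h1 := (D.lt_life_iff ⟨(D.life_pos a).le, hlt.trans_le (D.life_le a')⟩).1 hlt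
  exact lt_irrefl _ ((D.lt_life_iff ⟨(D.life_pos a).le, hlt.trans_le (D.life_le a')⟩).2
    (ne_top_of_le_ne_top h1 (D.w_le_w h _)))

/-- A consequence of superlinearity. The factor a / a' < 1 survives in boundary limits, where strict
pointwise order would not. -/
theorem U_ratio {a a' r : ℝ} (ha : 0 < a) (h : a ≤ a') (hr : r ∈ Ico 0 (D.life a')) :
    D.U a r ≤ a / a' * D.U a' r := by
  have ha' : 0 < a' := ha.trans_le h
  have h1 : D.w a r ≤ ENNReal.ofReal (a / a') * D.w a' r := by
    have := profile_mul_le (N := D.N) (ψ := D.weight) (V := D.pot)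
      (a := ENNReal.ofReal (a' / D.weight 0)) D.one_lt.le (l := ENNReal.ofReal (a / a'))
      (by rw [← ENNReal.ofReal_one]
          exact ENNReal.ofReal_le_ofReal ((div_le_one ha').2 h)) hr.1
    rw [← D.ofReal_mul_div (by positivity), div_mul_cancel₀ _ ha'.ne'] at this
    exact this
  have h2 := ENNReal.toReal_mono (mul_ne_top ofReal_ne_top (D.w_ne_top hr)) h1
  rw [ENNReal.toReal_mul, ENNReal.toReal_ofReal (by positivity)] at h2
  unfold U
  have := D.weight_pos (D.mem_of_life hr)
  calc _ ≤ D.weight r * (a / a' * (D.w a' r).toReal) := by gcongr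
    _ = _ := by ring

theorem U_mono {a a' r : ℝ} (ha : 0 < a) (h : a ≤ a') (hr : r ∈ Ico 0 (D.life a')) :
    D.U a r ≤ D.U a' r := by
  refine (D.U_ratio ha h hr).trans (mul_le_of_le_one_left ?_ ?_)
  · exact (D.U_pos (ha.trans_le h) hr).le
  · exact (div_le_one (ha.trans_le h)).2 h

theorem U_convex {a a' l m r : ℝ} (ha : 0 < a) (ha' : 0 < a') (hl : 0 ≤ l) (hm : 0 ≤ m)
    (hlm : l + m = 1) (hr : r ∈ Ico 0 (D.life a)) (hr' : r ∈ Ico 0 (D.life a')) :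
    D.U (l * a + m * a') r ≤ l * D.U a r + m * D.U a' r := by
  have hψ0 := D.weight_pos D.zero_mem_Ico
  have h1 : D.w (l * a + m * a') r
      ≤ ENNReal.ofReal l * D.w a r + ENNReal.ofReal m * D.w a' r := by
    have := profile_convex (a := ENNReal.ofReal (a / D.weight 0))
      (b := ENNReal.ofReal (a' / D.weight 0)) D.isWeight (l := ENNReal.ofReal l)
      (m := ENNReal.ofReal m) (by rw [← ENNReal.ofReal_add hl hm, hlm, ENNReal.ofReal_one]) hr.1
      D.p_nonneg
    rw [← D.ofReal_mul_div hl, ← D.ofReal_mul_div hm,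
      ← ENNReal.ofReal_add (by positivity) (by positivity), ← add_div] at this
    exact this
  have t1 := mul_ne_top (ofReal_ne_top (r := l)) (D.w_ne_top hr)
  have t2 := mul_ne_top (ofReal_ne_top (r := m)) (D.w_ne_top hr')
  have h2 := ENNReal.toReal_mono (add_ne_top.2 ⟨t1, t2⟩) h1
  rw [ENNReal.toReal_add t1 t2, ENNReal.toReal_mul, ENNReal.toReal_mul, ENNReal.toReal_ofReal hl,
    ENNReal.toReal_ofReal hm] at h2
  unfold U
  have := D.weight_pos (D.mem_of_life hr)
  calc _ ≤ D.weight r * (l * (D.w a r).toReal + m * (D.w a' r).toReal) := by gcongr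
    _ = _ := by ring

/-- The radial profile depends on its central value in a locally Lipschitz way. -/
theorem U_lipschitz {r C : ℝ} (hr : r ∈ Ico 0 D.R) : ∃ K η : ℝ, 0 < K ∧ 0 < η ∧
    ∀ a a' : ℝ, 0 < a → a ≤ a' → a' ≤ a + η → r < D.life a → D.U a r ≤ C →
      r < D.life a' ∧ D.U a' r ≤ D.U a r + K * (a' - a) := by
  have hψ0 := D.weight_pos D.zero_mem_Ico
  have hψ := D.weight_pos hr
  obtain ⟨L, hL, hLip⟩ := D.isWeight.profile_lipschitz D.p_nonneg (C := |C| / D.weight r) hr.1 hr.2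
    (by positivity)
  -- The Lipschitz bound is applied with θ = 2 (a' - a) / ψ(0), so that θ/2 is the shift of the
  -- central value of w; η is the size for which θ e^(L r) ≤ 1.
  refine ⟨D.weight r * (2 / D.weight 0 * Real.exp (L * r)), D.weight 0 / (2 * Real.exp (L * r)),
    by positivity, by positivity, fun a a' ha haa' hη hlife hC => ?_⟩
  have hmem : r ∈ Ico 0 (D.life a) := ⟨hr.1, hlife⟩
  have h0 := D.w_ne_top hmem
  have h1 : D.w a r ≤ ENNReal.ofReal (|C| / D.weight r) := by
    refine (ENNReal.le_ofReal_iff_toReal_le h0 (by positivity)).2 ?_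
    rw [le_div_iff₀ hψ, mul_comm]
    exact hC.trans (le_abs_self C)
  have hd : 0 ≤ a' - a := by linarith
  have h2 := hLip _ (2 * (a' - a) / D.weight 0) h1 (by positivity) (by
    have : a' - a ≤ D.weight 0 / (2 * Real.exp (L * r)) := by linarith
    calc 2 * (a' - a) / D.weight 0 * Real.exp (L * r)
        ≤ 2 * (D.weight 0 / (2 * Real.exp (L * r))) / D.weight 0 * Real.exp (L * r) := by gcongr
      _ = 1 := by field_simp) r ⟨hr.1, le_rfl⟩
  rw [← ENNReal.ofReal_add (by positivity) (by positivity)] at h2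
  have e : a / D.weight 0 + 2 * (a' - a) / D.weight 0 / 2 = a' / D.weight 0 := by
    field_simp; ring
  rw [e] at h2
  have t : D.w a r + ENNReal.ofReal (2 * (a' - a) / D.weight 0 * Real.exp (L * r)) ≠ ⊤ :=
    add_ne_top.2 ⟨h0, ofReal_ne_top⟩
  refine ⟨(D.lt_life_iff hr).2 (ne_top_of_le_ne_top t h2), ?_⟩
  have h3 := ENNReal.toReal_mono t h2
  rw [ENNReal.toReal_add h0 ofReal_ne_top, ENNReal.toReal_ofReal (by positivity)] at h3
  calc D.U a' r ≤ D.weight r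
        * ((D.w a r).toReal + 2 * (a' - a) / D.weight 0 * Real.exp (L * r)) := by
        unfold U
        gcongr
        exact h3
    _ = _ := by unfold U; ring

end Params

end

/-! ### Profiles as classical solutions, and uniqueness of radial solutions. -/

section

namespace Params

variable (D : Params)

/-- The derivative of the radial profile. -/
def U' (a r : ℝ) : ℝ := D.weight' r * (D.w a r).toReal + D.weight r * (r *
  radialSlope D.N D.p D.p_nonneg D.weight D.pot (ENNReal.ofReal (a / D.weight 0)) r)

/-- The second derivative of the radial profile. -/
def U'' (a r : ℝ) : ℝ := D.U a r ^ D.p - D.μ / (D.R - r) ^ 2 * D.U a r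
  - (D.N - 1) / r * D.U' a r

theorem hasDerivAt_w {a r : ℝ} (hr : r ∈ Ioo 0 (D.life a)) :
    HasDerivAt (fun r => (D.w a r).toReal) (r *
      radialSlope D.N D.p D.p_nonneg D.weight D.pot (ENNReal.ofReal (a / D.weight 0)) r) r :=
  D.isWeight.hasDerivAt_realProfile D.p_nonneg (D.life_le a) (fun _ hr => D.w_ne_top hr) hr

theorem hasDerivAt_U {a r : ℝ} (hr : r ∈ Ioo 0 (D.life a)) :
    HasDerivAt (D.U a) (D.U' a r) r :=
  (D.hasDerivAt_weight (D.mem_of_life ⟨hr.1.le, hr.2⟩)).mul (D.hasDerivAt_w hr)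

theorem hasDerivAt_U' {a r : ℝ} (hr : r ∈ Ioo 0 (D.life a)) :
    HasDerivAt (D.U' a) (D.U'' a r) r := by
  have hrR := D.mem_of_life ⟨hr.1.le, hr.2⟩
  have hr0 := hr.1.ne'
  have hψ := D.weight_pos hrR
  have d1 := D.hasDerivAt_weight hrR
  have d2 := D.hasDerivAt_weight' hrR
  have d3 := D.hasDerivAt_w hr
  have d4 := D.isWeight.hasDerivAt_radialSlope D.p_nonneg (D.life_le a)
    (fun _ hr => D.w_ne_top hr) hr d1
  have d5 := (d2.mul d3).add (d1.mul ((hasDerivAt_id r).mul d4))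
  refine d5.congr_deriv ?_
  have heq := D.weight_equation ⟨hr.1, hrR.2⟩
  have hF : realNlin D.N D.p D.p_nonneg D.weight D.pot (ENNReal.ofReal (a / D.weight 0)) r
      = D.pot r * (D.w a r).toReal + D.weight r ^ (D.p - 1) * (D.w a r).toReal ^ D.p := rfl
  have hU : D.U a r ^ D.p
      = D.weight r * (D.weight r ^ (D.p - 1) * (D.w a r).toReal ^ D.p) := by
    unfold U
    rw [Real.mul_rpow hψ.le ENNReal.toReal_nonneg, Real.rpow_sub_one hψ.ne']
    field_simp
  rw [hF]
  simp only [Pi.mul_apply, id, U'', hU]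
  unfold U U'
  set S := radialSlope D.N D.p D.p_nonneg D.weight D.pot (ENNReal.ofReal (a / D.weight 0)) r
  set W := (D.w a r).toReal
  set X := D.weight r ^ (D.p - 1) * W ^ D.p
  have h2 : D.weight'' r = - (D.pot r * D.weight r) - (D.N - 1) / r * D.weight' r
      - D.μ / (D.R - r) ^ 2 * D.weight r := by linarith
  rw [h2]
  field_simp
  ring

theorem tendsto_nhdsGT_zero_of_continuousOn {f : ℝ → ℝ} {ρ : ℝ} (hρ : 0 < ρ)
    (hf : ContinuousOn f (Ico 0 ρ)) : Tendsto f (𝓝[>] 0) (𝓝 (f 0)) :=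
  (hf 0 ⟨le_rfl, hρ⟩).mono_left (nhdsWithin_le_of_mem
    (mem_of_superset (Ioo_mem_nhdsGT hρ) Ioo_subset_Ico_self))

theorem weight'_continuousOn : ContinuousOn D.weight' (Ico 0 D.R) := fun _ hr =>
  (D.hasDerivAt_weight' hr).continuousAt.continuousWithinAt

theorem tendsto_slope (a : ℝ) : Tendsto (radialSlope D.N D.p D.p_nonneg D.weight D.pot
    (ENNReal.ofReal (a / D.weight 0))) (𝓝[>] 0) (𝓝 (realNlin D.N D.p D.p_nonneg D.weight D.pot
    (ENNReal.ofReal (a / D.weight 0)) 0 / D.N)) :=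
  D.isWeight.tendsto_radialSlope D.p_nonneg (D.life_le a) (D.life_pos a)
    fun _ hr => D.w_ne_top hr

theorem tendsto_id_nhdsGT_zero : Tendsto (fun r : ℝ => r) (𝓝[>] 0) (𝓝 0) :=
  tendsto_id.mono_left nhdsWithin_le_nhds

theorem tendsto_U'_zero (a : ℝ) : Tendsto (D.U' a) (𝓝[>] 0) (𝓝 0) := by
  have h1 := tendsto_nhdsGT_zero_of_continuousOn D.radius_pos D.weight'_continuousOn
  have h2 := tendsto_nhdsGT_zero_of_continuousOn D.radius_pos D.isWeight.cont
  have h3 := tendsto_nhdsGT_zero_of_continuousOn (D.life_pos a)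
    (D.isWeight.realProfile_continuousOn (a := ENNReal.ofReal (a / D.weight 0)) D.p_nonneg
      (D.life_le a) fun _ hr => D.w_ne_top hr)
  have h4 := (h1.mul h3).add (h2.mul (tendsto_id_nhdsGT_zero.mul (D.tendsto_slope a)))
  have e : D.weight' 0 = 0 := by simp [weight']
  rw [e, zero_mul, zero_mul, mul_zero, add_zero] at h4
  exact h4

theorem contDiffOn_w (a : ℝ) : ContDiffOn ℝ 2
    (fun x : EuclideanSpace ℝ (Fin D.N) => (D.w a ‖x‖).toReal) (ball 0 (D.life a)) := by
  have hwc := D.isWeight.realProfile_continuousOn (a := ENNReal.ofReal (a / D.weight 0)) D.p_nonneg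
      (D.life_le a) fun _ hr => D.w_ne_top hr
  have hFc := D.isWeight.realNlin_continuousOn (a := ENNReal.ofReal (a / D.weight 0)) D.p_nonneg
      (D.life_le a) fun _ hr => D.w_ne_top hr
  have hmem : ∀ r ∈ Ioo 0 (D.life a), r ∈ Ico 0 D.R := fun r hr =>
    D.mem_of_life ⟨hr.1.le, hr.2⟩
  have hd : ∀ r ∈ Ioo 0 (D.life a), HasDerivAt (radialSlope D.N D.p D.p_nonneg D.weight D.pot
      (ENNReal.ofReal (a / D.weight 0))) _ r := fun r hr =>
    D.isWeight.hasDerivAt_radialSlope D.p_nonneg (D.life_le a)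
      (fun _ hr => D.w_ne_top hr) hr (D.hasDerivAt_weight (hmem r hr))
  set S := radialSlope D.N D.p D.p_nonneg D.weight D.pot (ENNReal.ofReal (a / D.weight 0)) with hS
  set F := realNlin D.N D.p D.p_nonneg D.weight D.pot (ENNReal.ofReal (a / D.weight 0)) with hF
  have hw0 : HasDerivWithinAt (fun r => (D.w a r).toReal) 0 (Ici 0) 0 := by
    have hmem0 : Ico 0 (D.life a) ∈ 𝓝[>] (0 : ℝ) :=
      mem_of_superset (Ioo_mem_nhdsGT (D.life_pos a)) Ioo_subset_Ico_self
    refine hasDerivWithinAt_Ici_of_tendsto_deriv (s := Ioo 0 (D.life a)) ?_ ?_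
      (Ioo_mem_nhdsGT (D.life_pos a)) ?_
    · exact fun r hr => (D.hasDerivAt_w hr).differentiableAt.differentiableWithinAt
    · exact (hwc 0 ⟨le_rfl, D.life_pos a⟩).mono Ioo_subset_Ico_self
    · have := tendsto_id_nhdsGT_zero.mul (D.tendsto_slope a)
      rw [zero_mul] at this
      refine this.congr' ?_
      filter_upwards [Ioo_mem_nhdsGT (D.life_pos a)] with r hr
      exact (D.hasDerivAt_w hr).deriv.symm
  refine contDiffOn_comp_norm (W := fun r => (D.w a r).toReal) (H := S)
    (fun r hr => D.hasDerivAt_w hr) hw0 hd ?_ (D.tendsto_slope a) ?_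
  · have hSc : ContinuousOn S (Ioo 0 (D.life a)) := fun r hr =>
      (hd r hr).continuousAt.continuousWithinAt
    refine ContinuousOn.div ((hFc.mono Ioo_subset_Ico_self).sub (ContinuousOn.mul
      (continuousOn_const.add (ContinuousOn.div (ContinuousOn.mul (by fun_prop) ?_) ?_ ?_)) hSc))
      continuousOn_id fun r hr => hr.1.ne'
    · exact D.weight'_continuousOn.mono hmem
    · exact D.isWeight.cont.mono hmem
    · exact fun r hr => (D.weight_pos (hmem r hr)).ne'
  · have h1 := tendsto_nhdsGT_zero_of_continuousOn D.radius_pos D.weight'_continuousOn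
    have h2 := tendsto_nhdsGT_zero_of_continuousOn D.radius_pos D.isWeight.cont
    have h3 := tendsto_nhdsGT_zero_of_continuousOn (D.life_pos a) hFc
    have h4 := h3.sub ((((tendsto_id_nhdsGT_zero.const_mul 2).mul h1).div h2
      (D.weight_pos D.zero_mem_Ico).ne').const_add (D.N : ℝ) |>.mul (D.tendsto_slope a))
    have hN : (D.N : ℝ) ≠ 0 := by have := D.one_le_dim; positivity
    -- The limit of r H'(r) vanishes exactly because the slope tends to F(0)/N.
    have e : F 0 - (D.N + 2 * 0 * D.weight' 0 / D.weight 0) * (F 0 / D.N) = 0 := by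
      simp; field_simp; simp
    rw [← hF, e] at h4
    refine h4.congr' ?_
    filter_upwards [self_mem_nhdsWithin] with r hr
    have : r ≠ 0 := (mem_Ioi.1 hr).ne'
    field_simp
    rfl

/-- The radial solution with central value `a`. -/
def u (a : ℝ) (x : EuclideanSpace ℝ (Fin D.N)) : ℝ := D.U a ‖x‖

theorem norm_mem {ρ : ℝ} {x : EuclideanSpace ℝ (Fin D.N)}
    (hx : x ∈ ball (0 : EuclideanSpace ℝ (Fin D.N)) ρ) : ‖x‖ ∈ Ico 0 ρ :=
  ⟨norm_nonneg x, by simpa using hx⟩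

theorem contDiffOn_u (a : ℝ) : ContDiffOn ℝ 2 (D.u a) (ball 0 (D.life a)) := by
  refine ContDiffOn.mul ?_ (D.contDiffOn_w a)
  refine ContDiffOn.rpow_const_of_ne ?_ fun x hx => (D.sq_sub_pos (D.mem_of_life (D.norm_mem hx))).ne'
  exact contDiffOn_const.sub (contDiff_norm_sq ℝ).contDiffOn

theorem laplacian_u {a : ℝ} {x : EuclideanSpace ℝ (Fin D.N)}
    (hx : x ∈ ball (0 : EuclideanSpace ℝ (Fin D.N)) (D.life a)) (h0 : x ≠ 0) :
    Laplacian.laplacian (D.u a) x = D.U a ‖x‖ ^ D.p - D.μ / (D.R - ‖x‖) ^ 2 * D.U a ‖x‖ := by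
  have hr : ‖x‖ ∈ Ioo 0 (D.life a) := ⟨norm_pos_iff.2 h0, (D.norm_mem hx).2⟩
  have := laplacian_comp_norm (U := D.U a) (U' := D.U' a) h0 (by
    filter_upwards [Ioo_mem_nhds hr.1 hr.2] with s hs using D.hasDerivAt_U hs)
    (D.hasDerivAt_U' hr)
  unfold u
  rw [this]
  unfold U''
  ring

theorem isRadialSolution_u {a : ℝ} (ha : 0 < a) :
    IsRadialSolution D.R D.μ D.p (D.life a) (D.u a) := by
  refine ⟨⟨D.contDiffOn_u a, fun x hx => D.U_pos ha (D.norm_mem hx), fun x hx => ?_⟩,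
    fun x _ y _ hxy => by unfold u; rw [hxy]⟩
  have hdist : ∀ y ∈ ball (0 : EuclideanSpace ℝ (Fin D.N)) (D.life a),
      boundaryDist (ball 0 D.R) y = D.R - ‖y‖ := fun y hy =>
    boundaryDist_ball D.one_le_dim D.radius_pos (ball_subset_ball (D.life_le a) hy)
  by_cases h0 : x = 0
  -- The radial formula is not available at the origin. There both sides are continuous and agree on
  -- a punctured neighborhood, which is nontrivial since N ≥ 1.
  · have : Nonempty (Fin D.N) := ⟨⟨0, D.one_le_dim⟩⟩
    have hxU : x ∈ ball (0 : EuclideanSpace ℝ (Fin D.N)) (D.life a) := hx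
    set G : EuclideanSpace ℝ (Fin D.N) → ℝ := fun y =>
      D.u a y ^ D.p - D.μ / (D.R - ‖y‖) ^ 2 * D.u a y with hG
    have cu : ContinuousAt (D.u a) x :=
      (D.contDiffOn_u a).continuousOn.continuousAt (isOpen_ball.mem_nhds hx)
    have cd : D.R - ‖x‖ ≠ 0 :=
      (sub_pos.2 ((D.norm_mem hx).2.trans_le (D.life_le a))).ne'
    have cG : ContinuousAt G x := by
      refine (cu.rpow_const (Or.inr D.p_nonneg)).sub (ContinuousAt.mul ?_ cu)
      exact continuousAt_const.div (by fun_prop) (pow_ne_zero 2 cd)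
    have cL : ContinuousAt (Laplacian.laplacian (D.u a)) x := by
      have hc := (D.contDiffOn_u a).contDiffAt (isOpen_ball.mem_nhds hx)
      rw [InnerProductSpace.laplacian_eq_iteratedFDeriv_stdOrthonormalBasis]
      have h2 : ContinuousAt (iteratedFDeriv ℝ 2 (D.u a)) x :=
        (hc.iteratedFDeriv_right (m := 0) (i := 2) (by norm_num)).continuousAt
      exact tendsto_finsetSum _ fun i _ =>
        ((continuous_eval_const _).continuousAt.comp h2 :)
    have hev : ∀ᶠ y in 𝓝[≠] x, Laplacian.laplacian (D.u a) y = G y := by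
      filter_upwards [self_mem_nhdsWithin, mem_nhdsWithin_of_mem_nhds (isOpen_ball.mem_nhds hx)]
        with y hy hyb
      exact D.laplacian_u hyb (by simpa [h0] using hy)
    have heq : Laplacian.laplacian (D.u a) x = G x :=
      tendsto_nhds_unique_of_eventuallyEq (cL.mono_left nhdsWithin_le_nhds)
        (cG.mono_left nhdsWithin_le_nhds) hev
    unfold hardyOp
    rw [hdist x hx, heq]
    simp only [hG]
    ring
  · unfold hardyOp
    rw [hdist x hx, D.laplacian_u hx h0]
    unfold u
    ring

theorem u_zero {a : ℝ} (ha : 0 ≤ a) : D.u a 0 = a := by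
  unfold u; rw [norm_zero, D.U_zero ha]

theorem tendsto_comp_norm {f : ℝ → ℝ} {ρ : ℝ} {l : Filter ℝ} (h : Tendsto f (𝓝[<] ρ) l) :
    Tendsto (fun x : EuclideanSpace ℝ (Fin D.N) => f ‖x‖) (toSphere D.N ρ) l :=
  h.comp tendsto_comap

theorem exists_norm_eq_radius {r : ℝ} (hr : 0 ≤ r) :
    ∃ x : EuclideanSpace ℝ (Fin D.N), ‖x‖ = r := by
  have : Nonempty (Fin D.N) := ⟨⟨0, D.one_le_dim⟩⟩
  exact exists_norm_eq _ hr

/-- The norm takes every nonnegative value because N ≥ 1, so nothing is lost in passing to the ball.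
-/
theorem tendsto_of_tendsto_comp_norm {f : ℝ → ℝ} {ρ : ℝ} {l : Filter ℝ} (hρ : 0 < ρ)
    (h : Tendsto (fun x : EuclideanSpace ℝ (Fin D.N) => f ‖x‖) (toSphere D.N ρ) l) :
    Tendsto f (𝓝[<] ρ) l := by
  have hm : map (fun x : EuclideanSpace ℝ (Fin D.N) => ‖x‖) (toSphere D.N ρ) = 𝓝[<] ρ := by
    refine map_comap_of_mem (mem_of_superset (Ioo_mem_nhdsLT hρ) fun r hr => ?_)
    exact D.exists_norm_eq_radius hr.1.le
  rw [← hm, tendsto_map'_iff]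
  exact h

/-- A radial solution agrees with the constructed one with the same central value. -/
theorem radial_unique {a σ : ℝ} (hσ0 : 0 < σ) (hσ : σ ≤ D.R)
    {v : EuclideanSpace ℝ (Fin D.N) → ℝ} (hv : IsRadialSolution D.R D.μ D.p σ v) (hva : v 0 = a) :
    σ ≤ D.life a ∧ EqOn v (D.u a) (ball 0 σ) := by
  have ha : 0 < a := hva ▸ hv.1.pos 0 (mem_ball_self hσ0)
  -- The maximum principle needs strictly ordered central values, so v is compared with the profile
  -- of central value a + d; the Lipschitz bound then lets d tend to 0. The lower bound uses a - d.
  have hup : ∀ x ∈ ball (0 : EuclideanSpace ℝ (Fin D.N)) σ, ‖x‖ < D.life a → v x ≤ D.u a x := by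
    intro x hx hxa
    have hxI : ‖x‖ ∈ Ico 0 (D.life a) := ⟨norm_nonneg x, hxa⟩
    obtain ⟨K, η, hK, hη, hL⟩ := D.U_lipschitz (C := D.U a ‖x‖) (D.mem_of_life hxI)
    refine le_of_forall_pos_lt_add fun ε hε => ?_
    set d := min η (ε / (2 * K)) with hd
    have hd0 : 0 < d := lt_min hη (by positivity)
    obtain ⟨h1, h2⟩ := hL a (a + d) ha (by linarith) (by linarith [min_le_left η (ε / (2 * K))])
      hxa le_rfl
    have hd2 : K * d ≤ ε / 2 := by
      calc K * d ≤ K * (ε / (2 * K)) := by gcongr; exact min_le_right _ _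
        _ = ε / 2 := by field_simp
    have hs : x ∈ ball (0 : EuclideanSpace ℝ (Fin D.N)) (min σ (D.life (a + d))) :=
      mem_ball_zero_iff.2 (lt_min (mem_ball_zero_iff.1 hx) h1)
    have := (hv.mono (min_le_left σ (D.life (a + d)))).le_of_center_lt D.one_lt
      ((D.isRadialSolution_u (by linarith : 0 < a + d)).mono (min_le_right _ _))
      (by rw [hva, D.u_zero (by linarith)]; linarith) x hs
    unfold u at this ⊢
    have e : a + d - a = d := by ring
    rw [e] at h2
    linarith
  have hlow : ∀ x ∈ ball (0 : EuclideanSpace ℝ (Fin D.N)) σ, ‖x‖ < D.life a → D.u a x ≤ v x := by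
    intro x hx hxa
    have hxI : ‖x‖ ∈ Ico 0 (D.life a) := ⟨norm_nonneg x, hxa⟩
    obtain ⟨K, η, hK, hη, hL⟩ := D.U_lipschitz (C := D.U a ‖x‖) (D.mem_of_life hxI)
    refine le_of_forall_pos_lt_add fun ε hε => ?_
    set d := min (a / 2) (min η (ε / (2 * K))) with hd
    have hd0 : 0 < d := lt_min (by linarith) (lt_min hη (by positivity))
    have hda : d ≤ a / 2 := min_le_left _ _
    have hdη : d ≤ η := (min_le_right _ _).trans (min_le_left _ _)
    have hdε : d ≤ ε / (2 * K) := (min_le_right _ _).trans (min_le_right _ _)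
    have hlife : ‖x‖ < D.life (a - d) := hxa.trans_le (D.life_anti (by linarith))
    obtain ⟨h1, h2⟩ := hL (a - d) a (by linarith) (by linarith) (by linarith) hlife
      (D.U_mono (by linarith) (by linarith) hxI)
    have hd2 : K * d ≤ ε / 2 := by
      calc K * d ≤ K * (ε / (2 * K)) := by gcongr
        _ = ε / 2 := by field_simp
    have hs : x ∈ ball (0 : EuclideanSpace ℝ (Fin D.N)) (min σ (D.life (a - d))) :=
      mem_ball_zero_iff.2 (lt_min (mem_ball_zero_iff.1 hx) hlife)
    have := ((D.isRadialSolution_u (by linarith : 0 < a - d)).mono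
      (min_le_right σ _)).le_of_center_lt D.one_lt (hv.mono (min_le_left σ _))
      (by rw [hva, D.u_zero (by linarith)]; linarith) x hs
    unfold u at this ⊢
    have e : a - (a - d) = d := by ring
    rw [e] at h2
    linarith
  -- If the profile blew up before σ, the lower bound would make v unbounded on a compact ball
  -- inside its domain.
  have hle : σ ≤ D.life a := by
    by_contra! hlt
    have htop := D.tendsto_comp_norm (D.tendsto_U_atTop (hlt.trans_le hσ))
    have hl := D.life_pos a
    obtain ⟨C, hC⟩ := (isCompact_closedBall (0 : EuclideanSpace ℝ (Fin D.N)) (D.life a)).bddAbove_image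
      (hv.1.contDiffOn.continuousOn.mono (closedBall_subset_ball hlt))
    obtain ⟨r, hr0, hr, hbig⟩ := eventually_toSphere hl (htop.eventually_gt_atTop C)
    obtain ⟨s, hs1, hs2⟩ := exists_between hr
    obtain ⟨x, hx⟩ := D.exists_norm_eq_radius (hr0.le.trans hs1.le)
    have h1 := hbig x (by rw [hx]; exact hs1) (by rw [hx]; exact hs2)
    have h2 := hlow x (mem_ball_zero_iff.2 (by rw [hx]; linarith)) (by rw [hx]; exact hs2)
    have h3 : v x ≤ C := hC ⟨x, by simpa [hx] using hs2.le, rfl⟩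
    unfold u at h2
    linarith
  refine ⟨hle, fun x hx => ?_⟩
  have hxa : ‖x‖ < D.life a := (mem_ball_zero_iff.1 hx).trans_le hle
  exact le_antisymm (hup x hx hxa) (hlow x hx hxa)

end Params

end

/-! ### Logarithmic variables and the Keller–Osserman barrier. -/

section

/-- Comparison of a subsolution and a supersolution of `y'' + b y' + g y = y ^ p`. -/
theorem le_of_sub_super {p c d : ℝ} (hp : 1 < p) {b g y₁ y₁' y₁'' y₂ y₂' y₂'' : ℝ → ℝ}
    (c₁ : ContinuousOn y₁ (Icc c d)) (c₂ : ContinuousOn y₂ (Icc c d))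
    (pos : ∀ t ∈ Icc c d, 0 < y₂ t) (hc : y₁ c ≤ y₂ c) (hd : y₁ d ≤ y₂ d)
    (d₁ : ∀ t ∈ Ioo c d, HasDerivAt y₁ (y₁' t) t)
    (d₁' : ∀ t ∈ Ioo c d, HasDerivAt y₁' (y₁'' t) t)
    (d₂ : ∀ t ∈ Ioo c d, HasDerivAt y₂ (y₂' t) t)
    (d₂' : ∀ t ∈ Ioo c d, HasDerivAt y₂' (y₂'' t) t)
    (sub : ∀ t ∈ Ioo c d, 0 < y₁ t → y₁ t ^ p ≤ y₁'' t + b t * y₁' t + g t * y₁ t)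
    (sup : ∀ t ∈ Ioo c d, y₂'' t + b t * y₂' t + g t * y₂ t ≤ y₂ t ^ p) :
    ∀ t ∈ Icc c d, y₁ t ≤ y₂ t := by
  intro t₁ ht₁
  by_contra! hlt
  obtain ⟨t₀, ht₀, hmax⟩ := isCompact_Icc.exists_isMaxOn ⟨t₁, ht₁⟩
    (c₁.div c₂ fun t ht => (pos t ht).ne')
  have hq : 1 < y₁ t₀ / y₂ t₀ := ((one_lt_div (pos t₁ ht₁)).2 hlt).trans_le (hmax ht₁)
  have hp2 := pos t₀ ht₀
  have hgt : y₂ t₀ < y₁ t₀ := (one_lt_div hp2).1 hq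
  have ht : t₀ ∈ Ioo c d := by
    refine ⟨lt_of_le_of_ne ht₀.1 ?_, lt_of_le_of_ne ht₀.2 ?_⟩
    · rintro rfl; linarith
    · rintro rfl; linarith
  set q := y₁ t₀ / y₂ t₀ with hqdef
  have hy : y₁ t₀ = q * y₂ t₀ := by rw [hqdef]; field_simp
  -- At the maximum q > 1 of y₁ / y₂ the difference y₁ - q y₂ vanishes to first order, so the
  -- first-order and linear terms drop out whatever b and g are, and y₁^p > q y₂^p contradicts its
  -- concavity.
  have hloc : IsLocalMax (fun t => y₁ t - q * y₂ t) t₀ := by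
    filter_upwards [Ioo_mem_nhds ht.1 ht.2] with t hts
    have h1 : y₁ t / y₂ t ≤ q := hmax (Ioo_subset_Icc_self hts)
    rw [div_le_iff₀ (pos t (Ioo_subset_Icc_self hts))] at h1
    linarith
  have hev : ∀ᶠ t in 𝓝 t₀, HasDerivAt (fun t => y₁ t - q * y₂ t) (y₁' t - q * y₂' t) t := by
    filter_upwards [Ioo_mem_nhds ht.1 ht.2] with t hts
    exact (d₁ t hts).sub ((d₂ t hts).const_mul q)
  have h1 := hloc.hasDerivAt_eq_zero hev.self_of_nhds
  have h2 := IsLocalMax.second_deriv_nonpos hloc hev ((d₁' t₀ ht).sub ((d₂' t₀ ht).const_mul q))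
  have h3 := sub t₀ ht (hp2.trans hgt)
  have h4 := sup t₀ ht
  have h5 : y₁' t₀ = q * y₂' t₀ := by linarith
  have h6 : q * y₂ t₀ ^ p < y₁ t₀ ^ p := by
    rw [hy, Real.mul_rpow (by linarith) hp2.le]
    have : 0 < y₂ t₀ ^ p := Real.rpow_pos_of_pos hp2 p
    have : q < q ^ p := by simpa using Real.rpow_lt_rpow_of_exponent_lt hq hp
    gcongr
  have h7 := mul_le_mul_of_nonneg_left h4 (by linarith : (0 : ℝ) ≤ q)
  rw [h5, hy] at h3
  rw [hy] at h6
  nlinarith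

namespace Params

variable (D : Params)

/-- The blow-up exponent `2 / (p - 1)`. -/
def α : ℝ := 2 / (D.p - 1)

/-- The constant `μ + μ*`. -/
def G : ℝ := D.μ + muStar D.p

/-- The constant `(μ + μ*) ^ (1 / (p - 1))`. -/
def A : ℝ := D.G ^ (1 / (D.p - 1))

/-- The gap `α + β₋` between the singular and the linear exponent. -/
def gap : ℝ := D.α + D.β

/-- The contribution of the first-order term of the Laplacian in the variable
`t = - log (R - r)`. -/
def drift (t : ℝ) : ℝ := (D.N - 1) * Real.exp (-t) / (D.R - Real.exp (-t))

theorem α_pos : 0 < D.α := div_pos two_pos (sub_pos.2 D.one_lt)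

theorem α_mul : D.α * (D.p - 1) = 2 := div_mul_cancel₀ _ (sub_pos.2 D.one_lt).ne'

theorem α_mul_p : D.α * D.p = D.α + 2 := by linarith [D.α_mul]

theorem muStar_eq : muStar D.p = D.α * (D.α + 1) := by
  have : D.p - 1 ≠ 0 := (sub_pos.2 D.one_lt).ne'
  unfold muStar α
  field_simp
  ring

theorem G_eq : D.G = D.μ + D.α * (D.α + 1) := by rw [G, muStar_eq]

theorem G_pos : 0 < D.G := by have := D.lower; unfold G; linarith

theorem A_pos : 0 < D.A := Real.rpow_pos_of_pos D.G_pos _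

theorem A_rpow : D.A ^ (D.p - 1) = D.G := by
  have : D.p - 1 ≠ 0 := (sub_pos.2 D.one_lt).ne'
  rw [A, ← Real.rpow_mul D.G_pos.le]
  field_simp
  simp

theorem G_eq_gap : D.G = D.gap * (D.α + 1 - D.β) := by
  rw [G_eq, ← D.β_mul, gap]; ring

/-- This is the form in which μ > -μ* is used: G factors as (α + β₋)(α + 1 - β₋) with positive
second factor. So (R - r)^β₋ is of smaller order than the singular rate. -/
theorem gap_pos : 0 < D.gap := by
  have h1 := D.G_pos
  rw [G_eq_gap] at h1
  have h2 : 0 < D.α + 1 - D.β := by linarith [D.α_pos, D.β_lt_half]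
  exact (pos_iff_pos_of_mul_pos h1).2 h2

theorem drift_nonneg {t : ℝ} (ht : 0 < D.R - Real.exp (-t)) : 0 ≤ D.drift t := by
  have : (1 : ℝ) ≤ D.N := by exact_mod_cast D.one_le_dim
  exact div_nonneg (mul_nonneg (by linarith) (Real.exp_pos _).le) ht.le

theorem drift_anti {s t : ℝ} (hs : 0 < D.R - Real.exp (-s)) (hst : s ≤ t) :
    D.drift t ≤ D.drift s := by
  have : (1 : ℝ) ≤ D.N := by exact_mod_cast D.one_le_dim
  have h0 : (0 : ℝ) ≤ D.N - 1 := by linarith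
  have h1 : Real.exp (-t) ≤ Real.exp (-s) := Real.exp_le_exp.2 (by linarith)
  unfold drift
  gcongr

theorem tendsto_exp_neg : Tendsto (fun t : ℝ => Real.exp (-t)) atTop (𝓝 0) :=
  Real.tendsto_exp_neg_atTop_nhds_zero

theorem tendsto_drift : Tendsto D.drift atTop (𝓝 0) := by
  have h := (tendsto_exp_neg.const_mul ((D.N : ℝ) - 1)).div (tendsto_exp_neg.const_sub D.R)
    (by simpa using D.radius_pos.ne')
  rw [mul_zero, zero_div] at h
  exact h

/-- The rescaled radial profile `U(r) (R - r) ^ α` in the variable `t = - log (R - r)`. -/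
def Y (a t : ℝ) : ℝ := D.U a (D.R - Real.exp (-t)) * Real.exp (-(D.α * t))

/-- The first derivative of the rescaled profile. -/
def Y' (a t : ℝ) : ℝ :=
  D.U' a (D.R - Real.exp (-t)) * Real.exp (-t) * Real.exp (-(D.α * t)) - D.α * D.Y a t

/-- The second derivative of the rescaled profile. -/
def Y'' (a t : ℝ) : ℝ := D.Y a t ^ D.p - (2 * D.α + 1 + D.drift t) * D.Y' a t
  - (D.G + D.α * D.drift t) * D.Y a t

theorem hasDerivAt_radius (t : ℝ) :
    HasDerivAt (fun t => D.R - Real.exp (-t)) (Real.exp (-t)) t := by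
  have := ((hasDerivAt_id t).neg.exp).const_sub D.R
  simpa using this

theorem hasDerivAt_exp_neg_mul (c t : ℝ) :
    HasDerivAt (fun t => Real.exp (-(c * t))) (-c * Real.exp (-(c * t))) t := by
  have := (((hasDerivAt_id t).const_mul c).neg).exp
  refine this.congr_deriv ?_
  simp; ring

theorem hasDerivAt_Y {a t : ℝ} (ht : D.R - Real.exp (-t) ∈ Ioo 0 (D.life a)) :
    HasDerivAt (D.Y a) (D.Y' a t) t := by
  have h1 := (D.hasDerivAt_U ht).comp t (D.hasDerivAt_radius t)
  refine (h1.mul (hasDerivAt_exp_neg_mul D.α t)).congr_deriv ?_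
  unfold Y' Y
  simp only [Function.comp]
  ring

/-- The relation α p = α + 2 is what removes every power of R - r from the nonlinear term. -/
theorem hasDerivAt_Y' {a t : ℝ} (ha : 0 < a) (ht : D.R - Real.exp (-t) ∈ Ioo 0 (D.life a)) :
    HasDerivAt (D.Y' a) (D.Y'' a t) t := by
  have h1 := (D.hasDerivAt_U' ht).comp t (D.hasDerivAt_radius t)
  have h2 : HasDerivAt (fun t => Real.exp (-t)) (-Real.exp (-t)) t := by
    simpa using hasDerivAt_exp_neg_mul 1 t
  have h3 := ((h1.mul h2).mul (hasDerivAt_exp_neg_mul D.α t)).sub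
    ((D.hasDerivAt_Y ht).const_mul D.α)
  refine h3.congr_deriv ?_
  have hU := (D.U_pos ha ⟨ht.1.le, ht.2⟩).le
  have e1 : D.Y a t ^ D.p = D.U a (D.R - Real.exp (-t)) ^ D.p * (Real.exp (-t) * Real.exp (-t)
      * Real.exp (-(D.α * t))) := by
    unfold Y
    rw [Real.mul_rpow hU (Real.exp_pos _).le, ← Real.exp_mul, ← Real.exp_add, ← Real.exp_add]
    congr 2
    have := D.α_mul_p
    linear_combination (-t) * this
  unfold Y''
  rw [e1]
  unfold Y' Y U'' drift
  simp only [Function.comp, Pi.mul_apply]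
  rw [G_eq, show D.R - (D.R - Real.exp (-t)) = Real.exp (-t) by ring]
  have n1 : Real.exp (-t) ≠ 0 := (Real.exp_pos _).ne'
  have n2 : D.R - Real.exp (-t) ≠ 0 := ht.1.ne'
  set E := Real.exp (-t)
  set F := Real.exp (-(D.α * t))
  set X := D.U a (D.R - E) ^ D.p
  field_simp
  ring

theorem Y_pos {a t : ℝ} (ha : 0 < a) (ht : D.R - Real.exp (-t) ∈ Ioo 0 (D.life a)) :
    0 < D.Y a t := mul_pos (D.U_pos ha ⟨ht.1.le, ht.2⟩) (Real.exp_pos _)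

theorem Y_equation (a t : ℝ) : D.Y'' a t + (2 * D.α + 1 + D.drift t) * D.Y' a t
    + (D.G + D.α * D.drift t) * D.Y a t = D.Y a t ^ D.p := by
  unfold Y''; ring

theorem Y_continuousOn {a c d : ℝ}
    (h : ∀ t ∈ Icc c d, D.R - Real.exp (-t) ∈ Ioo 0 (D.life a)) :
    ContinuousOn (D.Y a) (Icc c d) := fun t ht =>
  (D.hasDerivAt_Y (h t ht)).continuousAt.continuousWithinAt

/-- The Keller–Osserman bound: a solution lies below a large solution of a window. -/
theorem Y_le_of_window {a T l M ē : ℝ} (ha : 0 < a) (hl : 0 < l) (hM : 0 < M)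
    (hw : ∀ t ∈ Icc (T - l) (T + l), D.R - Real.exp (-t) ∈ Ioo 0 (D.life a))
    (he : ∀ t ∈ Icc (T - l) (T + l), D.drift t ≤ ē)
    (hb : 4 * D.α * (D.α + 1) / l ^ 2 + 2 * D.α / l ^ 2 + 2 * D.α * (2 * D.α + 1 + ē) / l
      + (D.G + D.α * ē) ≤ M ^ (D.p - 1)) : D.Y a T ≤ M := by
  have hα := D.α_pos
  have hTmem : T ∈ Icc (T - l) (T + l) := ⟨by linarith, by linarith⟩
  obtain ⟨C, hC⟩ := isCompact_Icc.bddAbove_image (D.Y_continuousOn hw)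
  have hCb : ∀ t ∈ Icc (T - l) (T + l), D.Y a t ≤ C := fun t ht => hC ⟨t, ht, rfl⟩
  -- The barrier M s^(-α) is infinite at the ends of the window, so it is cut off where s = κ, with
  -- κ so small that it already exceeds the maximum C of Y. The point s = κ is at distance l' from
  -- T.
  obtain ⟨κ, hκ0, hκ1, hκC⟩ : ∃ κ : ℝ, 0 < κ ∧ κ < 1 ∧ C ≤ M * κ ^ (-D.α) := by
    have h1 : Tendsto (fun κ : ℝ => M * κ ^ (-D.α)) (𝓝[>] 0) atTop :=
      (tendsto_rpow_neg_nhdsGT_zero (by linarith)).const_mul_atTop hM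
    obtain ⟨κ, h2, h3⟩ := ((h1.eventually_ge_atTop C).and (Ioo_mem_nhdsGT one_pos)).exists
    exact ⟨κ, h3.1, h3.2, h2⟩
  set l' := l * √(1 - κ) with hl'
  have hsq : √(1 - κ) ^ 2 = 1 - κ := Real.sq_sqrt (by linarith)
  have hsq1 : √(1 - κ) < 1 := by
    rw [Real.sqrt_lt' one_pos]; linarith
  have hsq0 : 0 < √(1 - κ) := Real.sqrt_pos.2 (by linarith)
  have hl'0 : 0 < l' := mul_pos hl hsq0
  have hl'l : l' < l := by nlinarith
  set s : ℝ → ℝ := fun t => 1 - ((t - T) / l) ^ 2 with hs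
  set s' : ℝ → ℝ := fun t => -(2 * (t - T) / l ^ 2) with hs'
  have hsub : Icc (T - l') (T + l') ⊆ Icc (T - l) (T + l) :=
    Icc_subset_Icc (by linarith) (by linarith)
  have hsabs : ∀ t ∈ Icc (T - l') (T + l'), κ ≤ s t ∧ s t ≤ 1 := fun t ht => by
    have h1 : (t - T) ^ 2 ≤ l' ^ 2 := sq_le_sq' (by linarith [ht.1]) (by linarith [ht.2])
    have h2 : ((t - T) / l) ^ 2 ≤ 1 - κ := by
      rw [div_pow, div_le_iff₀ (by positivity)]
      calc (t - T) ^ 2 ≤ l' ^ 2 := h1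
        _ = _ := by rw [hl', mul_pow, hsq]; ring
    exact ⟨by simp only [hs]; linarith, by simp only [hs]; linarith [sq_nonneg ((t - T) / l)]⟩
  have hspos : ∀ t ∈ Icc (T - l') (T + l'), 0 < s t := fun t ht =>
    hκ0.trans_le (hsabs t ht).1
  have ds : ∀ t, HasDerivAt s (s' t) t := fun t => by
    have := ((((hasDerivAt_id t).sub_const T).div_const l).pow 2).const_sub 1
    refine this.congr_deriv ?_
    simp only [hs', id]
    norm_num
    field_simp
  have ds' : ∀ t, HasDerivAt s' (-(2 / l ^ 2)) t := fun t => by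
    have := ((((hasDerivAt_id t).sub_const T).const_mul 2).div_const (l ^ 2)).neg
    refine this.congr_deriv ?_
    simp
  have hend : ∀ t, (t - T) ^ 2 = l' ^ 2 → s t = κ := fun t ht => by
    simp only [hs]
    rw [div_pow, ht, hl', mul_pow, hsq]
    field_simp
    ring
  have hp0 := sub_pos.2 D.one_lt
  have res := le_of_sub_super (p := D.p) (c := T - l') (d := T + l') D.one_lt
    (b := fun t => 2 * D.α + 1 + D.drift t) (g := fun t => D.G + D.α * D.drift t)
    (y₁ := D.Y a) (y₁' := D.Y' a) (y₁'' := D.Y'' a)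
    (y₂ := fun t => M * s t ^ (-D.α)) (y₂' := fun t => M * (s' t * -D.α * s t ^ (-D.α - 1)))
    (y₂'' := fun t => M * ((-(2 / l ^ 2) * -D.α) * s t ^ (-D.α - 1)
      + s' t * -D.α * (s' t * (-D.α - 1) * s t ^ (-D.α - 1 - 1))))
    ((D.Y_continuousOn hw).mono hsub) ?_ ?_ ?_ ?_
    (fun t ht => D.hasDerivAt_Y (hw t (hsub (Ioo_subset_Icc_self ht))))
    (fun t ht => D.hasDerivAt_Y' ha (hw t (hsub (Ioo_subset_Icc_self ht)))) ?_ ?_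
    (fun t ht _ => (D.Y_equation a t).ge) ?_ T ⟨by linarith, by linarith⟩
  · simpa [hs] using res
  · exact continuousOn_const.mul (ContinuousOn.rpow_const
      (fun t _ => (ds t).continuousAt.continuousWithinAt) fun t ht => Or.inl (hspos t ht).ne')
  · exact fun t ht => mul_pos hM (Real.rpow_pos_of_pos (hspos t ht) _)
  · rw [hend _ (by ring)]
    exact (hCb _ (hsub ⟨le_rfl, by linarith⟩)).trans hκC
  · rw [hend _ (by ring)]
    exact (hCb _ (hsub ⟨by linarith, le_rfl⟩)).trans hκC
  · intro t ht
    exact ((ds t).rpow_const (Or.inl (hspos t (Ioo_subset_Icc_self ht)).ne')).const_mul M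
  · intro t ht
    exact (((ds' t).mul_const (-D.α)).mul
      ((ds t).rpow_const (Or.inl (hspos t (Ioo_subset_Icc_self ht)).ne'))).const_mul M
  · intro t ht
    have htI := Ioo_subset_Icc_self ht
    have hsp := hspos t htI
    have hs1 := (hsabs t htI).2
    have hdr := he t (hsub htI)
    have hdr0 := D.drift_nonneg (hw t (hsub htI)).1
    have hs'b : |s' t| ≤ 2 / l := by
      have h1 : |t - T| ≤ l := abs_le.2 ⟨by linarith [ht.1], by linarith [ht.2]⟩
      simp only [hs']
      rw [abs_neg, abs_div, abs_mul, abs_of_pos two_pos, abs_of_pos (by positivity : 0 < l ^ 2),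
        div_le_div_iff₀ (by positivity) hl]
      nlinarith
    have hs'2 : s' t ^ 2 ≤ 4 / l ^ 2 := by
      calc s' t ^ 2 = |s' t| ^ 2 := (sq_abs _).symm
        _ ≤ (2 / l) ^ 2 := by gcongr
        _ = 4 / l ^ 2 := by ring
    have e1 : s t ^ (-D.α - 1) = s t ^ (-D.α - 1 - 1) * s t := by
      rw [← Real.rpow_add_one hsp.ne']; ring_nf
    have e2 : s t ^ (-D.α) = s t ^ (-D.α - 1 - 1) * s t * s t := by
      rw [← Real.rpow_add_one hsp.ne', ← Real.rpow_add_one hsp.ne']; ring_nf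
    have e3 : (M * s t ^ (-D.α)) ^ D.p = M * M ^ (D.p - 1) * s t ^ (-D.α - 1 - 1) := by
      rw [Real.mul_rpow hM.le (by positivity), ← Real.rpow_mul hsp.le, Real.rpow_sub_one hM.ne']
      have : -D.α * D.p = -D.α - 1 - 1 := by linarith [D.α_mul_p]
      rw [this]; field_simp
    rw [e3, e1, e2]
    set X := s t ^ (-D.α - 1 - 1) with hX
    have hXp : 0 < X := Real.rpow_pos_of_pos hsp _
    -- The supersolution inequality divided by M s^(-α-2), where α p = α + 2 leaves only M^(p-1) on
    -- the right.
    have key : D.α * (D.α + 1) * s' t ^ 2 + 2 * D.α / l ^ 2 * s t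
        - D.α * (2 * D.α + 1 + D.drift t) * s t * s' t
        + (D.G + D.α * D.drift t) * (s t * s t) ≤ M ^ (D.p - 1) := by
      refine le_trans ?_ hb
      have k1 : D.α * (D.α + 1) * s' t ^ 2 ≤ 4 * D.α * (D.α + 1) / l ^ 2 := by
        calc _ ≤ D.α * (D.α + 1) * (4 / l ^ 2) := by gcongr
          _ = _ := by ring
      have k2 : 2 * D.α / l ^ 2 * s t ≤ 2 * D.α / l ^ 2 :=
        mul_le_of_le_one_right (by positivity) hs1
      have k3 : - D.α * (2 * D.α + 1 + D.drift t) * s t * s' t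
          ≤ 2 * D.α * (2 * D.α + 1 + ē) / l := by
        have j1 : -s' t ≤ 2 / l := (neg_le_abs _).trans hs'b
        have j2 : s t * -s' t ≤ 2 / l := by
          calc s t * -s' t ≤ s t * (2 / l) := by gcongr
            _ ≤ 1 * (2 / l) := by gcongr
            _ = _ := one_mul _
        calc _ = D.α * (2 * D.α + 1 + D.drift t) * (s t * -s' t) := by ring
          _ ≤ D.α * (2 * D.α + 1 + D.drift t) * (2 / l) := by gcongr
          _ ≤ D.α * (2 * D.α + 1 + ē) * (2 / l) := by gcongr
          _ = _ := by ring
      have k4 : (D.G + D.α * D.drift t) * (s t * s t) ≤ D.G + D.α * ē := by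
        have := D.G_pos
        have j1 : s t * s t ≤ 1 := mul_le_one₀ hs1 hsp.le hs1
        calc _ ≤ (D.G + D.α * D.drift t) * 1 := by gcongr
          _ ≤ _ := by rw [mul_one]; gcongr
      linarith
    calc _ = M * X * (D.α * (D.α + 1) * s' t ^ 2 + 2 * D.α / l ^ 2 * s t
        - D.α * (2 * D.α + 1 + D.drift t) * s t * s' t
        + (D.G + D.α * D.drift t) * (s t * s t)) := by ring
      _ ≤ M * X * M ^ (D.p - 1) := by gcongr
      _ = _ := by ring

end Params

end

/-! ### Upper bounds for global solutions and explicit subsolutions. -/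

section

namespace Params

variable (D : Params)

theorem radius_mem_of_global {a t : ℝ} (ha : D.life a = D.R) (ht : Real.exp (-t) < D.R) :
    D.R - Real.exp (-t) ∈ Ioo 0 (D.life a) := by
  rw [ha]
  exact ⟨by linarith, by linarith [Real.exp_pos (-t)]⟩

/-- Global radial solutions are locally bounded, uniformly in the central value. -/
theorem exists_bound_of_global {r : ℝ} (hr : r ∈ Ioo 0 D.R) :
    ∃ C, ∀ a, 0 < a → D.life a = D.R → D.U a r ≤ C := by
  have hd : 0 < D.R - r := sub_pos.2 hr.2
  set T := -Real.log (D.R - r) with hT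
  have hexpT : Real.exp (-T) = D.R - r := by rw [hT, neg_neg, Real.exp_log hd]
  have hlog : Real.log (D.R - r) < Real.log D.R := Real.log_lt_log hd (by linarith [hr.1])
  -- The centre of the ball is t = -log R, so the window starts halfway between the centre and T. It
  -- may extend as far towards the boundary as needed because the solution is global.
  set l := (T + Real.log D.R) / 2 with hl
  have hl0 : 0 < l := by simp only [hl, hT]; linarith
  have hstart : ∀ t, T - l ≤ t → Real.exp (-t) < D.R := fun t ht => by
    rw [← Real.lt_log_iff_exp_lt D.radius_pos]
    simp only [hl, hT] at ht ⊢
    linarith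
  have hs0 : 0 < D.R - Real.exp (-(T - l)) := sub_pos.2 (hstart _ le_rfl)
  set ē := D.drift (T - l)
  have hē : 0 ≤ ē := D.drift_nonneg hs0
  have hα := D.α_pos
  have hG := D.G_pos
  set Q := 4 * D.α * (D.α + 1) / l ^ 2 + 2 * D.α / l ^ 2 + 2 * D.α * (2 * D.α + 1 + ē) / l
      + (D.G + D.α * ē) with hQ
  have hQ0 : 0 < Q := by positivity
  have hp0 := sub_pos.2 D.one_lt
  refine ⟨Q ^ (1 / (D.p - 1)) * Real.exp (D.α * T), fun a ha hlife => ?_⟩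
  have h := D.Y_le_of_window (T := T) (M := Q ^ (1 / (D.p - 1))) (ē := ē) ha hl0
    (Real.rpow_pos_of_pos hQ0 _) (fun t ht => D.radius_mem_of_global hlife (hstart t ht.1))
    (fun t ht => D.drift_anti hs0 ht.1)
    (by rw [← Real.rpow_mul hQ0.le, one_div_mul_cancel hp0.ne', Real.rpow_one])
  unfold Y at h
  rw [hexpT, sub_sub_cancel, Real.exp_neg, ← div_eq_mul_inv, div_le_iff₀ (Real.exp_pos _)] at h
  exact h

/-- The sharp upper bound at the boundary for a global radial solution. -/
theorem eventually_Y_le {a M : ℝ} (ha : 0 < a) (hlife : D.life a = D.R) (hM : D.A < M) :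
    ∀ᶠ t in atTop, D.Y a t ≤ M := by
  have hα := D.α_pos
  have hM0 : 0 < M := D.A_pos.trans hM
  have hgap : D.G < M ^ (D.p - 1) := by
    rw [← D.A_rpow]
    exact Real.rpow_lt_rpow D.A_pos.le hM (sub_pos.2 D.one_lt)
  -- The drift is allowed half of the gap between M^(p-1) and G; a long window makes the remaining
  -- terms smaller than the other half.
  set ē := (M ^ (D.p - 1) - D.G) / (2 * D.α) with hē
  have hē0 : 0 < ē := div_pos (by linarith) (by positivity)
  have hlim : D.G + D.α * ē < M ^ (D.p - 1) := by
    have : D.α * ē = (M ^ (D.p - 1) - D.G) / 2 := by rw [hē]; field_simp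
    linarith
  obtain ⟨l, hl0, hl⟩ : ∃ l : ℝ, 0 < l ∧ 4 * D.α * (D.α + 1) / l ^ 2 + 2 * D.α / l ^ 2
      + 2 * D.α * (2 * D.α + 1 + ē) / l + (D.G + D.α * ē) ≤ M ^ (D.p - 1) := by
    have h2 : Tendsto (fun l : ℝ => l ^ 2) atTop atTop := tendsto_pow_atTop two_ne_zero
    have ht := ((h2.const_div_atTop (4 * D.α * (D.α + 1))).add
      (h2.const_div_atTop (2 * D.α))).add (tendsto_id.const_div_atTop
        (2 * D.α * (2 * D.α + 1 + ē))) |>.add_const (D.G + D.α * ē)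
    simp only [add_zero, zero_add] at ht
    obtain ⟨l, h3, h4⟩ := ((ht.eventually_lt_const hlim).and (eventually_gt_atTop 0)).exists
    exact ⟨l, h4, h3.le⟩
  have ev1 : ∀ᶠ t in atTop, D.drift (t - l) < ē :=
    (D.tendsto_drift.comp (tendsto_atTop_add_const_right _ (-l) tendsto_id)).eventually_lt_const
      hē0
  have ev2 : ∀ᶠ t in atTop, Real.exp (-(t - l)) < D.R :=
    (tendsto_exp_neg.comp
      (tendsto_atTop_add_const_right _ (-l) tendsto_id)).eventually_lt_const D.radius_pos
  filter_upwards [ev1, ev2] with T h1 h2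
  refine D.Y_le_of_window ha hl0 hM0 (fun t ht => D.radius_mem_of_global hlife ?_)
    (fun t ht => (D.drift_anti (sub_pos.2 h2) ht.1).trans h1.le) hl
  exact (Real.exp_le_exp.2 (by linarith [ht.1])).trans_lt h2

/-- The growth rate of the transition between the two regimes in the explicit subsolutions. -/
def rate : ℝ := min (D.gap / D.α) (1 - 2 * D.β) / 2

/-- The decay exponent in the explicit subsolutions. -/
def power : ℝ := D.gap / D.rate

/-- An explicit function that passes from the singular to the linear regime. -/
def trans (ε t : ℝ) : ℝ := D.A * (1 + ε * Real.exp (D.rate * t)) ^ (-D.power)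

theorem rate_pos : 0 < D.rate := by
  have := D.β_lt_half
  exact half_pos (lt_min (div_pos D.gap_pos D.α_pos) (by linarith))

theorem power_mul_rate : D.power * D.rate = D.gap := div_mul_cancel₀ _ D.rate_pos.ne'

theorem power_pos : 0 < D.power := div_pos D.gap_pos D.rate_pos

/-- Needed for (1 + h)^(-p · `power`) ≤ (1 + h)^(-`power` - 2) with h ≥ 0; it holds because the rate
is at most half of (α + β₋)/α. -/
theorem two_le_power_mul : 2 ≤ D.power * (D.p - 1) := by
  have h1 : D.rate ≤ D.gap / D.α / 2 := by
    unfold rate; gcongr; exact min_le_left _ _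
  have h2 : 2 * D.α ≤ D.power := by
    rw [power, le_div_iff₀ D.rate_pos]
    calc 2 * D.α * D.rate ≤ 2 * D.α * (D.gap / D.α / 2) := by
          have := D.α_pos
          gcongr
      _ = D.gap := by have := D.α_pos.ne'; field_simp
  have h3 := D.α_mul
  have h4 := sub_pos.2 D.one_lt
  nlinarith

theorem rate_lt : D.rate < 1 - 2 * D.β := by
  have h0 : 0 < 1 - 2 * D.β := by linarith [D.β_lt_half]
  have : min (D.gap / D.α) (1 - 2 * D.β) ≤ 1 - 2 * D.β := min_le_right _ _
  unfold rate
  linarith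

theorem one_add_pos {ε : ℝ} (hε : 0 ≤ ε) (t : ℝ) : 0 < 1 + ε * Real.exp (D.rate * t) := by
  positivity

theorem trans_le {ε : ℝ} (hε : 0 ≤ ε) (t : ℝ) : D.trans ε t ≤ D.A := by
  refine mul_le_of_le_one_right D.A_pos.le (Real.rpow_le_one_of_one_le_of_nonpos ?_ ?_)
  · have : 0 ≤ ε * Real.exp (D.rate * t) := by positivity
    linarith
  · linarith [D.power_pos]

/-- The first derivative of `trans`. -/
def trans' (ε t : ℝ) : ℝ := D.A * (-D.gap * (ε * Real.exp (D.rate * t))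
  * (1 + ε * Real.exp (D.rate * t)) ^ (-D.power - 1))

/-- The second derivative of `trans`. -/
def trans'' (ε t : ℝ) : ℝ := D.A * (-D.gap * D.rate * (ε * Real.exp (D.rate * t))
    * (1 + ε * Real.exp (D.rate * t)) ^ (-D.power - 1)
  + D.gap * (D.gap + D.rate) * (ε * Real.exp (D.rate * t)) ^ 2
    * (1 + ε * Real.exp (D.rate * t)) ^ (-D.power - 1 - 1))

theorem hasDerivAt_bump (ε t : ℝ) : HasDerivAt (fun t => ε * Real.exp (D.rate * t))
    (D.rate * (ε * Real.exp (D.rate * t))) t := by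
  have := (((hasDerivAt_id t).const_mul D.rate).exp).const_mul ε
  refine this.congr_deriv ?_
  simp; ring

theorem hasDerivAt_trans {ε : ℝ} (hε : 0 ≤ ε) (t : ℝ) :
    HasDerivAt (D.trans ε) (D.trans' ε t) t := by
  have h := (((D.hasDerivAt_bump ε t).const_add 1).rpow_const (p := -D.power)
    (Or.inl (D.one_add_pos hε t).ne')).const_mul D.A
  refine h.congr_deriv ?_
  unfold trans'
  rw [← D.power_mul_rate]
  ring

theorem hasDerivAt_trans' {ε : ℝ} (hε : 0 ≤ ε) (t : ℝ) :
    HasDerivAt (D.trans' ε) (D.trans'' ε t) t := by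
  have h := (((D.hasDerivAt_bump ε t).const_mul (-D.gap)).mul
    (((D.hasDerivAt_bump ε t).const_add 1).rpow_const (p := -D.power - 1)
    (Or.inl (D.one_add_pos hε t).ne'))).const_mul D.A
  refine h.congr_deriv ?_
  unfold trans''
  rw [← D.power_mul_rate]
  ring

/-- With h = ε e^(κ t), where κ is `rate`, division by A (1 + h)^(-`power` - 2) leaves a quadratic
inequality in h. Its margin is gap (1 - 2β₋ - κ) h, positive because κ lies below the distance 1 -
2β₋ of the two linear exponents, and the hypothesis on the drift keeps the perturbation below it. -/
theorem trans_sub {ε t : ℝ} (hε : 0 ≤ ε) (he : 0 ≤ D.drift t)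
    (hs : D.drift t * D.β * (1 + ε * Real.exp (D.rate * t))
      ≤ D.gap * (1 - 2 * D.β - D.rate)) :
    D.trans ε t ^ D.p ≤ D.trans'' ε t + (2 * D.α + 1 + D.drift t) * D.trans' ε t
      + (D.G + D.α * D.drift t) * D.trans ε t := by
  have h1 := D.one_add_pos hε t
  have hh : 0 ≤ ε * Real.exp (D.rate * t) := by positivity
  unfold trans trans' trans''
  set h := ε * Real.exp (D.rate * t)
  set X := (1 + h) ^ (-D.power - 1 - 1) with hX
  have hX0 : 0 < X := Real.rpow_pos_of_pos h1 _
  have e1 : (1 + h) ^ (-D.power - 1) = X * (1 + h) := by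
    rw [hX, ← Real.rpow_add_one h1.ne']; ring_nf
  have e2 : (1 + h) ^ (-D.power) = X * (1 + h) * (1 + h) := by
    rw [hX, ← Real.rpow_add_one h1.ne', ← Real.rpow_add_one h1.ne']; ring_nf
  have e3 : (D.A * (1 + h) ^ (-D.power)) ^ D.p ≤ D.A * D.G * X := by
    rw [Real.mul_rpow D.A_pos.le (by positivity), ← Real.rpow_mul h1.le]
    have j1 : D.A ^ D.p = D.A * D.G := by
      rw [← D.A_rpow, Real.rpow_sub_one D.A_pos.ne']
      have := D.A_pos.ne'
      field_simp
    have j2 : (1 + h) ^ (-D.power * D.p) ≤ X := by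
      refine Real.rpow_le_rpow_of_exponent_le (by linarith) ?_
      linarith [D.two_le_power_mul]
    rw [j1]
    have := D.A_pos
    have := D.G_pos
    gcongr
  refine e3.trans ?_
  rw [e1, e2]
  have hA := D.A_pos
  have key : D.G ≤ D.gap * (D.gap + D.rate) * h ^ 2 - D.gap * D.rate * h * (1 + h)
      - (2 * D.α + 1 + D.drift t) * (D.gap * h * (1 + h))
      + (D.G + D.α * D.drift t) * ((1 + h) * (1 + h)) := by
    have i1 : D.gap * (D.gap + D.rate) * h ^ 2 - D.gap * D.rate * h * (1 + h)
      - (2 * D.α + 1 + D.drift t) * (D.gap * h * (1 + h))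
      + (D.G + D.α * D.drift t) * ((1 + h) * (1 + h)) - D.G
      = D.gap * (1 - 2 * D.β - D.rate) * h - D.drift t * D.β * (1 + h) * h
        + D.α * (D.drift t * (1 + h)) := by
      rw [G_eq_gap, gap]; ring
    have i2 := mul_le_mul_of_nonneg_right hs hh
    have i3 : 0 ≤ D.α * (D.drift t * (1 + h)) :=
      mul_nonneg D.α_pos.le (mul_nonneg he h1.le)
    linarith
  calc D.A * D.G * X = D.A * X * D.G := by ring
    _ ≤ D.A * X * (D.gap * (D.gap + D.rate) * h ^ 2 - D.gap * D.rate * h * (1 + h)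
      - (2 * D.α + 1 + D.drift t) * (D.gap * h * (1 + h))
      + (D.G + D.α * D.drift t) * ((1 + h) * (1 + h))) := by gcongr
    _ = _ := by ring

/-- A lower bound by explicit subsolutions: it holds from a fixed radius on, up to any radius at
which the subsolution has been overtaken. -/
theorem exists_lower_bound : ∃ t₁ K : ℝ, Real.exp (-t₁) < D.R ∧ 0 < K ∧
    ∀ a d ε : ℝ, 0 < a → D.R - Real.exp (-d) < D.life a → 0 ≤ ε → ε ≤ 1 →
      D.trans ε d ≤ D.Y a d → ∀ t ∈ Icc t₁ d,
        D.trans ε t - K * Real.exp (-((D.α + 1 / 2) * t)) ≤ D.Y a t := by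
  have hsmall : ∀ᶠ t in atTop, Real.exp (-t) < D.R ∧
      D.drift t * D.β * (1 + Real.exp (D.rate * t)) ≤ D.gap * (1 - 2 * D.β - D.rate) := by
    refine (tendsto_exp_neg.eventually_lt_const D.radius_pos).and ?_
    have hpos : 0 < D.gap * (1 - 2 * D.β - D.rate) :=
      mul_pos D.gap_pos (by linarith [D.rate_lt])
    rcases D.β_cases with ⟨h1, -⟩ | ⟨h1, -⟩
    · filter_upwards [tendsto_exp_neg.eventually_lt_const D.radius_pos] with t ht
      have := D.drift_nonneg (sub_pos.2 ht)
      have h2 : D.drift t * D.β * (1 + Real.exp (D.rate * t)) ≤ 0 :=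
        mul_nonpos_of_nonpos_of_nonneg (mul_nonpos_of_nonneg_of_nonpos this h1.le)
          (by positivity)
      linarith
    -- For β₋ > 0 the drift term has the wrong sign, but it decays like e^(-t) while the bump grows
    -- only like e^(κ t), κ being `rate` and less than 1.
    · have hr : 0 < 1 - D.rate := by linarith [D.rate_lt]
      have l1 : Tendsto (fun t => Real.exp (-t) * (1 + Real.exp (D.rate * t))) atTop (𝓝 0) := by
        have l2 : Tendsto (fun t => Real.exp (-((1 - D.rate) * t))) atTop (𝓝 0) :=
          tendsto_exp_neg.comp (tendsto_id.const_mul_atTop hr)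
        have l3 := tendsto_exp_neg.add l2
        rw [add_zero] at l3
        refine l3.congr fun t => ?_
        rw [mul_add, mul_one, ← Real.exp_add]
        congr 2; ring
      have l4 := ((l1.const_mul ((D.N : ℝ) - 1)).div (tendsto_exp_neg.const_sub D.R)
        (by simpa using D.radius_pos.ne')).mul_const D.β
      rw [mul_zero, zero_div, zero_mul] at l4
      filter_upwards [l4.eventually_lt_const hpos] with t ht
      refine le_trans (le_of_eq ?_) ht.le
      simp only [drift, Pi.div_apply]
      ring
  obtain ⟨t₁, ht₁⟩ := eventually_atTop.1 hsmall
  have hα := D.α_pos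
  have hA := D.A_pos
  refine ⟨t₁, D.A / Real.exp (-((D.α + 1 / 2) * t₁)), (ht₁ t₁ le_rfl).1, by positivity,
    fun a d ε ha hd hε hε1 hcmp => ?_⟩
  -- This K makes the subtracted term equal to A at t₁, so the subsolution is nonpositive there and
  -- no information on Y at t₁ is needed. Hence t₁ and K do not depend on a, d or ε.
  set K := D.A / Real.exp (-((D.α + 1 / 2) * t₁)) with hK
  have hK0 : 0 < K := by positivity
  have hmem : ∀ t ∈ Icc t₁ d, D.R - Real.exp (-t) ∈ Ioo 0 (D.life a) := fun t ht =>
    ⟨sub_pos.2 (ht₁ t ht.1).1, lt_of_le_of_lt (by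
      have : Real.exp (-d) ≤ Real.exp (-t) := Real.exp_le_exp.2 (by linarith [ht.2])
      linarith) hd⟩
  intro t ht
  have htd : t₁ ≤ d := ht.1.trans ht.2
  set lam := -(D.α + 1 / 2) with hlam
  have hz : ∀ t, HasDerivAt (fun t => K * Real.exp (-((D.α + 1 / 2) * t)))
      (K * (lam * Real.exp (-((D.α + 1 / 2) * t)))) t := fun t =>
    (hasDerivAt_exp_neg_mul (D.α + 1 / 2) t).const_mul K
  have hz' : ∀ t, HasDerivAt (fun t => K * (lam * Real.exp (-((D.α + 1 / 2) * t))))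
      (K * (lam * (lam * Real.exp (-((D.α + 1 / 2) * t))))) t := fun t =>
    ((hasDerivAt_exp_neg_mul (D.α + 1 / 2) t).const_mul lam).const_mul K
  refine le_of_sub_super (p := D.p) (c := t₁) (d := d) D.one_lt
    (b := fun t => 2 * D.α + 1 + D.drift t) (g := fun t => D.G + D.α * D.drift t)
    (y₁ := fun t => D.trans ε t - K * Real.exp (-((D.α + 1 / 2) * t)))
    (y₁' := fun t => D.trans' ε t - K * (lam * Real.exp (-((D.α + 1 / 2) * t))))
    (y₁'' := fun t => D.trans'' ε t - K * (lam * (lam * Real.exp (-((D.α + 1 / 2) * t)))))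
    (y₂ := D.Y a) (y₂' := D.Y' a) (y₂'' := D.Y'' a) ?_ (D.Y_continuousOn hmem)
    (fun t ht => D.Y_pos ha (hmem t ht)) ?_ ?_
    (fun t _ => (D.hasDerivAt_trans hε t).sub (hz t))
    (fun t _ => (D.hasDerivAt_trans' hε t).sub (hz' t))
    (fun t ht => D.hasDerivAt_Y (hmem t (Ioo_subset_Icc_self ht)))
    (fun t ht => D.hasDerivAt_Y' ha (hmem t (Ioo_subset_Icc_self ht))) ?_
    (fun t _ => (D.Y_equation a t).le) t ht
  · exact fun t _ => ((D.hasDerivAt_trans hε t).sub (hz t)).continuousAt.continuousWithinAt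
  · have h1 := D.trans_le hε t₁
    have h2 : K * Real.exp (-((D.α + 1 / 2) * t₁)) = D.A := by
      rw [hK]; exact div_mul_cancel₀ _ (Real.exp_pos _).ne'
    have h3 := D.Y_pos ha (hmem t₁ ⟨le_rfl, htd⟩)
    rw [h2]
    linarith
  · have : 0 ≤ K * Real.exp (-((D.α + 1 / 2) * d)) := by positivity
    linarith
  · intro t ht hpos
    have htI := Ioo_subset_Icc_self ht
    have hdr := D.drift_nonneg (hmem t htI).1
    set z := Real.exp (-((D.α + 1 / 2) * t)) with hzdef
    have hz0 : 0 < z := Real.exp_pos _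
    have hs := D.trans_sub (ε := ε) (t := t) hε hdr (by
      rcases D.β_cases with ⟨h1, -⟩ | ⟨h1, -⟩
      · have h2 : D.drift t * D.β * (1 + ε * Real.exp (D.rate * t)) ≤ 0 :=
          mul_nonpos_of_nonpos_of_nonneg (mul_nonpos_of_nonneg_of_nonpos hdr h1.le)
            (D.one_add_pos hε t).le
        have h3 : 0 < D.gap * (1 - 2 * D.β - D.rate) :=
          mul_pos D.gap_pos (by linarith [D.rate_lt])
        linarith
      · refine le_trans ?_ (ht₁ t htI.1).2
        have : ε * Real.exp (D.rate * t) ≤ 1 * Real.exp (D.rate * t) := by gcongr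
        have := mul_nonneg hdr h1.le
        gcongr
        linarith)
    have h1 : (D.trans ε t - K * z) ^ D.p ≤ D.trans ε t ^ D.p :=
      Real.rpow_le_rpow hpos.le (by have : 0 ≤ K * z := by positivity
                                    linarith) D.p_nonneg
    -- The function z corresponds to (R - r)^(1/2), on which the linear operator is nonpositive
    -- because μ < 1/4; subtracting its multiple preserves subsolutions.
    have h2 : K * (lam * (lam * z)) + (2 * D.α + 1 + D.drift t) * (K * (lam * z))
        + (D.G + D.α * D.drift t) * (K * z) = K * z * (D.μ - 1 / 4 - D.drift t / 2) := by
      rw [hlam, G_eq]; ring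
    have h3 : K * z * (D.μ - 1 / 4 - D.drift t / 2) ≤ 0 :=
      mul_nonpos_of_nonneg_of_nonpos (by positivity) (by linarith [D.upper])
    linarith

end Params

end

/-! ### Existence of global profiles and a monotone quantity near the boundary. -/

section

theorem exists_gt_lt_of_hasDerivAt_neg {f : ℝ → ℝ} {f' x y : ℝ} (hf : HasDerivAt f f' x)
    (h : f' < 0) (hxy : x < y) : ∃ z ∈ Ioo x y, f z < f x := by
  have h1 := (hasDerivAt_iff_tendsto_slope.1 hf).eventually_lt_const h
  have h2 : ∀ᶠ z in 𝓝[>] x, slope f x z < 0 :=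
    h1.filter_mono (nhdsWithin_mono x fun z hz => ne_of_gt hz)
  obtain ⟨z, hz, hz'⟩ := (h2.and (Ioo_mem_nhdsGT hxy)).exists
  refine ⟨z, hz', ?_⟩
  rw [slope_def_field, div_neg_iff] at hz
  rcases hz with hz | hz
  · linarith [hz.2, hz'.1]
  · linarith [hz.1]

namespace Params

variable (D : Params)

theorem exp_neg_neg_log {r : ℝ} (hr : r < D.R) : Real.exp (-(-Real.log (D.R - r))) = D.R - r := by
  rw [neg_neg, Real.exp_log (sub_pos.2 hr)]

theorem Y_log {a r : ℝ} (hr : r < D.R) :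
    D.Y a (-Real.log (D.R - r)) = D.U a r * (D.R - r) ^ D.α := by
  unfold Y
  rw [D.exp_neg_neg_log hr, sub_sub_cancel, Real.rpow_def_of_pos (sub_pos.2 hr)]
  congr 2
  ring

/-- Radial solutions with small central values stay below the explicit singular subsolution. -/
theorem Y_le_of_small {a : ℝ} (ha : 0 < a) (hsmall : a * D.R ^ D.α < D.A) {t : ℝ}
    (ht : D.R - Real.exp (-t) ∈ Ioo 0 (D.life a)) : D.Y a t ≤ D.A := by
  by_contra! hlt
  have hR := D.radius_pos
  have hl := D.life_pos a
  have hα := D.α_pos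
  have hU : Tendsto (D.U a) (𝓝[>] 0) (𝓝 a) := by
    have := tendsto_nhdsGT_zero_of_continuousOn hl (D.U_continuousOn a)
    rwa [D.U_zero ha.le] at this
  have hpow : Tendsto (fun r : ℝ => (D.R - r) ^ D.α) (𝓝[>] 0) (𝓝 (D.R ^ D.α)) := by
    have : ContinuousAt (fun r : ℝ => (D.R - r) ^ D.α) 0 :=
      ContinuousAt.rpow_const (by fun_prop) (Or.inl (by simpa using hR.ne'))
    have h := this.tendsto
    simp only [sub_zero] at h
    exact h.mono_left nhdsWithin_le_nhds
  have hsub : Tendsto (fun r : ℝ => D.R - r) (𝓝[>] 0) (𝓝 D.R) := by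
    have : Continuous (fun r : ℝ => D.R - r) := by fun_prop
    have h := this.tendsto 0
    simp only [sub_zero] at h
    exact h.mono_left nhdsWithin_le_nhds
  have ev1 := (hU.mul hpow).eventually_lt_const hsmall
  -- Near the centre Y has slope of the sign of -α a, so it starts below A and decreasing. To exceed
  -- A later it would need an interior minimum below A, where the equation forces Y'' < 0.
  have ev2 : ∀ᶠ r in 𝓝[>] (0 : ℝ), D.U' a r * (D.R - r) - D.α * D.U a r < 0 := by
    refine (((D.tendsto_U'_zero a).mul hsub).sub (hU.const_mul D.α)).eventually_lt_const ?_
    have : 0 < D.α * a := by positivity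
    linarith
  obtain ⟨r, ⟨h1, h2⟩, hr⟩ := ((ev1.and ev2).and (Ioo_mem_nhdsGT ht.1)).exists
  have hrR : r < D.R := by linarith [hr.2, Real.exp_pos (-t)]
  set s := -Real.log (D.R - r) with hs
  have hes : Real.exp (-s) = D.R - r := D.exp_neg_neg_log hrR
  have hrs : D.R - Real.exp (-s) = r := by rw [hes]; ring
  have hst : s < t := by
    have : Real.exp (-t) < Real.exp (-s) := by rw [hes]; linarith [hr.2]
    have := Real.exp_lt_exp.1 this
    linarith
  have hmem : ∀ τ ∈ Icc s t, D.R - Real.exp (-τ) ∈ Ioo 0 (D.life a) := fun τ hτ => by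
    have e1 : Real.exp (-τ) ≤ Real.exp (-s) := Real.exp_le_exp.2 (by linarith [hτ.1])
    have e2 : Real.exp (-t) ≤ Real.exp (-τ) := Real.exp_le_exp.2 (by linarith [hτ.2])
    exact ⟨by linarith [hr.1], by linarith [ht.2]⟩
  have hYs : D.Y a s < D.A := by rw [hs, D.Y_log hrR]; exact h1
  have hY's : D.Y' a s < 0 := by
    have hE : 0 < Real.exp (-(D.α * s)) := Real.exp_pos _
    have : D.Y' a s = (D.U' a r * (D.R - r) - D.α * D.U a r) * Real.exp (-(D.α * s)) := by
      unfold Y' Y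
      rw [hes, sub_sub_cancel]; ring
    rw [this]
    exact mul_neg_of_neg_of_pos h2 hE
  obtain ⟨t₀, ht₀, hmin⟩ := isCompact_Icc.exists_isMinOn ⟨s, le_rfl, hst.le⟩
    (D.Y_continuousOn hmem)
  have hYt₀ : D.Y a t₀ < D.A := (hmin ⟨le_rfl, hst.le⟩ : D.Y a t₀ ≤ D.Y a s).trans_lt hYs
  have hI : t₀ ∈ Ioo s t := by
    refine ⟨lt_of_le_of_ne ht₀.1 ?_, lt_of_le_of_ne ht₀.2 ?_⟩
    · intro heq
      obtain ⟨z, hz, hlt'⟩ := exists_gt_lt_of_hasDerivAt_neg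
        (D.hasDerivAt_Y (hmem s ⟨le_rfl, hst.le⟩)) hY's hst
      have : D.Y a t₀ ≤ D.Y a z := hmin (Ioo_subset_Icc_self hz)
      rw [← heq] at this
      linarith
    · rintro rfl; linarith
  have hloc : IsLocalMin (D.Y a) t₀ := by
    filter_upwards [Ioo_mem_nhds hI.1 hI.2] with τ hτ
    exact hmin (Ioo_subset_Icc_self hτ)
  have hev : ∀ᶠ τ in 𝓝 t₀, HasDerivAt (D.Y a) (D.Y' a τ) τ := by
    filter_upwards [Ioo_mem_nhds hI.1 hI.2] with τ hτ
    exact D.hasDerivAt_Y (hmem τ (Ioo_subset_Icc_self hτ))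
  have k1 := hloc.hasDerivAt_eq_zero hev.self_of_nhds
  have k2 := IsLocalMin.second_deriv_nonneg hloc hev (D.hasDerivAt_Y' ha (hmem t₀ ht₀))
  have k3 := D.Y_equation a t₀
  have hY0 := D.Y_pos ha (hmem t₀ ht₀)
  have hdr := D.drift_nonneg (hmem t₀ ht₀).1
  have k4 : D.Y a t₀ ^ D.p < D.G * D.Y a t₀ := by
    have : D.Y a t₀ ^ D.p = D.Y a t₀ ^ (D.p - 1) * D.Y a t₀ := by
      rw [Real.rpow_sub_one hY0.ne']; field_simp
    rw [this, ← D.A_rpow]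
    have := Real.rpow_lt_rpow hY0.le hYt₀ (sub_pos.2 D.one_lt)
    gcongr
  rw [k1] at k3
  have : 0 ≤ D.α * D.drift t₀ * D.Y a t₀ := by positivity
  nlinarith

/-- Blow-up at a radius less than R would make Y unbounded, since (R - r)^α stays away from 0 there.
-/
theorem life_of_small {a : ℝ} (ha : 0 < a) (hsmall : a * D.R ^ D.α < D.A) : D.life a = D.R := by
  refine le_antisymm (D.life_le a) (not_lt.1 fun hlt => ?_)
  have hl := D.life_pos a
  have hd : 0 < D.R - D.life a := sub_pos.2 hlt
  have hα := D.α_pos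
  have hA := D.A_pos
  have ev := (D.tendsto_U_atTop hlt).eventually_gt_atTop (D.A / (D.R - D.life a) ^ D.α)
  obtain ⟨r, h1, h2⟩ := (ev.and (Ioo_mem_nhdsLT hl)).exists
  have hrR : r < D.R := h2.2.trans hlt
  have h3 := D.Y_le_of_small ha hsmall (t := -Real.log (D.R - r))
    (by rw [D.exp_neg_neg_log hrR, sub_sub_cancel]; exact h2)
  rw [D.Y_log hrR] at h3
  have hP : 0 < (D.R - D.life a) ^ D.α := Real.rpow_pos_of_pos hd _
  have h4 : (D.R - D.life a) ^ D.α ≤ (D.R - r) ^ D.α :=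
    Real.rpow_le_rpow hd.le (by linarith [h2.2]) hα.le
  rw [div_lt_iff₀ hP] at h1
  have h5 := D.U_pos ha ⟨h2.1.le, h2.2⟩
  nlinarith

theorem U'_nonneg_of_neg {a r : ℝ} (hβ : D.β < 0) (hr : r ∈ Ioo 0 (D.life a)) :
    0 ≤ D.U' a r := by
  have hb : D.b = 0 := max_eq_right hβ.le
  have hrR := D.mem_of_life ⟨hr.1.le, hr.2⟩
  have h1 : D.weight' r = 0 := by unfold weight'; rw [hb]; ring
  unfold U'
  rw [h1, zero_mul, zero_add]
  refine mul_nonneg (D.weight_pos hrR).le (mul_nonneg hr.1.le ?_)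
  exact div_nonneg (D.isWeight.realFlux_nonneg D.p_nonneg hrR)
    (mul_nonneg hr.1.le (D.isWeight.mass_nonneg hrR))

/-- A weight `Q ∼ (R - r) ^ (- β₋)` such that `Q U` is eventually monotone for every global radial
profile `U`. -/
theorem exists_comparator : ∃ (r₀ c₀ : ℝ) (Q : ℝ → ℝ), 0 ≤ r₀ ∧ r₀ < D.R ∧ 0 < c₀ ∧
    (∀ r ∈ Ioo r₀ D.R, 0 < Q r) ∧
    Tendsto (fun r => Q r * (D.R - r) ^ D.β) (𝓝[<] D.R) (𝓝 c₀) ∧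
    ∀ a, 0 < a → D.life a = D.R → MonotoneOn (fun r => D.U a r * Q r) (Ioo r₀ D.R) := by
  have hR := D.radius_pos
  rcases D.β_cases with ⟨hβ, -⟩ | ⟨hβ, -⟩
  · have hN : (1 : ℝ) ≤ D.N := by exact_mod_cast D.one_le_dim
    set B := -D.β with hB
    have hB0 : 0 < B := by simp only [hB]; linarith
    have hμ : B ^ 2 + B + D.μ = 0 := by rw [hB, ← D.β_mul]; ring
    -- For β₋ < 0 the weight is trivial and only U itself is known to increase. The radius r₀ solves
    -- (N + 1) B r = 2N (R - r), the sign change of the linear term in the derivative of P Z.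
    set r₀ := 2 * D.N * D.R / (2 * D.N + (D.N + 1) * B) with hr₀
    have hden : 0 < 2 * D.N + (D.N + 1) * B := by positivity
    have hr₀0 : 0 < r₀ := by positivity
    have hr₀R : r₀ < D.R := by
      rw [hr₀, div_lt_iff₀ hden]
      have : 0 < D.R * ((D.N + 1) * B) := by positivity
      linarith
    have hr₀eq : 2 * D.N * (D.R - r₀) = (D.N + 1) * B * r₀ := by
      rw [hr₀]; field_simp; ring
    refine ⟨r₀, D.R ^ D.N, fun r => r ^ D.N * (D.R - r) ^ B, hr₀0.le, hr₀R, by positivity,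
      fun r hr => ?_, ?_, fun a ha hlife => ?_⟩
    · exact mul_pos (pow_pos (hr₀0.trans hr.1) _) (Real.rpow_pos_of_pos (sub_pos.2 hr.2) _)
    · have : Tendsto (fun r : ℝ => r ^ D.N) (𝓝[<] D.R) (𝓝 (D.R ^ D.N)) :=
        ((continuous_pow D.N).tendsto D.R).mono_left nhdsWithin_le_nhds
      refine this.congr' ?_
      filter_upwards [self_mem_nhdsWithin] with r hr
      have hd : 0 < D.R - r := sub_pos.2 hr
      rw [mul_assoc, ← Real.rpow_add hd, hB]
      simp
    -- Here k = -Q'/Q, so (U Q)' = Q Z. The factor P removes U' from (P Z)', and B² + B + μ = 0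
    -- removes the double pole at R.
    · set k : ℝ → ℝ := fun r => -D.N / r + B / (D.R - r) with hk
      set Z : ℝ → ℝ := fun r => D.U' a r - k r * D.U a r with hZ
      set P : ℝ → ℝ := fun r => r⁻¹ * (D.R - r) ^ (-B) with hP
      have hmem : ∀ r ∈ Ico r₀ D.R, r ∈ Ioo 0 (D.life a) := fun r hr => by
        rw [hlife]; exact ⟨hr₀0.trans_le hr.1, hr.2⟩
      have hP0 : ∀ r ∈ Ico r₀ D.R, 0 < P r := fun r hr =>
        mul_pos (inv_pos.2 (hmem r hr).1) (Real.rpow_pos_of_pos (sub_pos.2 hr.2) _)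
      have dδ : ∀ r, HasDerivAt (fun r : ℝ => D.R - r) (-1) r := fun r => by
        simpa using (hasDerivAt_id r).const_sub D.R
      have dk : ∀ r ∈ Ico r₀ D.R, HasDerivAt k (D.N / r ^ 2 + B / (D.R - r) ^ 2) r := by
        intro r hr
        have h0 := (hmem r hr).1.ne'
        have h1 : D.R - r ≠ 0 := (sub_pos.2 hr.2).ne'
        have := ((hasDerivAt_const r (-(D.N : ℝ))).div (hasDerivAt_id r) h0).add
          ((hasDerivAt_const r B).div (dδ r) h1)
        refine this.congr_deriv ?_
        simp
      have dP : ∀ r ∈ Ico r₀ D.R, HasDerivAt P (P r * (-1 / r + B / (D.R - r))) r := by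
        intro r hr
        have h0 := (hmem r hr).1.ne'
        have h1 : D.R - r ≠ 0 := (sub_pos.2 hr.2).ne'
        have := (hasDerivAt_inv h0).mul ((dδ r).rpow_const (p := -B) (Or.inl h1))
        refine this.congr_deriv ?_
        simp only [hP]
        rw [Real.rpow_sub_one h1]
        field_simp
      have dZ : ∀ r ∈ Ico r₀ D.R, HasDerivAt Z (D.U'' a r -
          ((D.N / r ^ 2 + B / (D.R - r) ^ 2) * D.U a r + k r * D.U' a r)) r := fun r hr =>
        (D.hasDerivAt_U' (hmem r hr)).sub ((dk r hr).mul (D.hasDerivAt_U (hmem r hr)))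
      have dPZ : ∀ r ∈ Ico r₀ D.R, HasDerivAt (fun r => P r * Z r) (P r * (D.U a r ^ D.p
          + D.U a r * ((D.N + 1) * B * r - 2 * D.N * (D.R - r)) / (r ^ 2 * (D.R - r)))) r := by
        intro r hr
        have h0 := (hmem r hr).1.ne'
        have h1 : D.R - r ≠ 0 := (sub_pos.2 hr.2).ne'
        refine ((dP r hr).mul (dZ r hr)).congr_deriv ?_
        have hμ' : D.μ = -B ^ 2 - B := by linarith
        simp only [hZ, hk, U'']
        rw [hμ']
        field_simp
        ring
      have hPZ : MonotoneOn (fun r => P r * Z r) (Ico r₀ D.R) := by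
        refine monotoneOn_of_deriv_nonneg (convex_Ico _ _)
          (fun r hr => (dPZ r hr).continuousAt.continuousWithinAt)
          (fun r hr => (dPZ r (interior_subset hr)).differentiableAt.differentiableWithinAt)
          fun r hr => ?_
        have hr' := interior_subset hr
        have hrm := hmem r hr'
        have hd : 0 < D.R - r := sub_pos.2 hr'.2
        rw [(dPZ r hr').deriv]
        have hU0 := D.U_pos ha ⟨hrm.1.le, hrm.2⟩
        have hnum : 0 ≤ (D.N + 1) * B * r - 2 * D.N * (D.R - r) := by
          have e1 : (D.N + 1) * B * r₀ ≤ (D.N + 1) * B * r := by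
            have := hr'.1
            gcongr
          have e2 : 2 * D.N * (D.R - r) ≤ 2 * D.N * (D.R - r₀) := by
            have := hr'.1
            gcongr
          linarith
        have hPr := hP0 r hr'
        have := hrm.1
        positivity
      -- Together with U' ≥ 0 this starts the monotonicity argument with Z(r₀) ≥ 0; the choice of r₀
      -- reduces it to 2 ≤ N + 1.
      have hk0 : k r₀ ≤ 0 := by
        have hd : 0 < D.R - r₀ := sub_pos.2 hr₀R
        simp only [hk]
        rw [neg_div, neg_add_nonpos_iff, div_le_div_iff₀ hd hr₀0]
        have : (D.N + 1) * (B * r₀) ≤ (D.N + 1) * (D.N * (D.R - r₀)) := by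
          have : 0 ≤ (D.N - 1) * (D.N * (D.R - r₀)) :=
            mul_nonneg (by linarith) (by positivity)
          nlinarith
        exact le_of_mul_le_mul_left this (by linarith)
      have hZ0 : 0 ≤ Z r₀ := by
        have hm := hmem r₀ ⟨le_rfl, hr₀R⟩
        have h1 := D.U'_nonneg_of_neg hβ hm
        have h2 := D.U_pos ha ⟨hm.1.le, hm.2⟩
        simp only [hZ]
        nlinarith
      have hZnn : ∀ r ∈ Ico r₀ D.R, 0 ≤ Z r := fun r hr => by
        have h1 : P r₀ * Z r₀ ≤ P r * Z r := hPZ ⟨le_rfl, hr₀R⟩ hr hr.1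
        have h2 : 0 ≤ P r₀ * Z r₀ := mul_nonneg (hP0 _ ⟨le_rfl, hr₀R⟩).le hZ0
        exact nonneg_of_mul_nonneg_right (h2.trans h1) (hP0 r hr)
      have dUQ : ∀ r ∈ Ioo r₀ D.R, HasDerivAt (fun r => D.U a r * (r ^ D.N * (D.R - r) ^ B))
          (r ^ D.N * (D.R - r) ^ B * Z r) r := by
        intro r hr
        have hr' := Ioo_subset_Ico_self hr
        have h0 := (hmem r hr').1.ne'
        have h1 : D.R - r ≠ 0 := (sub_pos.2 hr.2).ne'
        have := (D.hasDerivAt_U (hmem r hr')).mul ((hasDerivAt_pow D.N r).mul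
          ((dδ r).rpow_const (p := B) (Or.inl h1)))
        refine this.congr_deriv ?_
        obtain ⟨n, hn⟩ : ∃ n, D.N = n + 1 := ⟨D.N - 1, by have := D.one_le_dim; omega⟩
        simp only [hZ, hk, Pi.mul_apply]
        rw [Real.rpow_sub_one h1, hn]
        simp only [Nat.add_sub_cancel, pow_succ]
        push_cast
        field_simp
        ring
      refine monotoneOn_of_deriv_nonneg (convex_Ioo _ _)
          (fun r hr => (dUQ r hr).continuousAt.continuousWithinAt)
          (fun r hr => (dUQ r (interior_subset hr)).differentiableAt.differentiableWithinAt)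
          fun r hr => ?_
      have hr' := interior_subset hr
      rw [(dUQ r hr').deriv]
      have h1 := (hmem r (Ioo_subset_Ico_self hr')).1
      have h2 : 0 < D.R - r := sub_pos.2 hr'.2
      have h3 := hZnn r (Ioo_subset_Ico_self hr')
      positivity
  · have hb : D.b = D.β := max_eq_left hβ.le
    -- For β₋ > 0 the weight itself has the linear rate, and U / ψ = w is monotone.
    refine ⟨0, (2 * D.R) ^ (-D.β), fun r => (D.weight r)⁻¹, le_rfl, hR, by positivity,
      fun r hr => inv_pos.2 (D.weight_pos ⟨hr.1.le, hr.2⟩), ?_, fun a ha hlife r hr s hs hrs => ?_⟩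
    · have hc : ContinuousAt (fun r : ℝ => (D.R + r) ^ (-D.β)) D.R :=
        ContinuousAt.rpow_const (by fun_prop) (Or.inl (by positivity))
      have : Tendsto (fun r : ℝ => (D.R + r) ^ (-D.β)) (𝓝[<] D.R) (𝓝 ((2 * D.R) ^ (-D.β))) := by
        rw [two_mul]
        exact hc.tendsto.mono_left nhdsWithin_le_nhds
      refine this.congr' ?_
      filter_upwards [Ioo_mem_nhdsLT hR] with r hr
      have hd : 0 < D.R - r := sub_pos.2 hr.2
      have hs : 0 < D.R + r := by linarith [hr.1]
      unfold weight
      rw [hb, show D.R ^ 2 - r ^ 2 = (D.R - r) * (D.R + r) by ring, Real.mul_rpow hd.le hs.le,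
        Real.rpow_neg hs.le]
      have := (Real.rpow_pos_of_pos hd D.β).ne'
      have := (Real.rpow_pos_of_pos hs D.β).ne'
      field_simp
    · simp only [← div_eq_mul_inv]
      exact D.U_div_weight_mono hr.1.le hrs (by rw [hlife]; exact ⟨hs.1.le, hs.2⟩)

end Params

end

/-! ### The threshold and the two boundary regimes. -/

section

namespace Params

variable (D : Params)

/-- The quotient of a radial profile by the linear boundary rate. -/
def lin (a r : ℝ) : ℝ := D.U a r / (D.R - r) ^ D.β

theorem U_eq_lin {a r : ℝ} (hr : r < D.R) : D.U a r = D.lin a r * (D.R - r) ^ D.β :=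
  (div_mul_cancel₀ _ (Real.rpow_pos_of_pos (sub_pos.2 hr) _).ne').symm

theorem Y_log_eq_lin {a r : ℝ} (hr : r < D.R) :
    D.Y a (-Real.log (D.R - r)) = D.lin a r * (D.R - r) ^ D.gap := by
  rw [D.Y_log hr, D.U_eq_lin hr, mul_assoc, ← Real.rpow_add (sub_pos.2 hr), gap, add_comm D.β]

theorem tendsto_sub_radius : Tendsto (fun r => D.R - r) (𝓝[<] D.R) (𝓝[>] 0) := by
  refine tendsto_nhdsWithin_iff.2 ⟨?_, ?_⟩
  · have : Tendsto (fun r => D.R - r) (𝓝 D.R) (𝓝 (D.R - D.R)) :=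
      (continuous_const.sub continuous_id).tendsto _
    rw [sub_self] at this
    exact this.mono_left nhdsWithin_le_nhds
  · filter_upwards [self_mem_nhdsWithin] with r hr using mem_Ioi.2 (sub_pos.2 (mem_Iio.1 hr))

theorem tendsto_neg_log : Tendsto (fun r => -Real.log (D.R - r)) (𝓝[<] D.R) atTop :=
  tendsto_neg_atBot_atTop.comp (Real.tendsto_log_nhdsGT_zero.comp D.tendsto_sub_radius)

/-- A global radial profile either has a linear boundary limit or is larger than that rate. -/
theorem linear_or_atTop {a : ℝ} (ha : 0 < a) (hlife : D.life a = D.R) :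
    (∃ c, 0 < c ∧ Tendsto (D.lin a) (𝓝[<] D.R) (𝓝 c)) ∨
      Tendsto (D.lin a) (𝓝[<] D.R) atTop := by
  obtain ⟨r₀, c₀, Q, hr₀, hr₀R, hc₀, hQ, hlim, hmono⟩ := D.exists_comparator
  have hm := hmono a ha hlife
  have hmem : Ioo r₀ D.R ∈ 𝓝[<] D.R := Ioo_mem_nhdsLT hr₀R
  have hne : (Ioo r₀ D.R).Nonempty := nonempty_Ioo.2 hr₀R
  have heq : (fun r => D.U a r * Q r * (Q r * (D.R - r) ^ D.β)⁻¹) =ᶠ[𝓝[<] D.R] D.lin a := by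
    filter_upwards [hmem] with r hr
    have h1 := (hQ r hr).ne'
    have h2 := (Real.rpow_pos_of_pos (sub_pos.2 hr.2) D.β).ne'
    unfold lin
    field_simp
  have hinv := hlim.inv₀ hc₀.ne'
  by_cases hb : BddAbove ((fun r => D.U a r * Q r) '' Ioo r₀ D.R)
  · left
    have ht := hm.tendsto_nhdsWithin_Ioo_left hne hb
    refine ⟨_, ?_, (ht.mul hinv).congr' heq⟩
    obtain ⟨r, hr⟩ := hne
    have : D.U a r * Q r ≤ sSup ((fun r => D.U a r * Q r) '' Ioo r₀ D.R) :=
      le_csSup hb (mem_image_of_mem _ hr)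
    have h2 := D.U_pos ha (r := r) ⟨hr₀.trans hr.1.le, hlife ▸ hr.2⟩
    have := mul_pos h2 (hQ r hr)
    have h3 := inv_pos.2 hc₀
    exact mul_pos (by linarith) h3
  · right
    have ht : Tendsto (fun r => D.U a r * Q r) (𝓝[<] D.R) atTop := by
      refine tendsto_atTop.2 fun M => ?_
      rw [not_bddAbove_iff] at hb
      obtain ⟨-, ⟨s, hs, rfl⟩, hM⟩ := hb M
      filter_upwards [Ioo_mem_nhdsLT hs.2] with r hr
      exact hM.le.trans (hm hs ⟨hs.1.trans hr.1, hr.2⟩ hr.1.le)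
    exact (ht.atTop_mul_pos (inv_pos.2 hc₀) hinv).congr' heq

/-- The supremum of the central values of the global radial solutions. -/
def uStar : ℝ := sSup {a | 0 < a ∧ D.life a = D.R}

/-- Since U / ψ increases, the central value is controlled by U at R/2, where the Keller–Osserman
bound is uniform in a. -/
theorem bddAbove_global : BddAbove {a | 0 < a ∧ D.life a = D.R} := by
  have hR := D.radius_pos
  have hmem : D.R / 2 ∈ Ioo 0 D.R := ⟨by linarith, by linarith⟩
  obtain ⟨C, hC⟩ := D.exists_bound_of_global hmem
  refine ⟨C / D.weight (D.R / 2) * D.weight 0, fun a ⟨ha, hlife⟩ => ?_⟩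
  have h1 := D.U_div_weight_mono (a := a) le_rfl hmem.1.le ⟨hmem.1.le, hlife ▸ hmem.2⟩
  rw [D.U_zero ha.le, div_le_iff₀ (D.weight_pos D.zero_mem_Ico)] at h1
  have h2 := D.weight_pos (Ioo_subset_Ico_self hmem)
  have h3 := D.weight_pos D.zero_mem_Ico
  have h4 := hC a ha hlife
  refine h1.trans ?_
  gcongr

theorem exists_global : ∃ a, 0 < a ∧ D.life a = D.R := by
  have hA := D.A_pos
  have hRα : 0 < D.R ^ D.α := Real.rpow_pos_of_pos D.radius_pos _
  have h0 : 0 < D.A / (2 * D.R ^ D.α) := by positivity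
  refine ⟨_, h0, D.life_of_small h0 ?_⟩
  rw [div_mul_eq_mul_div, div_lt_iff₀ (by positivity)]
  have := mul_pos hA hRα
  linarith

theorem uStar_pos : 0 < D.uStar := by
  obtain ⟨a, ha⟩ := D.exists_global
  exact ha.1.trans_le (le_csSup D.bddAbove_global ha)

theorem life_of_lt_uStar {a : ℝ} (h : a < D.uStar) : D.life a = D.R := by
  obtain ⟨b, ⟨-, hb⟩, hab⟩ := exists_lt_of_lt_csSup D.exists_global h
  exact (D.life_le a).antisymm (hb ▸ D.life_anti hab.le)

/-- If U_{u*} died at a radius ρ < R, the global profiles with a < u* would still be uniformly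
bounded at ρ. The Lipschitz bound then has a step η independent of a, and a central value within η
below u* carries finiteness at ρ over to u*. -/
theorem life_uStar : D.life D.uStar = D.R := by
  by_contra hne
  have hlt : D.life D.uStar < D.R := lt_of_le_of_ne (D.life_le _) hne
  have h0 := D.life_pos D.uStar
  obtain ⟨C, hC⟩ := D.exists_bound_of_global ⟨h0, hlt⟩
  obtain ⟨K, η, -, hη, h⟩ := D.U_lipschitz (C := C) ⟨h0.le, hlt⟩
  have hs := D.uStar_pos
  have ha0 : 0 < max (D.uStar - η) (D.uStar / 2) := lt_max_of_lt_right (by linarith)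
  have ha : max (D.uStar - η) (D.uStar / 2) < D.uStar := max_lt (by linarith) (by linarith)
  have hlife := D.life_of_lt_uStar ha
  exact lt_irrefl _ (h _ D.uStar ha0 ha.le
    (by linarith [le_max_left (D.uStar - η) (D.uStar / 2)]) (hlife ▸ hlt) (hC _ ha0 hlife)).1

theorem life_of_le_uStar {a : ℝ} (h : a ≤ D.uStar) : D.life a = D.R := by
  rcases h.lt_or_eq with h | rfl
  · exact D.life_of_lt_uStar h
  · exact D.life_uStar

theorem life_lt_of_uStar_lt {a : ℝ} (h : D.uStar < a) : D.life a < D.R :=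
  lt_of_le_of_ne (D.life_le a) fun h' =>
    h.not_ge (le_csSup D.bddAbove_global ⟨D.uStar_pos.trans h, h'⟩)

/-- Radial profiles with central values slightly above the threshold approximate the threshold
profile. -/
theorem exists_gt_uStar {r e : ℝ} (hr : r ∈ Ico 0 D.R) (he : 0 < e) :
    ∃ a, D.uStar < a ∧ r < D.life a ∧ D.U a r ≤ D.U D.uStar r + e := by
  obtain ⟨K, η, hK, hη, h⟩ := D.U_lipschitz (C := D.U D.uStar r) hr
  have hm : 0 < min η (e / K) := lt_min hη (by positivity)
  obtain ⟨h1, h2⟩ := h D.uStar (D.uStar + min η (e / K)) D.uStar_pos (by linarith)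
    (by linarith [min_le_left η (e / K)]) (D.life_uStar ▸ hr.2) le_rfl
  refine ⟨_, by linarith, h1, h2.trans ?_⟩
  have : K * min η (e / K) ≤ K * (e / K) := by gcongr; exact min_le_right _ _
  rw [mul_div_cancel₀ _ hK.ne'] at this
  rw [add_sub_cancel_left]
  linarith

theorem trans_zero (t : ℝ) : D.trans 0 t = D.A := by
  simp [trans]

theorem exists_le_Y {a r : ℝ} (hlife : D.life a < D.R) (hr : r < D.life a) :
    ∃ s, r < s ∧ s < D.life a ∧ D.A ≤ D.Y a (-Real.log (D.R - s)) := by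
  have hd : 0 < (D.R - D.life a) ^ D.α := Real.rpow_pos_of_pos (sub_pos.2 hlife) _
  have hev := ((D.tendsto_U_atTop hlife).eventually_ge_atTop
    (D.A / (D.R - D.life a) ^ D.α)).and (Ioo_mem_nhdsLT hr)
  obtain ⟨s, hs, h1, h2⟩ := hev.exists
  refine ⟨s, h1, h2, ?_⟩
  rw [D.Y_log (h2.trans hlife)]
  have hA := D.A_pos
  have hle : (D.R - D.life a) ^ D.α ≤ (D.R - s) ^ D.α :=
    Real.rpow_le_rpow (sub_pos.2 hlife).le (by linarith) D.α_pos.le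
  calc D.A = D.A / (D.R - D.life a) ^ D.α * (D.R - D.life a) ^ D.α :=
        (div_mul_cancel₀ _ hd.ne').symm
    _ ≤ D.U a s * (D.R - s) ^ D.α := by
        have : 0 < D.A / (D.R - D.life a) ^ D.α := by positivity
        exact mul_le_mul hs hle hd.le (this.le.trans hs)

/-- Dropping the 1 in 1 + ε e^(κ t), with κ equal to `rate`, leaves the pure linear regime A
ε^(-`power`) (R - r)^gap. -/
theorem trans_le_of_lin {a r ε : ℝ} (hr : r < D.R) (hε : 0 < ε)
    (h : D.A * ε ^ (-D.power) ≤ D.lin a r) :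
    D.trans ε (-Real.log (D.R - r)) ≤ D.Y a (-Real.log (D.R - r)) := by
  have hd := sub_pos.2 hr
  rw [D.Y_log_eq_lin hr, trans]
  have hexp : Real.exp (D.rate * -Real.log (D.R - r)) = (D.R - r) ^ (-D.rate) := by
    rw [Real.rpow_def_of_pos hd]; ring_nf
  have hx : 0 < (D.R - r) ^ (-D.rate) := Real.rpow_pos_of_pos hd _
  have h1 : (1 + ε * (D.R - r) ^ (-D.rate)) ^ (-D.power)
      ≤ (ε * (D.R - r) ^ (-D.rate)) ^ (-D.power) :=
    Real.rpow_le_rpow_of_nonpos (by positivity) (by linarith) (by linarith [D.power_pos])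
  rw [Real.mul_rpow hε.le hx.le, ← Real.rpow_mul hd.le, neg_mul_neg, mul_comm D.rate,
    D.power_mul_rate] at h1
  rw [hexp]
  have hA := D.A_pos
  calc _ ≤ D.A * (ε ^ (-D.power) * (D.R - r) ^ D.gap) := by gcongr
    _ = D.A * ε ^ (-D.power) * (D.R - r) ^ D.gap := by ring
    _ ≤ _ := by gcongr

theorem tendsto_trans (t : ℝ) : Tendsto (fun ε => D.trans ε t) (𝓝[>] 0) (𝓝 D.A) := by
  have hc : ContinuousAt (fun ε => D.trans ε t) 0 := by
    unfold trans
    refine continuousAt_const.mul (ContinuousAt.rpow_const (by fun_prop) (Or.inl (by simp)))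
  have := hc.tendsto
  rw [D.trans_zero] at this
  exact this.mono_left nhdsWithin_le_nhds

/-- The threshold solution and the global solutions without linear boundary limit are bounded below
by the singular rate. -/
theorem exists_singular_lower_bound : ∃ t₁ K : ℝ, ∀ a, 0 < a → D.life a = D.R →
    (a = D.uStar ∨ Tendsto (D.lin a) (𝓝[<] D.R) atTop) → ∀ t, t₁ ≤ t →
      D.A - K * Real.exp (-((D.α + 1 / 2) * t)) ≤ D.Y a t := by
  obtain ⟨t₁, K, ht₁, -, h⟩ := D.exists_lower_bound
  refine ⟨t₁, K, fun a ha hlife hcase t ht => ?_⟩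
  have htR : Real.exp (-t) < D.R := (Real.exp_le_exp.2 (by linarith)).trans_lt ht₁
  have hrm := D.radius_mem_of_global hlife htR
  have hlog : -Real.log (D.R - (D.R - Real.exp (-t))) = t := by
    rw [sub_sub_cancel, Real.log_exp, neg_neg]
  rcases hcase with rfl | hcase
  -- For a slightly above u* the profile blows up and so reaches the level A at some later s; the
  -- lower bound with ε = 0 applies up to s, and a then decreases to u*.
  · refine le_of_forall_pos_le_add fun e he => ?_
    have hx := Real.exp_pos (D.α * t)
    rw [hlife] at hrm
    obtain ⟨a, ha, hra, hU⟩ := D.exists_gt_uStar (Ioo_subset_Ico_self hrm) (mul_pos he hx)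
    have ha' := D.life_lt_of_uStar_lt ha
    obtain ⟨s, hrs, hs, hY⟩ := D.exists_le_Y ha' hra
    have hsR := hs.trans ha'
    have hts : t ≤ -Real.log (D.R - s) := by
      rw [← hlog]
      exact neg_le_neg (Real.log_le_log (sub_pos.2 hsR) (by linarith))
    have := h a _ 0 (D.uStar_pos.trans ha) (by rw [D.exp_neg_neg_log hsR]; linarith) le_rfl
      zero_le_one (by rw [D.trans_zero]; exact hY) t ⟨ht, hts⟩
    rw [D.trans_zero] at this
    refine this.trans ?_
    unfold Y
    calc _ ≤ (D.U D.uStar (D.R - Real.exp (-t)) + e * Real.exp (D.α * t)) *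
          Real.exp (-(D.α * t)) := by gcongr
      _ = _ := by rw [add_mul, mul_assoc e, ← Real.exp_add, add_neg_cancel, Real.exp_zero, mul_one]
  -- When U dominates the linear rate it overtakes each of the subsolutions near the boundary;
  -- afterwards ε tends to 0.
  · have key : ∀ ε ∈ Ioc (0 : ℝ) 1,
        D.trans ε t - K * Real.exp (-((D.α + 1 / 2) * t)) ≤ D.Y a t := by
      intro ε hε
      obtain ⟨r, hr, hrR, hlog'⟩ := ((hcase.eventually_ge_atTop (D.A * ε ^ (-D.power))).and
        ((eventually_mem_nhdsWithin (s := Iio D.R)).and (D.tendsto_neg_log.eventually_ge_atTop t))).exists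
      exact h a _ ε ha (by rw [D.exp_neg_neg_log hrR, hlife, sub_sub_cancel]; exact hrR) hε.1.le hε.2
        (D.trans_le_of_lin hrR hε.1 hr) t ⟨ht, hlog'⟩
    refine le_of_tendsto ((D.tendsto_trans t).sub_const _) ?_
    filter_upwards [Ioc_mem_nhdsGT zero_lt_one] with ε hε using key ε hε

theorem tendsto_Y {a : ℝ} (ha : 0 < a) (hlife : D.life a = D.R)
    (h : a = D.uStar ∨ Tendsto (D.lin a) (𝓝[<] D.R) atTop) : Tendsto (D.Y a) atTop (𝓝 D.A) := by
  obtain ⟨t₁, K, hK⟩ := D.exists_singular_lower_bound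
  have hlow : Tendsto (fun t => D.A - K * Real.exp (-((D.α + 1 / 2) * t))) atTop (𝓝 D.A) := by
    have h1 : Tendsto (fun t => (D.α + 1 / 2) * t) atTop atTop :=
      tendsto_id.const_mul_atTop (by linarith [D.α_pos])
    simpa using ((tendsto_exp_neg.comp h1).const_mul K).const_sub D.A
  refine tendsto_order.2 ⟨fun m hm => ?_, fun M hM => ?_⟩
  · filter_upwards [hlow.eventually_const_lt hm, eventually_ge_atTop t₁] with t h1 h2
    exact h1.trans_le (hK a ha hlife h t h2)
  · filter_upwards [D.eventually_Y_le ha hlife (M := (D.A + M) / 2) (by linarith)] with t ht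
    linarith

theorem tendsto_U_singular {a : ℝ} (h : Tendsto (D.Y a) atTop (𝓝 D.A)) :
    Tendsto (fun r => D.U a r / (D.R - r) ^ (-D.α)) (𝓝[<] D.R) (𝓝 D.A) := by
  refine (h.comp D.tendsto_neg_log).congr' ?_
  filter_upwards [self_mem_nhdsWithin] with r hr
  rw [Function.comp_apply, D.Y_log hr, Real.rpow_neg (sub_pos.2 hr).le, div_inv_eq_mul]

theorem tendsto_Y_uStar : Tendsto (D.Y D.uStar) atTop (𝓝 D.A) :=
  D.tendsto_Y D.uStar_pos D.life_uStar (Or.inl rfl)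

theorem tendsto_rpow_gap : Tendsto (fun r => (D.R - r) ^ D.gap) (𝓝[<] D.R) (𝓝 0) := by
  have h : Tendsto (fun x : ℝ => x ^ D.gap) (𝓝 0) (𝓝 (0 ^ D.gap)) :=
    (Real.continuousAt_rpow_const 0 _ (Or.inr D.gap_pos.le)).tendsto
  rw [Real.zero_rpow D.gap_pos.ne'] at h
  exact (h.mono_left nhdsWithin_le_nhds).comp D.tendsto_sub_radius

/-- A linear limit would force Y → 0, because α + β₋ > 0, whereas Y → A > 0. -/
theorem not_tendsto_lin_uStar (c : ℝ) : ¬ Tendsto (D.lin D.uStar) (𝓝[<] D.R) (𝓝 c) := by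
  intro h
  have h1 : Tendsto (fun r => D.lin D.uStar r * (D.R - r) ^ D.gap) (𝓝[<] D.R) (𝓝 D.A) := by
    refine (D.tendsto_Y_uStar.comp D.tendsto_neg_log).congr' ?_
    filter_upwards [self_mem_nhdsWithin] with r hr using D.Y_log_eq_lin hr
  have h2 := tendsto_nhds_unique h1 (h.mul D.tendsto_rpow_gap)
  rw [mul_zero] at h2
  exact D.A_pos.ne' h2

theorem tendsto_lin_uStar : Tendsto (D.lin D.uStar) (𝓝[<] D.R) atTop :=
  (D.linear_or_atTop D.uStar_pos D.life_uStar).resolve_left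
    fun ⟨c, _, hc⟩ => D.not_tendsto_lin_uStar c hc

/-- Below the threshold the boundary behavior is linear. -/
theorem exists_tendsto_lin {a : ℝ} (ha : 0 < a) (h : a < D.uStar) :
    ∃ c, 0 < c ∧ Tendsto (D.lin a) (𝓝[<] D.R) (𝓝 c) := by
  have hlife := D.life_of_lt_uStar h
  refine (D.linear_or_atTop ha hlife).resolve_right fun htop => ?_
  have h1 := D.tendsto_Y ha hlife (Or.inr htop)
  have h2 := D.tendsto_Y_uStar.const_mul (a / D.uStar)
  -- Both profiles would have the same limit A, although U_a ≤ (a / u*) U_{u*} with a / u* < 1.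
  have hle : D.A ≤ a / D.uStar * D.A := by
    refine le_of_tendsto_of_tendsto h1 h2 ?_
    filter_upwards [tendsto_exp_neg.eventually_lt_const D.radius_pos] with t ht
    have := D.U_ratio ha h.le (Ioo_subset_Ico_self (D.radius_mem_of_global D.life_uStar ht))
    unfold Y
    rw [← mul_assoc]
    gcongr
  have hlt : a / D.uStar < 1 := (div_lt_one D.uStar_pos).2 h
  nlinarith [D.A_pos]

theorem lin_limit_le {a a' c c' : ℝ} (ha : 0 < a) (h : a ≤ a') (h' : D.life a' = D.R)
    (hc : Tendsto (D.lin a) (𝓝[<] D.R) (𝓝 c)) (hc' : Tendsto (D.lin a') (𝓝[<] D.R) (𝓝 c')) :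
    c ≤ a / a' * c' := by
  refine le_of_tendsto_of_tendsto hc (hc'.const_mul _) ?_
  filter_upwards [Ioo_mem_nhdsLT D.radius_pos] with r hr
  have := D.U_ratio ha h (r := r) ⟨hr.1.le, h' ▸ hr.2⟩
  have hd := Real.rpow_pos_of_pos (sub_pos.2 hr.2) D.β
  unfold lin
  rw [← mul_div_assoc]
  gcongr

/-- The linear boundary limit determines the central value. -/
theorem eq_of_lin_limit {a a' c : ℝ} (ha : 0 < a) (ha' : 0 < a') (h : D.life a = D.R)
    (h' : D.life a' = D.R) (hc0 : 0 < c) (hc : Tendsto (D.lin a) (𝓝[<] D.R) (𝓝 c))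
    (hc' : Tendsto (D.lin a') (𝓝[<] D.R) (𝓝 c)) : a = a' := by
  have aux : ∀ {x y : ℝ}, 0 < x → D.life y = D.R → Tendsto (D.lin x) (𝓝[<] D.R) (𝓝 c) →
      Tendsto (D.lin y) (𝓝[<] D.R) (𝓝 c) → ¬ x < y := by
    intro x y hx hy hcx hcy hlt
    have h1 := D.lin_limit_le hx hlt.le hy hcx hcy
    have h2 : x / y < 1 := (div_lt_one (hx.trans hlt)).2 hlt
    nlinarith
  exact le_antisymm (not_lt.1 (aux ha' h hc' hc)) (not_lt.1 (aux ha h' hc hc'))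

theorem U_lower_semicontinuous {r e : ℝ} (hr : r ∈ Ico 0 D.R) (he : 0 < e) :
    ∃ a, 0 < a ∧ a < D.uStar ∧ D.U D.uStar r ≤ D.U a r + e := by
  obtain ⟨K, η, hK, hη, h⟩ := D.U_lipschitz (C := D.U D.uStar r) hr
  have hs := D.uStar_pos
  set d := min (min η (e / K)) (D.uStar / 2) with hd
  have hd0 : 0 < d := lt_min (lt_min hη (by positivity)) (by linarith)
  have hdη : d ≤ η := (min_le_left _ _).trans (min_le_left _ _)
  have hde : d ≤ e / K := (min_le_left _ _).trans (min_le_right _ _)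
  have hds : d ≤ D.uStar / 2 := min_le_right _ _
  have ha0 : 0 < D.uStar - d := by linarith
  have ha : D.uStar - d < D.uStar := by linarith
  have hrs : r ∈ Ico 0 (D.life D.uStar) := D.life_uStar.symm ▸ hr
  obtain ⟨-, h2⟩ := h (D.uStar - d) D.uStar ha0 ha.le (by linarith)
    (D.life_of_lt_uStar ha ▸ hr.2) (D.U_mono ha0 ha.le hrs)
  refine ⟨_, ha0, ha, h2.trans ?_⟩
  have : K * d ≤ K * (e / K) := by gcongr
  rw [mul_div_cancel₀ _ hK.ne'] at this
  rw [sub_sub_cancel]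
  linarith

/-- If all limits were at most y, monotonicity of U Q would give U_a Q ≤ c₀ y on a fixed interval
for all a < u*, hence also for u*, whose linear quotient is unbounded. -/
theorem exists_lt_lin_limit (y : ℝ) : ∃ a, 0 < a ∧ a < D.uStar ∧
    ∀ c, Tendsto (D.lin a) (𝓝[<] D.R) (𝓝 c) → y < c := by
  by_contra! hcon
  obtain ⟨r₀, c₀, Q, hr₀, hr₀R, hc₀, hQ, hlim, hmono⟩ := D.exists_comparator
  have hbd : ∀ r ∈ Ioo r₀ D.R, D.U D.uStar r * Q r ≤ y * c₀ := by
    intro r hr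
    have hQr := hQ r hr
    refine le_of_forall_pos_le_add fun e he => ?_
    obtain ⟨a, ha, hau, hU⟩ := D.U_lower_semicontinuous (e := e / Q r) ⟨hr₀.trans hr.1.le, hr.2⟩
      (by positivity)
    obtain ⟨c, hc, hcy⟩ := hcon a ha hau
    have hle : D.U a r * Q r ≤ c * c₀ := by
      refine ge_of_tendsto (hc.mul hlim) ?_
      filter_upwards [Ioo_mem_nhdsLT hr.2] with s hs
      have h1 : D.U a r * Q r ≤ D.U a s * Q s :=
        hmono a ha (D.life_of_lt_uStar hau) hr ⟨hr.1.trans hs.1, hs.2⟩ hs.1.le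
      rw [D.U_eq_lin hs.2] at h1
      linarith
    calc D.U D.uStar r * Q r ≤ (D.U a r + e / Q r) * Q r := by gcongr
      _ = D.U a r * Q r + e := by field_simp
      _ ≤ y * c₀ + e := by
        have : c * c₀ ≤ y * c₀ := by gcongr
        linarith
  have htop : Tendsto (fun r => D.lin D.uStar r * (Q r * (D.R - r) ^ D.β)) (𝓝[<] D.R) atTop :=
    D.tendsto_lin_uStar.atTop_mul_pos hc₀ hlim
  obtain ⟨r, h1, h2⟩ := ((htop.eventually_gt_atTop (y * c₀)).and (Ioo_mem_nhdsLT hr₀R)).exists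
  have h3 := hbd r h2
  rw [D.U_eq_lin h2.2] at h3
  linarith

/-- Every positive number is the linear boundary limit of a profile below the threshold. -/
theorem exists_lin_limit_eq {y : ℝ} (hy : 0 < y) :
    ∃ a, 0 < a ∧ a < D.uStar ∧ Tendsto (D.lin a) (𝓝[<] D.R) (𝓝 y) := by
  have hex : ∀ a ∈ Ioo 0 D.uStar, ∃ c, 0 < c ∧ Tendsto (D.lin a) (𝓝[<] D.R) (𝓝 c) :=
    fun a ha => D.exists_tendsto_lin ha.1 ha.2
  choose! c hc0 hc using hex
  have hs := D.uStar_pos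
  have hconv : ConvexOn ℝ (Ioo 0 D.uStar) c := by
    refine ⟨convex_Ioo _ _, fun a ha a' ha' l m hl hm hlm => ?_⟩
    have hmem : l • a + m • a' ∈ Ioo 0 D.uStar := convex_Ioo _ _ ha ha' hl hm hlm
    refine le_of_tendsto_of_tendsto (hc _ hmem)
      (((hc a ha).const_mul l).add ((hc a' ha').const_mul m)) ?_
    filter_upwards [Ioo_mem_nhdsLT D.radius_pos] with r hr
    have := D.U_convex ha.1 ha'.1 hl hm hlm (r := r)
      ⟨hr.1.le, (D.life_of_lt_uStar ha.2).symm ▸ hr.2⟩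
      ⟨hr.1.le, (D.life_of_lt_uStar ha'.2).symm ▸ hr.2⟩
    have hd := Real.rpow_pos_of_pos (sub_pos.2 hr.2) D.β
    simp only [lin, smul_eq_mul]
    rw [← mul_div_assoc, ← mul_div_assoc, ← add_div]
    gcongr
  have hcont : ContinuousOn c (Ioo 0 D.uStar) := hconv.continuousOn isOpen_Ioo
  obtain ⟨a₂, h20, h2s, h2⟩ := D.exists_lt_lin_limit y
  have hm2 : a₂ ∈ Ioo 0 D.uStar := ⟨h20, h2s⟩
  have hy2 := h2 _ (hc _ hm2)
  have hc2 := hc0 _ hm2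
  -- By the ratio bound, scaling the central value a₂ by y / c(a₂) < 1 brings the limit down to at
  -- most y; this is the lower end for the intermediate value theorem.
  have h1lt : a₂ * (y / c a₂) < a₂ := mul_lt_of_lt_one_right h20 ((div_lt_one hc2).2 hy2)
  have hm1 : a₂ * (y / c a₂) ∈ Ioo 0 D.uStar := ⟨by positivity, h1lt.trans h2s⟩
  have hy1 : c (a₂ * (y / c a₂)) ≤ y := by
    have := D.lin_limit_le hm1.1 h1lt.le (D.life_of_lt_uStar h2s) (hc _ hm1) (hc _ hm2)
    rwa [mul_div_cancel_left₀ _ h20.ne', div_mul_cancel₀ _ hc2.ne'] at this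
  obtain ⟨a, ha, rfl⟩ := isPreconnected_Ioo.intermediate_value hm1 hm2 hcont ⟨hy1, hy2.le⟩
  exact ⟨a, ha.1, ha.2, hc a ha⟩

end Params

end

/-! ### Comparison of the threshold solution with arbitrary solutions. -/

section

namespace Params

variable (D : Params)

theorem isRadialSolution_global {a : ℝ} (ha : 0 < a) (h : D.life a = D.R) :
    IsRadialSolution D.R D.μ D.p D.R (D.u a) := by
  have := D.isRadialSolution_u ha
  rwa [h] at this

/-- A radial solution in the whole ball is the constructed one with the same central value. -/
theorem eqOn_of_global {v : EuclideanSpace ℝ (Fin D.N) → ℝ}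
    (hv : IsRadialSolution D.R D.μ D.p D.R v) :
    0 < v 0 ∧ D.life (v 0) = D.R ∧ EqOn v (D.u (v 0)) (ball 0 D.R) := by
  obtain ⟨h1, h2⟩ := D.radial_unique D.radius_pos le_rfl hv rfl
  exact ⟨hv.1.pos 0 (mem_ball_self D.radius_pos), (D.life_le _).antisymm h1, h2⟩

theorem eventually_mem_ball {ρ : ℝ} (hρ : 0 < ρ) :
    ∀ᶠ x in toSphere D.N ρ, x ∈ ball (0 : EuclideanSpace ℝ (Fin D.N)) ρ := by
  filter_upwards [preimage_mem_comap (Ioo_mem_nhdsLT hρ)] with x hx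
  simpa using hx.2

theorem hasLinearBoundaryLimit_u {a c : ℝ} :
    HasLinearBoundaryLimit D.R D.μ (D.u a) c ↔ Tendsto (D.lin a) (𝓝[<] D.R) (𝓝 c) :=
  ⟨fun h => D.tendsto_of_tendsto_comp_norm D.radius_pos h, fun h => D.tendsto_comp_norm h⟩

theorem hasLinearBoundaryLimit_congr {u v : EuclideanSpace ℝ (Fin D.N) → ℝ} {c : ℝ}
    (h : EqOn u v (ball 0 D.R)) :
    HasLinearBoundaryLimit D.R D.μ u c ↔ HasLinearBoundaryLimit D.R D.μ v c := by
  refine tendsto_congr' ?_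
  filter_upwards [D.eventually_mem_ball D.radius_pos] with x hx
  rw [h hx]

theorem hasSingularBoundaryLimit_uStar :
    HasSingularBoundaryLimit D.R D.μ D.p (D.u D.uStar) :=
  D.tendsto_comp_norm (D.tendsto_U_singular D.tendsto_Y_uStar)

/-- A solution in the whole ball lies below every radial solution that blows up inside. -/
theorem le_of_uStar_lt {v : EuclideanSpace ℝ (Fin D.N) → ℝ}
    (hv : IsPositiveSolutionOn D.μ D.p (ball 0 D.R) (ball 0 D.R) v) {a : ℝ} (ha : D.uStar < a) :
    ∀ x ∈ ball (0 : EuclideanSpace ℝ (Fin D.N)) (D.life a), v x ≤ D.u a x := by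
  have hlt := D.life_lt_of_uStar_lt ha
  have ha0 := D.uStar_pos.trans ha
  have hsub : closedBall (0 : EuclideanSpace ℝ (Fin D.N)) (D.life a) ⊆ ball 0 D.R :=
    closedBall_subset_ball hlt
  obtain ⟨C, hC⟩ := ((isCompact_closedBall _ _).bddAbove_image (hv.contDiffOn.continuousOn.mono hsub))
  -- The solution v is bounded on the closed smaller ball while the radial one is infinite on its
  -- boundary, so radiality of v is not needed.
  refine (hv.mono (ball_subset_ball hlt.le)).le_of_boundary D.one_lt (D.isRadialSolution_u ha0).1
    fun ε hε => ?_
  filter_upwards [(D.tendsto_comp_norm (D.tendsto_U_atTop hlt)).eventually_ge_atTop C,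
    D.eventually_mem_ball (D.life_pos a)] with x h1 h2
  have h3 : v x ≤ C := hC (mem_image_of_mem _ (ball_subset_closedBall h2))
  have h4 := (D.isRadialSolution_u ha0).1.pos x h2
  have h5 : D.U a ‖x‖ = D.u a x := rfl
  nlinarith

/-- The threshold solution is maximal. -/
theorem le_u_uStar {v : EuclideanSpace ℝ (Fin D.N) → ℝ}
    (hv : IsPositiveSolutionOn D.μ D.p (ball 0 D.R) (ball 0 D.R) v) :
    ∀ x ∈ ball (0 : EuclideanSpace ℝ (Fin D.N)) D.R, v x ≤ D.u D.uStar x := by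
  intro x hx
  refine le_of_forall_pos_le_add fun e he => ?_
  obtain ⟨a, ha, hxa, hU⟩ := D.exists_gt_uStar (r := ‖x‖) ⟨norm_nonneg x, by simpa using hx⟩ he
  exact (D.le_of_uStar_lt hv ha x (by simpa using hxa)).trans hU

/-- A solution with the singular boundary behavior is not below the threshold solution. -/
theorem u_uStar_le {v : EuclideanSpace ℝ (Fin D.N) → ℝ}
    (hv : IsPositiveSolutionOn D.μ D.p (ball 0 D.R) (ball 0 D.R) v)
    (hlim : HasSingularBoundaryLimit D.R D.μ D.p v) :
    ∀ x ∈ ball (0 : EuclideanSpace ℝ (Fin D.N)) D.R, D.u D.uStar x ≤ v x := by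
  have hu := D.isRadialSolution_global D.uStar_pos D.life_uStar
  refine hu.1.le_of_boundary D.one_lt hv fun ε hε => ?_
  have hA := D.A_pos
  have h1 : Tendsto _ _ (𝓝 D.A) := D.hasSingularBoundaryLimit_uStar
  have h2 : Tendsto _ _ (𝓝 ((1 + ε) * D.A)) := Tendsto.const_mul (1 + ε) hlim
  -- Both solutions have the same positive limit A after division by the singular rate, so their
  -- ratio is eventually below 1 + ε.
  filter_upwards [h1.eventually_lt h2 (by nlinarith), D.eventually_mem_ball D.radius_pos]
    with x hx hxb
  have hd : 0 < (D.R - ‖x‖) ^ (-(2 / (D.p - 1))) :=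
    Real.rpow_pos_of_pos (sub_pos.2 (by simpa using hxb)) _
  rw [← mul_div_assoc, div_lt_div_iff_of_pos_right hd] at hx
  exact hx.le

end Params

end

end HardyProblem

end

/-! ### Assembly of the three assertions. -/

theorem theoremB (N : ℕ) (hN : 1 ≤ N) (R p μ : ℝ) (hR : 0 < R) (hp : 1 < p)
    (hμ_lower : -HardyProblem.muStar p < μ) (hμ_upper : μ < 1 / 4) (hμ_ne : μ ≠ 0) :
    ∃ uStar : ℝ, 0 < uStar ∧
      -- (i) existence and uniqueness on the whole ball for central values up to the threshold
      (∀ a : ℝ, 0 < a → a ≤ uStar →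
        ∃ u : EuclideanSpace ℝ (Fin N) → ℝ,
          HardyProblem.IsRadialSolution R μ p R u ∧ u 0 = a ∧
          ∀ v : EuclideanSpace ℝ (Fin N) → ℝ,
            HardyProblem.IsRadialSolution R μ p R v → v 0 = a → EqOn v u (ball 0 R)) ∧
      -- (i) blow-up at some radius smaller than `R` for central values above the threshold
      (∀ a : ℝ, uStar < a →
        ∃ ρ : ℝ, 0 < ρ ∧ ρ < R ∧
          ∃ u : EuclideanSpace ℝ (Fin N) → ℝ,
            HardyProblem.IsRadialSolution R μ p ρ u ∧ u 0 = a ∧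
            Tendsto u (HardyProblem.toSphere N ρ) atTop ∧
            ∀ (σ : ℝ) (v : EuclideanSpace ℝ (Fin N) → ℝ), 0 < σ → σ ≤ R →
              HardyProblem.IsRadialSolution R μ p σ v → v 0 = a →
                σ ≤ ρ ∧ EqOn v u (ball 0 σ)) ∧
      -- (ii) below the threshold the linear regime prevails
      (∀ u : EuclideanSpace ℝ (Fin N) → ℝ,
        HardyProblem.IsRadialSolution R μ p R u → u 0 < uStar →
          ∃ c : ℝ, 0 < c ∧ HardyProblem.HasLinearBoundaryLimit R μ u c) ∧
      -- (ii) vice versa, every positive limit is attained by exactly one radial solution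
      (∀ c : ℝ, 0 < c →
        ∃ u : EuclideanSpace ℝ (Fin N) → ℝ,
          HardyProblem.IsRadialSolution R μ p R u ∧ u 0 < uStar ∧
          HardyProblem.HasLinearBoundaryLimit R μ u c ∧
          ∀ v : EuclideanSpace ℝ (Fin N) → ℝ,
            HardyProblem.IsRadialSolution R μ p R v →
              HardyProblem.HasLinearBoundaryLimit R μ v c → EqOn v u (ball 0 R)) ∧
      -- (iii) the solution at the threshold: boundary behavior, maximality, uniqueness
      (∀ u : EuclideanSpace ℝ (Fin N) → ℝ,
        HardyProblem.IsRadialSolution R μ p R u → u 0 = uStar →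
          HardyProblem.HasSingularBoundaryLimit R μ p u ∧
          (∀ v : EuclideanSpace ℝ (Fin N) → ℝ,
            HardyProblem.IsPositiveSolutionOn μ p (ball 0 R) (ball 0 R) v →
              ∀ x ∈ ball (0 : EuclideanSpace ℝ (Fin N)) R, v x ≤ u x) ∧
          (∀ v : EuclideanSpace ℝ (Fin N) → ℝ,
            HardyProblem.IsPositiveSolutionOn μ p (ball 0 R) (ball 0 R) v →
              HardyProblem.HasSingularBoundaryLimit R μ p v → EqOn v u (ball 0 R))) := by
  let D : HardyProblem.Params := ⟨N, R, p, μ, hN, hR, hp, hμ_lower, hμ_upper, hμ_ne⟩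
  refine ⟨D.uStar, D.uStar_pos, fun a ha hle => ?_, fun a ha => ?_, fun u hu hlt => ?_,
    fun c hc => ?_, fun u hu hu0 => ?_⟩
  · exact ⟨D.u a, D.isRadialSolution_global ha (D.life_of_le_uStar hle), D.u_zero ha.le,
      fun v hv hva => (D.radial_unique hR le_rfl hv hva).2⟩
  · have ha0 := D.uStar_pos.trans ha
    have hlt := D.life_lt_of_uStar_lt ha
    exact ⟨D.life a, D.life_pos a, hlt, D.u a, D.isRadialSolution_u ha0, D.u_zero ha0.le,
      D.tendsto_comp_norm (D.tendsto_U_atTop hlt),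
      fun σ v h0 hσ hv hva => D.radial_unique h0 hσ hv hva⟩
  · obtain ⟨h0, -, heq⟩ := D.eqOn_of_global hu
    obtain ⟨c, hc, hlim⟩ := D.exists_tendsto_lin h0 hlt
    exact ⟨c, hc, (D.hasLinearBoundaryLimit_congr heq).2 (D.hasLinearBoundaryLimit_u.2 hlim)⟩
  · obtain ⟨a, ha, hau, hlim⟩ := D.exists_lin_limit_eq hc
    have hlife := D.life_of_lt_uStar hau
    refine ⟨D.u a, D.isRadialSolution_global ha hlife, (D.u_zero ha.le).trans_lt hau,
      D.hasLinearBoundaryLimit_u.2 hlim, fun v hv hvlim => ?_⟩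
    obtain ⟨h0, hl, heq⟩ := D.eqOn_of_global hv
    have hvlim' := D.hasLinearBoundaryLimit_u.1 ((D.hasLinearBoundaryLimit_congr heq).1 hvlim)
    rwa [D.eq_of_lin_limit h0 ha hl hlife hc hvlim' hlim] at heq
  · have heq : EqOn u (D.u D.uStar) (ball 0 R) := (D.radial_unique hR le_rfl hu hu0).2
    refine ⟨?_, fun v hv x hx => ?_, fun v hv hlim x hx => ?_⟩
    · refine (tendsto_congr' ?_).2 D.hasSingularBoundaryLimit_uStar
      filter_upwards [D.eventually_mem_ball hR] with x hx
      rw [heq hx]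
    · rw [heq hx]
      exact D.le_u_uStar hv x hx
    · rw [heq hx]
      exact (D.le_u_uStar hv x hx).antisymm (D.u_uStar_le hv hlim x hx)
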